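/- \textbf{Setting.} A free algebra $\mathbb{A}$ is a finite list of constructors $c_1,\dots,c_{k(\mathbb{A})}$ with arities $\mathcal{R}(c_i)\in\mathbb{N}$; it is a word algebra if exactly one constructor has arity $0$ and all others have arity $1$. Fix a finite family $\mathscr{A}$ of free algebras. $|t|$ denotes the number of constructors in a free algebra term $t$. Types are $A::=\mathbb{A}^i\mid A\multimap A$ with $\mathbb{A}\in\mathscr{A}$, $i\in\mathbb{N}$; $A\multimap^0B=B$, $A\multimap^{n+1}B=A\multimap(A\multimap^nB)$; the level $V(A)$ is the largest index $i$ occurring in $A$. Terms are $M::=x\mid c\mid MM\mid\lambda x.M\mid M\{\!\{M_1,\dots,M_k\}\!\}\mid M\langle\!\langle M_1,\dots,M_k\rangle\!\rangle$ (conditional and recursion), up to renaming of bound variables, with size $|x|=|c|=1$, $|\lambda x.M|=|M|+1$, $|MN|=|M|+|N|$, $|M\{\!\{M_1,\dots,M_k\}\!\}|=|M\langle\!\langle M_1,\dots,M_k\rangle\!\rangle|=|M|+\sum_i|M_i|+k$. Contexts are finite sets of declarations $x:A$ of distinct variables; a comma is a union with disjoint domains. The typing rules of $\mathsf{RH}(\mathsf{W})$,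 where $\mathsf{W}=\{\mathbb{A}^i\mid\mathbb{A}\in\mathscr{A}\text{ a word algebra}\}$, are: \begin{itemize} \item axiom $x:A\vdash x:A$; weakening: from $\Gamma\vdash M:B$ infer $\Gamma,x:A\vdash M:B$; contraction: from $\Gamma,x:A,y:A\vdash M:B$ infer $\Gamma,z:A\vdash M\{z/x,z/y\}:B$, provided $A\in\mathsf{W}$; \item from $\Gamma,x:A\vdash M:B$ infer $\Gamma\vdash\lambda x.M:A\multimap B$; from $\Gamma\vdash M:A\multimap B$ and $\Delta\vdash N:A$ infer $\Gamma,\Delta\vdash MN:B$; $\vdash c:\mathbb{A}^i\multimap^{\mathcal{R}(c)}\mathbb{A}^i$ for every constructor $c$ of $\mathbb{A}$; \item conditional: from $\Delta\vdash L:\mathbb{A}^m$ and $\Gamma_i\vdash M_i:\mathbb{A}^m\multimap^{\mathcal{R}(c_i)}C$ for $1\le i\le k(\mathbb{A})$ infer $\Gamma_1,\dots,\Gamma_{k(\mathbb{A})},\Delta\vdash L\{\!\{M_1,\dots,M_{k(\mathbb{A})}\}\!\}:C$; \item recursion: from $\Delta\vdash L:\mathbb{A}^m$ and $\Gamma_i\vdash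 M_i:\mathbb{A}^m\multimap^{\mathcal{R}(c_i)}(C\multimap^{\mathcal{R}(c_i)}C)$ for $1\le i\le k(\mathbb{A})$ infer $\Gamma_1,\dots,\Gamma_{k(\mathbb{A})},\Delta\vdash L\langle\!\langle M_1,\dots,M_{k(\mathbb{A})}\rangle\!\rangle:C$, provided all types in the $\Gamma_i$ are in $\mathsf{W}$ and $m>V(C)$. \end{itemize} For a derivation $\pi$, the recursion depth $R(\pi)$ is the largest number of recursion rules on a path from the root to a leaf, and the highest tier $I(\pi)$ is the largest $m$ in an instance of the recursion rule in $\pi$ ($0$ if there is none). \textbf{Interaction graphs.} The graph $G=G_\pi$ of $\pi$ is built along $\pi$. It has a directed edge for each declaration of the context of its conclusion, and a directed conclusion edge; edges are labelled by types. An axiom is one edge from the premise to the conclusion; in every other rule the conclusion edges and premise edges of the subgraphs are attached as follows. Weakening adds a vertex $W$ entered by the edge of $x$. Contraction adds a vertex $X$ entered by the edge $h$ of $z$ and left by the edges $e,g$ of $x,y$. Abstraction adds $I_\multimap$ left by the edge $e:A$ of $x$ and by the conclusion $h:A\multimap B$, and entered by $g:B$ from the body. Application adds $E_\multimap$ entered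 by $e:A\multimap B$ from the function and $g:A$ from the argument, left by $h:B$. A constructor $c$ is a vertex $I^c_{\mathbb{A}}$ left by one edge. A conditional adds $C^N_{\mathbb{A}}$ entered by $e_0:\mathbb{A}^m$ from $L$ and by $e_i$ from $M_i$, left by $g:C$. A recursion adds in the same way $v$ labelled $C^R_{\mathbb{A}}$ with edges $e_0,e_i,g$, and for each declaration of each $\Gamma_i$ a vertex $P^R_{\mathbb{A}}$ entered by the outer edge and left by the edge inside; all edges of the graphs of the $M_i$ form the box of $v$. $\rho(v)=e_0$, and $\theta(e)$ is the $C^R$-vertex of the innermost box containing $e$, if any. \textbf{Context semantics.} Term contexts $u$ are algebra terms with one hole $[\cdot]$; type contexts are $L::=[\cdot]\mid L\multimap A\mid A\multimap L$, where $[\cdot]$ is positive, $A\multimap L$ has the polarity of $L$ and $L\multimap A$ the opposite one; $L$ is a focus for $A$ if $A=L[\mathbb{A}^i]$ for some $\mathbb{A}^i$. Labels are tuples $(t,e,U,L)$ with $t$ a term of an algebra of $\mathscr{A}$, $e$ an edge, $U$ a finite sequence (stack) of triples $(u,s,v)$ ($u$ a term context, $s$ a term of the same algebra, $v$ a vertex),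 $L$ a type context. For a finite tree $T$ of labels, $L(T)$ is the term in the root label. If $L(T)=u[s]$, then $B(T,u,s)$ is the smallest subtree of $T$ whose root carries the occurrence of $s$ singled out by $u$. $T(G)$ is the smallest set of finite trees closed under the following rules, where $l\leftarrow l_1,\dots,l_k$ means that trees of $T(G)$ with root labels $l_1,\dots,l_k$ may be joined below a new root $l$, where $P_A$ ($N_A$) ranges over positive (negative) focuses for $A$, and where, for $1\le j\le r$, $\mathrm{arg}^r_j(A,L,B)=A\multimap^{j-1}(L\multimap(A\multimap^{r-j}B))$: \begin{itemize} \item $I_\multimap$: $(t,e,U,P_A)\leftarrow(t,h,U,P_A\multimap B)$; $(t,h,U,N_A\multimap B)\leftarrow(t,e,U,N_A)$; $(t,h,U,A\multimap P_B)\leftarrow(t,g,U,P_B)$; $(t,g,U,N_B)\leftarrow(t,h,U,A\multimap N_B)$. \item $E_\multimap$: $(t,e,U,P_A\multimap B)\leftarrow(t,g,U,P_A)$; $(t,g,U,N_A)\leftarrow(t,e,U,N_A\multimap B)$; $(t,e,U,A\multimap N_B)\leftarrow(t,h,U,N_B)$; $(t,h,U,P_B)\leftarrow(t,e,U,A\multimap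 P_B)$. \item $X$: $(t,e,U,[\cdot])\leftarrow(t,h,U,[\cdot])$ and $(t,g,U,[\cdot])\leftarrow(t,h,U,[\cdot])$. \item $I^c_{\mathbb{A}}$ with edge $e$, $\mathcal{R}(c)=0$: $(c,e,\varepsilon,[\cdot])\leftarrow$ if $\theta(e)$ is undefined; $(c,e,(u,t,v)U,[\cdot])\leftarrow$ if $\theta(e)=v$ and some tree in $T(G)$ has root $(u[t],\rho(v),U,[\cdot])$. \item $I^c_{\mathbb{A}}$ with edge $e$ of type $\mathbb{A}^i\multimap^r\mathbb{A}^i$, $r=\mathcal{R}(c)>0$: $(ct_1\cdots t_r,e,U,\mathbb{A}^i\multimap^r[\cdot])\leftarrow(t_j,e,U,\mathrm{arg}^r_j(\mathbb{A}^i,[\cdot],\mathbb{A}^i))_{1\le j\le r}$. \item $C^N_{\mathbb{A}}$, if $T\in T(G)$ has root $(c_it_1\cdots t_r,e_0,U,[\cdot])$: $(t,g,U,P_C)\leftarrow(t,e_i,U,\mathbb{A}^m\multimap^rP_C)$; $(t,e_i,U,\mathbb{A}^m\multimap^rN_C)\leftarrow(t,g,U,N_C)$; and, with $S_j=B(T,c_it_1\cdots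 t_{j-1}[\cdot]t_{j+1}\cdots t_r,t_j)$, the tree with root $(t_j,e_i,U,\mathrm{arg}^r_j(\mathbb{A}^m,[\cdot],C))$ and only immediate subtree $S_j$ is in $T(G)$. \item $v$ labelled $C^R_{\mathbb{A}}$, if $T\in T(G)$ has root $(u[s],e_0,U,[\cdot])$, $s=c_it_1\cdots t_r$, and $u_j=u[c_it_1\cdots t_{j-1}[\cdot]t_{j+1}\cdots t_r]$: for $t_k=c_js_1\cdots s_q$, $(r',e_i,(u,s,v)U,\mathbb{A}^m\multimap^r\mathrm{arg}^r_k(C,P_C,C))\leftarrow(r',e_j,(u_k,t_k,v)U,\mathbb{A}^m\multimap^q(C\multimap^qP_C))$ and $(r',e_j,(u_k,t_k,v)U,\mathbb{A}^m\multimap^q(C\multimap^qN_C))\leftarrow(r',e_i,(u,s,v)U,\mathbb{A}^m\multimap^r\mathrm{arg}^r_k(C,N_C,C))$; if $u=[\cdot]$, $(r',g,U,P_C)\leftarrow(r',e_i,([\cdot],s,v)U,\mathbb{A}^m\multimap^r(C\multimap^rP_C))$ and $(r',e_i,([\cdot],s,v)U,\mathbb{A}^m\multimap^r(C\multimap^rN_C))\leftarrow(r',g,U,N_C)$;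 and the tree with root $(t_j,e_i,(u,s,v)U,\mathrm{arg}^r_j(\mathbb{A}^m,[\cdot],C\multimap^rC))$ and only immediate subtree $B(T,u_j,t_j)$ is in $T(G)$, for $1\le j\le r$. \item $P^R_{\mathbb{A}}$ with outer edge $e$ and inner edge $g$, $\theta(g)=v$, if some tree in $T(G)$ has root $(u[s],\rho(v),U,[\cdot])$: $(t,g,(u,s,v)U,[\cdot])\leftarrow(t,e,U,[\cdot])$. \end{itemize} \textbf{Theorem.} For all $d,e\in\mathbb{N}$ there are polynomials $p^d_e:\mathbb{N}\to\mathbb{N}$ (depending only on $d$, $e$ and $\mathscr{A}$) such that for every type derivation $\pi:\Gamma\vdash M:A$ in $\mathsf{RH}(\mathsf{W})$ and every tree $T\in T(G_\pi)$, $$|L(T)|\le p^{I(\pi)}_{R(\pi)}(|M|).$$ -/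

import Mathlib

namespace LinRec

/-! ### Free algebras, their terms and term contexts -/

/-- A free algebra: `k` constructors `c₁, …, c_k`, each with an arity. -/
structure FreeAlg where
  k : ℕ
  arity : Fin k → ℕ

/-- Word algebras: exactly one constructor of arity `0`, all the others of arity `1`. -/
def FreeAlg.IsWord (B : FreeAlg) : Prop :=
  ∃ i, B.arity i = 0 ∧ ∀ j, j ≠ i → B.arity j = 1

/-- Terms of a free algebra. -/
inductive AlgTerm (B : FreeAlg) : Type
  | mk (c : Fin B.k) (ts : Fin (B.arity c) → AlgTerm B) : AlgTerm B

/-- The number of constructors in a term of a free algebra. -/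
def AlgTerm.size {B : FreeAlg} : AlgTerm B → ℕ
  | .mk _ ts => 1 + ∑ j, (ts j).size

/-- Term contexts: terms with exactly one hole. In `node c j ts u` the hole is in the argument
at position `j`, which is `u`; the other arguments are given by `ts`. -/
inductive AlgCtx (B : FreeAlg) : Type
  | hole : AlgCtx B
  | node (c : Fin B.k) (j : Fin (B.arity c)) (ts : {l // l ≠ j} → AlgTerm B) (u : AlgCtx B) :
      AlgCtx B

/-- `u[t]` for a context `u` and a term `t`. -/
def AlgCtx.plug {B : FreeAlg} : AlgCtx B → AlgTerm B → AlgTerm B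
  | .hole, t => t
  | .node c j ts u, t => .mk c fun l => if h : l = j then u.plug t else ts ⟨l, h⟩

/-- `u[w]` for contexts `u` and `w`. -/
def AlgCtx.comp {B : FreeAlg} : AlgCtx B → AlgCtx B → AlgCtx B
  | .hole, w => w
  | .node c j ts u, w => .node c j ts (u.comp w)

/-- The context `c t₁ … t_{j-1} [·] t_{j+1} … t_n`. -/
def AlgCtx.arg {B : FreeAlg} (c : Fin B.k) (ts : Fin (B.arity c) → AlgTerm B)
    (j : Fin (B.arity c)) : AlgCtx B :=
  .node c j (fun l => ts l) .hole

/-! ### Types and type contexts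

A finite family of free algebras is given as `𝒜 : Fin n → FreeAlg`. -/

/-- Types: `base a i` is the base type `𝔸^i` for the algebra `𝔸 = 𝒜 a` at tier `i`; `arr` is the
linear arrow. -/
inductive Ty {n : ℕ} (𝒜 : Fin n → FreeAlg) : Type
  | base (a : Fin n) (i : ℕ) : Ty 𝒜
  | arr (A B : Ty 𝒜) : Ty 𝒜

/-- `A ⊸ⁿ B`. -/
def Ty.arrows {n : ℕ} {𝒜 : Fin n → FreeAlg} : ℕ → Ty 𝒜 → Ty 𝒜 → Ty 𝒜
  | 0, _, B => B
  | r + 1, A, B => .arr A (arrows r A B)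

/-- The level of a type. -/
def Ty.level {n : ℕ} {𝒜 : Fin n → FreeAlg} : Ty 𝒜 → ℕ
  | .base _ i => i
  | .arr A B => max A.level B.level

/-- Type contexts: `left L A` is `L ⊸ A` and `right A L` is `A ⊸ L`. -/
inductive TyCtx {n : ℕ} (𝒜 : Fin n → FreeAlg) : Type
  | hole : TyCtx 𝒜
  | left (L : TyCtx 𝒜) (A : Ty 𝒜) : TyCtx 𝒜
  | right (A : Ty 𝒜) (L : TyCtx 𝒜) : TyCtx 𝒜

/-- `L[A]`. -/
def TyCtx.fill {n : ℕ} {𝒜 : Fin n → FreeAlg} : TyCtx 𝒜 → Ty 𝒜 → Ty 𝒜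
  | .hole, X => X
  | .left L A, X => .arr (L.fill X) A
  | .right A L, X => .arr A (L.fill X)

/-- The polarity of a type context: `true` for positive, `false` for negative. -/
def TyCtx.positive {n : ℕ} {𝒜 : Fin n → FreeAlg} : TyCtx 𝒜 → Bool
  | .hole => true
  | .left L _ => !L.positive
  | .right _ L => L.positive

/-- `A ⊸ʳ L` for a type context `L`. -/
def TyCtx.arrows {n : ℕ} {𝒜 : Fin n → FreeAlg} : ℕ → Ty 𝒜 → TyCtx 𝒜 → TyCtx 𝒜
  | 0, _, L => L
  | r + 1, A, L => .right A (arrows r A L)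

/-- `A ⊸ʲ (L ⊸ (A ⊸^(r-j-1) B))`: the `j`-th (from zero) of `r` argument positions. -/
def TyCtx.argAt {n : ℕ} {𝒜 : Fin n → FreeAlg} {r : ℕ} (A : Ty 𝒜) (j : Fin r) (L : TyCtx 𝒜)
    (B : Ty 𝒜) : TyCtx 𝒜 :=
  TyCtx.arrows j A (.left L (Ty.arrows (r - j - 1) A B))

/-- `L` is a focus for `A` if `A = L[𝔸^i]` for some base type `𝔸^i`. -/
def TyCtx.IsFocus {n : ℕ} {𝒜 : Fin n → FreeAlg} (L : TyCtx 𝒜) (A : Ty 𝒜) : Prop :=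
  ∃ a i, A = L.fill (.base a i)

def TyCtx.PosFocus {n : ℕ} {𝒜 : Fin n → FreeAlg} (L : TyCtx 𝒜) (A : Ty 𝒜) : Prop :=
  L.positive = true ∧ L.IsFocus A

def TyCtx.NegFocus {n : ℕ} {𝒜 : Fin n → FreeAlg} (L : TyCtx 𝒜) (A : Ty 𝒜) : Prop :=
  L.positive = false ∧ L.IsFocus A

/-! ### Terms of the lambda calculus -/

/-- Terms up to renaming of bound variables, with de Bruijn indices: below `d` abstractions, the
indices `0, …, d - 1` are bound and `d + x` is the free variable `x`.
`cond L M` is the conditional `L {{M₁, …, M_k}}` and `recur L M` the recursion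
`L ⟪M₁, …, M_k⟫`. -/
inductive Term {n : ℕ} (𝒜 : Fin n → FreeAlg) : Type
  | var (x : ℕ) : Term 𝒜
  | con (a : Fin n) (c : Fin (𝒜 a).k) : Term 𝒜
  | app (M N : Term 𝒜) : Term 𝒜
  | lam (M : Term 𝒜) : Term 𝒜
  | cond {k : ℕ} (L : Term 𝒜) (M : Fin k → Term 𝒜) : Term 𝒜
  | recur {k : ℕ} (L : Term 𝒜) (M : Fin k → Term 𝒜) : Term 𝒜

/-- The size `|M|` of a term. -/
def Term.size {n : ℕ} {𝒜 : Fin n → FreeAlg} : Term 𝒜 → ℕ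
  | .var _ => 1
  | .con _ _ => 1
  | .app M N => M.size + N.size
  | .lam M => M.size + 1
  | .cond (k := k) L M => L.size + ∑ i, (M i).size + k
  | .recur (k := k) L M => L.size + ∑ i, (M i).size + k

/-- Extension of a renaming below an abstraction. -/
def liftRen (σ : ℕ → ℕ) : ℕ → ℕ
  | 0 => 0
  | x + 1 => σ x + 1

/-- Capture-avoiding renaming of the free variables. -/
def Term.rename {n : ℕ} {𝒜 : Fin n → FreeAlg} : (ℕ → ℕ) → Term 𝒜 → Term 𝒜
  | σ, .var x => .var (σ x)
  | _, .con a c => .con a c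
  | σ, .app M N => .app (M.rename σ) (N.rename σ)
  | σ, .lam M => .lam (M.rename (liftRen σ))
  | σ, .cond L M => .cond (L.rename σ) fun i => (M i).rename σ
  | σ, .recur L M => .recur (L.rename σ) fun i => (M i).rename σ

/-- `M{z/x, z/y}`. -/
def Term.contract {n : ℕ} {𝒜 : Fin n → FreeAlg} (M : Term 𝒜) (x y z : ℕ) : Term 𝒜 :=
  M.rename fun w => if w = x ∨ w = y then z else w

/-! ### Typing contexts -/

/-- Typing contexts: partial functions from variables to types (all those that occur in type
derivations are finite). -/
abbrev Ctx {n : ℕ} (𝒜 : Fin n → FreeAlg) : Type := ℕ → Option (Ty 𝒜)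

/-- The variables declared in a context. -/
abbrev Ctx.Dom {n : ℕ} {𝒜 : Fin n → FreeAlg} (Γ : Ctx 𝒜) : Type := {x : ℕ // (Γ x).isSome = true}

def Ctx.empty {n : ℕ} {𝒜 : Fin n → FreeAlg} : Ctx 𝒜 := fun _ => none

/-- `Γ, x : A` (used for `x` not declared in `Γ`). -/
def Ctx.insert {n : ℕ} {𝒜 : Fin n → FreeAlg} (Γ : Ctx 𝒜) (x : ℕ) (A : Ty 𝒜) : Ctx 𝒜 :=
  fun w => if w = x then some A else Γ w

/-- `Γ, x : A` below an abstraction of `x`: index `0` is `x`, the others are shifted. -/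
def Ctx.cons {n : ℕ} {𝒜 : Fin n → FreeAlg} (Γ : Ctx 𝒜) (A : Ty 𝒜) : Ctx 𝒜
  | 0 => some A
  | x + 1 => Γ x

/-- `Γ` is `Γ₁, Γ₂`, the union of contexts with disjoint domains. -/
def Ctx.Union {n : ℕ} {𝒜 : Fin n → FreeAlg} (Γ₁ Γ₂ Γ : Ctx 𝒜) : Prop :=
  (∀ x, Γ₁ x = none ∨ Γ₂ x = none) ∧ ∀ x A, Γ x = some A ↔ Γ₁ x = some A ∨ Γ₂ x = some A

/-- `Γ` is `Γ₁, …, Γ_k, Δ`, the union of contexts with pairwise disjoint domains. -/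
def Ctx.UnionAll {n : ℕ} {𝒜 : Fin n → FreeAlg} {k : ℕ} (Γs : Fin k → Ctx 𝒜) (Δ Γ : Ctx 𝒜) :
    Prop :=
  (∀ i j, i ≠ j → ∀ x, Γs i x = none ∨ Γs j x = none) ∧
  (∀ i x, Γs i x = none ∨ Δ x = none) ∧
  ∀ x A, Γ x = some A ↔ (∃ i, Γs i x = some A) ∨ Δ x = some A

theorem Ctx.Union.left {n : ℕ} {𝒜 : Fin n → FreeAlg} {Γ₁ Γ₂ Γ : Ctx 𝒜} (h : Ctx.Union Γ₁ Γ₂ Γ)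
    (x : ℕ) (hx : (Γ₁ x).isSome = true) : (Γ x).isSome = true := by
  obtain ⟨A, hA⟩ := Option.isSome_iff_exists.mp hx
  exact Option.isSome_iff_exists.mpr ⟨A, (h.2 x A).mpr (Or.inl hA)⟩

theorem Ctx.Union.right {n : ℕ} {𝒜 : Fin n → FreeAlg} {Γ₁ Γ₂ Γ : Ctx 𝒜} (h : Ctx.Union Γ₁ Γ₂ Γ)
    (x : ℕ) (hx : (Γ₂ x).isSome = true) : (Γ x).isSome = true := by
  obtain ⟨A, hA⟩ := Option.isSome_iff_exists.mp hx
  exact Option.isSome_iff_exists.mpr ⟨A, (h.2 x A).mpr (Or.inr hA)⟩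

theorem Ctx.UnionAll.branch {n : ℕ} {𝒜 : Fin n → FreeAlg} {k : ℕ} {Γs : Fin k → Ctx 𝒜}
    {Δ Γ : Ctx 𝒜} (h : Ctx.UnionAll Γs Δ Γ) (i : Fin k) (x : ℕ)
    (hx : (Γs i x).isSome = true) : (Γ x).isSome = true := by
  obtain ⟨A, hA⟩ := Option.isSome_iff_exists.mp hx
  exact Option.isSome_iff_exists.mpr ⟨A, (h.2.2 x A).mpr (Or.inl ⟨i, hA⟩)⟩

theorem Ctx.UnionAll.main {n : ℕ} {𝒜 : Fin n → FreeAlg} {k : ℕ} {Γs : Fin k → Ctx 𝒜}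
    {Δ Γ : Ctx 𝒜} (h : Ctx.UnionAll Γs Δ Γ) (x : ℕ)
    (hx : (Δ x).isSome = true) : (Γ x).isSome = true := by
  obtain ⟨A, hA⟩ := Option.isSome_iff_exists.mp hx
  exact Option.isSome_iff_exists.mpr ⟨A, (h.2.2 x A).mpr (Or.inr hA)⟩

theorem Ctx.isSome_insert_self {n : ℕ} {𝒜 : Fin n → FreeAlg} (Γ : Ctx 𝒜) (x : ℕ) (A : Ty 𝒜) :
    (Γ.insert x A x).isSome = true := by
  simp [Ctx.insert]

theorem Ctx.isSome_insert {n : ℕ} {𝒜 : Fin n → FreeAlg} (Γ : Ctx 𝒜) (x : ℕ) (A : Ty 𝒜) (w : ℕ)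
    (hw : (Γ w).isSome = true) : (Γ.insert x A w).isSome = true := by
  by_cases h : w = x
  · simp [Ctx.insert, h]
  · simpa [Ctx.insert, h] using hw

theorem Ctx.isSome_of_insert {n : ℕ} {𝒜 : Fin n → FreeAlg} (Γ : Ctx 𝒜) (x : ℕ) (A : Ty 𝒜)
    (w : ℕ) (hne : w ≠ x) (hw : (Γ.insert x A w).isSome = true) : (Γ w).isSome = true := by
  simpa [Ctx.insert, hne] using hw

/-! ### Type systems and type derivations -/

/-- The subsystems: contraction (and the contexts of the branches of recursions) are limited to the
types in `dup`, and if `ramified` holds then the ramification condition is imposed. -/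
structure System {n : ℕ} (𝒜 : Fin n → FreeAlg) where
  dup : Set (Ty 𝒜)
  ramified : Prop

/-- The system `H(D)`. -/
def H {n : ℕ} {𝒜 : Fin n → FreeAlg} (D : Set (Ty 𝒜)) : System 𝒜 := ⟨D, False⟩

/-- The ramified system `RH(D)`. -/
def RH {n : ℕ} {𝒜 : Fin n → FreeAlg} (D : Set (Ty 𝒜)) : System 𝒜 := ⟨D, True⟩

/-- `W`, the class of the types `𝔸^i` where `𝔸` is a word algebra. -/
def wordTypes {n : ℕ} (𝒜 : Fin n → FreeAlg) : Set (Ty 𝒜) :=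
  {A | ∃ a i, (𝒜 a).IsWord ∧ A = .base a i}

/-- Type derivations `π : Γ ⊢ M : A`. -/
inductive Deriv {n : ℕ} {𝒜 : Fin n → FreeAlg} (S : System 𝒜) :
    Ctx 𝒜 → Term 𝒜 → Ty 𝒜 → Type
  | ax {Γ' : Ctx 𝒜} (x : ℕ) (A : Ty 𝒜) (hΓ' : Γ' = Ctx.empty.insert x A) :
      Deriv S Γ' (.var x) A
  | weak {Γ Γ' : Ctx 𝒜} {M : Term 𝒜} {B : Ty 𝒜} (x : ℕ) (A : Ty 𝒜) (hx : Γ x = none)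
      (hΓ' : Γ' = Γ.insert x A) (d : Deriv S Γ M B) : Deriv S Γ' M B
  | contr {Γ Γ' Γ'' : Ctx 𝒜} {M M' : Term 𝒜} {B : Ty 𝒜} (x y z : ℕ) (A : Ty 𝒜) (hxy : x ≠ y)
      (hx : Γ x = none) (hy : Γ y = none) (hz : Γ z = none) (hA : A ∈ S.dup)
      (hΓ'' : Γ'' = (Γ.insert x A).insert y A) (hΓ' : Γ' = Γ.insert z A)
      (hM' : M' = M.contract x y z) (d : Deriv S Γ'' M B) : Deriv S Γ' M' B
  | lam {Γ : Ctx 𝒜} {M : Term 𝒜} {A B : Ty 𝒜} (d : Deriv S (Γ.cons A) M B) :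
      Deriv S Γ (.lam M) (.arr A B)
  | app {Γ Γ₁ Γ₂ : Ctx 𝒜} {M N : Term 𝒜} {A B : Ty 𝒜} (hΓ : Ctx.Union Γ₁ Γ₂ Γ)
      (d₁ : Deriv S Γ₁ M (.arr A B)) (d₂ : Deriv S Γ₂ N A) : Deriv S Γ (.app M N) B
  | con {Γ' : Ctx 𝒜} (a : Fin n) (c : Fin (𝒜 a).k) (i : ℕ) (hΓ' : Γ' = Ctx.empty) :
      Deriv S Γ' (.con a c) (Ty.arrows ((𝒜 a).arity c) (.base a i) (.base a i))
  | cond {a : Fin n} {m : ℕ} {Γs : Fin (𝒜 a).k → Ctx 𝒜} {Δ Γ : Ctx 𝒜} {L : Term 𝒜}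
      {M : Fin (𝒜 a).k → Term 𝒜} {C : Ty 𝒜} (hΓ : Ctx.UnionAll Γs Δ Γ)
      (ds : ∀ i, Deriv S (Γs i) (M i) (Ty.arrows ((𝒜 a).arity i) (.base a m) C))
      (d : Deriv S Δ L (.base a m)) : Deriv S Γ (.cond L M) C
  | recur {a : Fin n} {m : ℕ} {Γs : Fin (𝒜 a).k → Ctx 𝒜} {Δ Γ : Ctx 𝒜} {L : Term 𝒜}
      {M : Fin (𝒜 a).k → Term 𝒜} {C : Ty 𝒜} (hΓ : Ctx.UnionAll Γs Δ Γ)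
      (hdup : ∀ i x A, Γs i x = some A → A ∈ S.dup)
      (hram : S.ramified → C.level < m)
      (ds : ∀ i, Deriv S (Γs i) (M i)
        (Ty.arrows ((𝒜 a).arity i) (.base a m) (Ty.arrows ((𝒜 a).arity i) C C)))
      (d : Deriv S Δ L (.base a m)) : Deriv S Γ (.recur L M) C

/-- The recursion depth `R(π)`: the biggest number of instances of the recursion rule on a path
from the root to a leaf. -/
def Deriv.recDepth {n : ℕ} {𝒜 : Fin n → FreeAlg} {S : System 𝒜} {Γ : Ctx 𝒜} {M : Term 𝒜}
    {A : Ty 𝒜} : Deriv S Γ M A → ℕ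
  | .ax _ _ _ => 0
  | .weak _ _ _ _ d => d.recDepth
  | .contr _ _ _ _ _ _ _ _ _ _ _ _ d => d.recDepth
  | .lam d => d.recDepth
  | .app _ d₁ d₂ => max d₁.recDepth d₂.recDepth
  | .con _ _ _ _ => 0
  | .cond _ ds d => max (Finset.univ.sup fun i => (ds i).recDepth) d.recDepth
  | .recur _ _ _ ds d => 1 + max (Finset.univ.sup fun i => (ds i).recDepth) d.recDepth

/-- The highest tier `I(π)`: the maximum tier of the recurrence argument in an instance of the
recursion rule (`0` if there is no such instance). -/
def Deriv.highTier {n : ℕ} {𝒜 : Fin n → FreeAlg} {S : System 𝒜} {Γ : Ctx 𝒜} {M : Term 𝒜}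
    {A : Ty 𝒜} : Deriv S Γ M A → ℕ
  | .ax _ _ _ => 0
  | .weak _ _ _ _ d => d.highTier
  | .contr _ _ _ _ _ _ _ _ _ _ _ _ d => d.highTier
  | .lam d => d.highTier
  | .app _ d₁ d₂ => max d₁.highTier d₂.highTier
  | .con _ _ _ _ => 0
  | .cond _ ds d => max (Finset.univ.sup fun i => (ds i).highTier) d.highTier
  | .recur (m := m) _ _ _ ds d =>
      max m (max (Finset.univ.sup fun i => (ds i).highTier) d.highTier)

/-! ### Interaction graphs

Every edge of an interaction graph leaves either a premise of the graph or an internal vertex. An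
interaction graph with premises `Γ` is given by its internal vertices, the internal edges (those
that leave internal vertices) and, for every internal vertex, its label together with the edges
incident to it; its set of edges is `Γ.Dom ⊕ E`. The vertices labelled `P` (the sources of the
edges in `Γ.Dom`) and the vertex labelled `C` (the target of the edge `out`) induce no closure
condition, so they are left implicit. Plugging the conclusion of a graph into a premise
of another one identifies the two edges. -/

/-- The labels of vertices, with the incident edges. -/
inductive Node {n : ℕ} (𝒜 : Fin n → FreeAlg) (E : Type) : Type
  /-- `W`, with incoming edge `e`. -/
  | weak (e : E) : Node 𝒜 E
  /-- `X`, with incoming edge `h` and outgoing edges `e`, `g`. -/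
  | dup (e g h : E) : Node 𝒜 E
  /-- `I_⊸`: outgoing edge `e` for the variable, incoming edge `g` from the body, outgoing
  conclusion `h`. -/
  | lam (e g h : E) : Node 𝒜 E
  /-- `E_⊸`: incoming edges `e` from the function and `g` from the argument, outgoing
  conclusion `h`. -/
  | app (e g h : E) : Node 𝒜 E
  /-- `I^c_𝔸`, with outgoing edge `e`. -/
  | con (a : Fin n) (c : Fin (𝒜 a).k) (e : E) : Node 𝒜 E
  /-- `C^N_𝔸`: incoming edges `e₀` from the argument and `es i` from the branches, outgoing
  conclusion `g`. -/
  | cond (a : Fin n) (e₀ : E) (es : Fin (𝒜 a).k → E) (g : E) : Node 𝒜 E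
  /-- `C^R_𝔸`: incoming edges `e₀` (the recursive premise) and `es i` from the branches, outgoing
  conclusion `g`. -/
  | recur (a : Fin n) (e₀ : E) (es : Fin (𝒜 a).k → E) (g : E) : Node 𝒜 E
  /-- `P^R_𝔸`: incoming edge `e`, outgoing edge `g` into the box. -/
  | boxPrem (a : Fin n) (e g : E) : Node 𝒜 E

def Node.map {n : ℕ} {𝒜 : Fin n → FreeAlg} {E F : Type} (f : E → F) : Node 𝒜 E → Node 𝒜 F
  | .weak e => .weak (f e)
  | .dup e g h => .dup (f e) (f g) (f h)
  | .lam e g h => .lam (f e) (f g) (f h)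
  | .app e g h => .app (f e) (f g) (f h)
  | .con a c e => .con a c (f e)
  | .cond a e₀ es g => .cond a (f e₀) (fun i => f (es i)) (f g)
  | .recur a e₀ es g => .recur a (f e₀) (fun i => f (es i)) (f g)
  | .boxPrem a e g => .boxPrem a (f e) (f g)

/-- Graphs with premises `Γ`: `ty` gives the types of the internal edges, `box e` is the vertex
`C^R` that delimits the innermost box in which the internal edge `e` is contained, if any. -/
structure IGraph {n : ℕ} {𝒜 : Fin n → FreeAlg} (Γ : Ctx 𝒜) where
  V : Type
  E : Type
  node : V → Node 𝒜 (Γ.Dom ⊕ E)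
  ty : E → Ty 𝒜
  box : E → Option V
  out : Γ.Dom ⊕ E

/-- The set of edges. -/
abbrev IGraph.Edge {n : ℕ} {𝒜 : Fin n → FreeAlg} {Γ : Ctx 𝒜} (G : IGraph Γ) : Type :=
  Γ.Dom ⊕ G.E

/-- The type of an edge. -/
def IGraph.edgeTy {n : ℕ} {𝒜 : Fin n → FreeAlg} {Γ : Ctx 𝒜} (G : IGraph Γ) : G.Edge → Ty 𝒜
  | .inl x => (Γ x.1).get x.2
  | .inr e => G.ty e

/-- The box-premise `θ_G(e)` of an edge. -/
def IGraph.boxPremise {n : ℕ} {𝒜 : Fin n → FreeAlg} {Γ : Ctx 𝒜} (G : IGraph Γ) :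
    G.Edge → Option G.V
  | .inl _ => none
  | .inr e => G.box e

/-- `ρ_G(v) = e`: the vertex `v` has label `C^R_𝔸` for some `𝔸`, and its recursive premise
is `e`. -/
def IGraph.RecPremise {n : ℕ} {𝒜 : Fin n → FreeAlg} {Γ : Ctx 𝒜} (G : IGraph Γ) (v : G.V)
    (e : G.Edge) : Prop :=
  ∃ a es g, G.node v = .recur a e es g

/-- The graph of an axiom: one edge from the premise to the conclusion. -/
def IGraph.ax {n : ℕ} {𝒜 : Fin n → FreeAlg} {Γ' : Ctx 𝒜} (x : ℕ) (A : Ty 𝒜)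
    (hΓ' : Γ' = Ctx.empty.insert x A) : IGraph Γ' where
  V := Empty
  E := Empty
  node := Empty.elim
  ty := Empty.elim
  box := Empty.elim
  out := .inl ⟨x, hΓ' ▸ Ctx.isSome_insert_self _ x A⟩

/-- A new premise `x`, whose edge enters a new vertex `W`. -/
def IGraph.weak {n : ℕ} {𝒜 : Fin n → FreeAlg} {Γ Γ' : Ctx 𝒜} (x : ℕ) (A : Ty 𝒜)
    (hΓ' : Γ' = Γ.insert x A) (G : IGraph Γ) : IGraph Γ' :=
  let f : G.Edge → Γ'.Dom ⊕ G.E :=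
    Sum.map (fun w => ⟨w.1, hΓ' ▸ Ctx.isSome_insert Γ x A w.1 w.2⟩) id
  { V := Option G.V
    E := G.E
    node := fun
      | none => .weak (.inl ⟨x, hΓ' ▸ Ctx.isSome_insert_self Γ x A⟩)
      | some v => (G.node v).map f
    ty := G.ty
    box := fun e => (G.box e).map some
    out := f G.out }

/-- The premises `x` and `y` become the edges (`false` and `true`) that leave a new vertex `X`,
which is entered by the edge of a new premise `z`. -/
def IGraph.contr {n : ℕ} {𝒜 : Fin n → FreeAlg} {Γ Γ' Γ'' : Ctx 𝒜} (x y z : ℕ) (A : Ty 𝒜)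
    (hΓ'' : Γ'' = (Γ.insert x A).insert y A) (hΓ' : Γ' = Γ.insert z A) (G : IGraph Γ'') :
    IGraph Γ' :=
  let f : G.Edge → Γ'.Dom ⊕ (Bool ⊕ G.E) := fun
    | .inl w =>
        if hx : w.1 = x then .inr (.inl false)
        else if hy : w.1 = y then .inr (.inl true)
        else .inl ⟨w.1, hΓ' ▸ Ctx.isSome_insert Γ z A w.1 (Ctx.isSome_of_insert Γ x A w.1 hx
          (Ctx.isSome_of_insert (Γ.insert x A) y A w.1 hy (hΓ'' ▸ w.2)))⟩
    | .inr e => .inr (.inr e)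
  { V := Option G.V
    E := Bool ⊕ G.E
    node := fun
      | none => .dup (.inr (.inl false)) (.inr (.inl true))
          (.inl ⟨z, hΓ' ▸ Ctx.isSome_insert_self Γ z A⟩)
      | some v => (G.node v).map f
    ty := Sum.elim (fun _ => A) G.ty
    box := Sum.elim (fun _ => none) fun e => (G.box e).map some
    out := f G.out }

/-- The bound variable becomes the edge `false` that leaves a new vertex `I_⊸`, whose conclusion is
the edge `true`. -/
def IGraph.lam {n : ℕ} {𝒜 : Fin n → FreeAlg} {Γ : Ctx 𝒜} (A B : Ty 𝒜) (G : IGraph (Γ.cons A)) :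
    IGraph Γ :=
  let f : G.Edge → Γ.Dom ⊕ (Bool ⊕ G.E) := fun
    | .inl ⟨0, _⟩ => .inr (.inl false)
    | .inl ⟨x + 1, hx⟩ => .inl ⟨x, hx⟩
    | .inr e => .inr (.inr e)
  { V := Option G.V
    E := Bool ⊕ G.E
    node := fun
      | none => .lam (.inr (.inl false)) (f G.out) (.inr (.inl true))
      | some v => (G.node v).map f
    ty := Sum.elim (fun b => if b then .arr A B else A) G.ty
    box := Sum.elim (fun _ => none) fun e => (G.box e).map some
    out := .inr (.inl true) }

/-- A new vertex `E_⊸`, with the conclusion `none`. -/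
def IGraph.app {n : ℕ} {𝒜 : Fin n → FreeAlg} {Γ Γ₁ Γ₂ : Ctx 𝒜} (hΓ : Ctx.Union Γ₁ Γ₂ Γ)
    (B : Ty 𝒜) (G₁ : IGraph Γ₁) (G₂ : IGraph Γ₂) : IGraph Γ :=
  let f₁ : G₁.Edge → Γ.Dom ⊕ Option (G₁.E ⊕ G₂.E) :=
    Sum.map (fun w => ⟨w.1, hΓ.left w.1 w.2⟩) fun e => some (.inl e)
  let f₂ : G₂.Edge → Γ.Dom ⊕ Option (G₁.E ⊕ G₂.E) :=
    Sum.map (fun w => ⟨w.1, hΓ.right w.1 w.2⟩) fun e => some (.inr e)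
  { V := Option (G₁.V ⊕ G₂.V)
    E := Option (G₁.E ⊕ G₂.E)
    node := fun
      | none => .app (f₁ G₁.out) (f₂ G₂.out) (.inr none)
      | some (.inl v) => (G₁.node v).map f₁
      | some (.inr v) => (G₂.node v).map f₂
    ty := fun
      | none => B
      | some (.inl e) => G₁.ty e
      | some (.inr e) => G₂.ty e
    box := fun
      | none => none
      | some (.inl e) => (G₁.box e).map fun v => some (.inl v)
      | some (.inr e) => (G₂.box e).map fun v => some (.inr v)
    out := .inr none }

/-- A vertex `I^c_𝔸` with its outgoing edge. -/
def IGraph.con {n : ℕ} {𝒜 : Fin n → FreeAlg} (Γ' : Ctx 𝒜) (a : Fin n) (c : Fin (𝒜 a).k)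
    (i : ℕ) : IGraph Γ' where
  V := Unit
  E := Unit
  node := fun _ => .con a c (.inr ())
  ty := fun _ => Ty.arrows ((𝒜 a).arity c) (.base a i) (.base a i)
  box := fun _ => none
  out := .inr ()

/-- A new vertex `C^N_𝔸`, with the conclusion `none`. -/
def IGraph.cond {n : ℕ} {𝒜 : Fin n → FreeAlg} {a : Fin n} {Γs : Fin (𝒜 a).k → Ctx 𝒜}
    {Δ Γ : Ctx 𝒜} (hΓ : Ctx.UnionAll Γs Δ Γ) (C : Ty 𝒜) (Gs : ∀ i, IGraph (Γs i))
    (G₀ : IGraph Δ) : IGraph Γ :=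
  let f (i : Fin (𝒜 a).k) : (Gs i).Edge → Γ.Dom ⊕ Option ((Σ i, (Gs i).E) ⊕ G₀.E) :=
    Sum.map (fun w => ⟨w.1, hΓ.branch i w.1 w.2⟩) fun e => some (.inl ⟨i, e⟩)
  let f₀ : G₀.Edge → Γ.Dom ⊕ Option ((Σ i, (Gs i).E) ⊕ G₀.E) :=
    Sum.map (fun w => ⟨w.1, hΓ.main w.1 w.2⟩) fun e => some (.inr e)
  { V := Option ((Σ i, (Gs i).V) ⊕ G₀.V)
    E := Option ((Σ i, (Gs i).E) ⊕ G₀.E)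
    node := fun
      | none => .cond a (f₀ G₀.out) (fun i => f i (Gs i).out) (.inr none)
      | some (.inl ⟨i, v⟩) => ((Gs i).node v).map (f i)
      | some (.inr v) => (G₀.node v).map f₀
    ty := fun
      | none => C
      | some (.inl ⟨i, e⟩) => (Gs i).ty e
      | some (.inr e) => G₀.ty e
    box := fun
      | none => none
      | some (.inl ⟨i, e⟩) => ((Gs i).box e).map fun v => some (.inl ⟨i, v⟩)
      | some (.inr e) => (G₀.box e).map fun v => some (.inr v)
    out := .inr none }

/-- A new vertex `C^R_𝔸` (`none`), with the conclusion `none`. It delimits a box that contains all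
the edges of the graphs of the branches; every premise `x` of the `i`-th branch becomes an edge
that leaves a new vertex `P^R_𝔸` (both are called `⟨i, .inl x⟩`). -/
def IGraph.recur {n : ℕ} {𝒜 : Fin n → FreeAlg} {a : Fin n} {Γs : Fin (𝒜 a).k → Ctx 𝒜}
    {Δ Γ : Ctx 𝒜} (hΓ : Ctx.UnionAll Γs Δ Γ) (C : Ty 𝒜) (Gs : ∀ i, IGraph (Γs i))
    (G₀ : IGraph Δ) : IGraph Γ :=
  let f (i : Fin (𝒜 a).k) (e : (Gs i).Edge) : Γ.Dom ⊕ Option ((Σ i, (Gs i).Edge) ⊕ G₀.E) :=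
    .inr (some (.inl ⟨i, e⟩))
  let f₀ : G₀.Edge → Γ.Dom ⊕ Option ((Σ i, (Gs i).Edge) ⊕ G₀.E) :=
    Sum.map (fun w => ⟨w.1, hΓ.main w.1 w.2⟩) fun e => some (.inr e)
  { V := Option ((Σ i, (Γs i).Dom ⊕ (Gs i).V) ⊕ G₀.V)
    E := Option ((Σ i, (Gs i).Edge) ⊕ G₀.E)
    node := fun
      | none => .recur a (f₀ G₀.out) (fun i => f i (Gs i).out) (.inr none)
      | some (.inl ⟨i, .inl x⟩) =>
          .boxPrem a (.inl ⟨x.1, hΓ.branch i x.1 x.2⟩) (f i (.inl x))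
      | some (.inl ⟨i, .inr v⟩) => ((Gs i).node v).map (f i)
      | some (.inr v) => (G₀.node v).map f₀
    ty := fun
      | none => C
      | some (.inl ⟨i, e⟩) => (Gs i).edgeTy e
      | some (.inr e) => G₀.ty e
    box := fun
      | none => none
      | some (.inl ⟨i, e⟩) =>
          match (Gs i).boxPremise e with
          | none => some none
          | some v => some (some (.inl ⟨i, .inr v⟩))
      | some (.inr e) => (G₀.box e).map fun v => some (.inr v)
    out := .inr none }

/-- The interaction graph `G_π` of a type derivation `π`. -/
def Deriv.graph {n : ℕ} {𝒜 : Fin n → FreeAlg} {S : System 𝒜} {Γ : Ctx 𝒜} {M : Term 𝒜}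
    {A : Ty 𝒜} : Deriv S Γ M A → IGraph Γ
  | .ax x A hΓ' => .ax x A hΓ'
  | .weak x A _ hΓ' d => d.graph.weak x A hΓ'
  | .contr x y z A _ _ _ _ _ hΓ'' hΓ' _ d => d.graph.contr x y z A hΓ'' hΓ'
  | .lam (A := A) (B := B) d => d.graph.lam A B
  | .app (B := B) hΓ d₁ d₂ => .app hΓ B d₁.graph d₂.graph
  | .con a c i _ => .con Γ a c i
  | .cond (C := C) hΓ ds d => .cond hΓ C (fun i => (ds i).graph) d.graph
  | .recur (C := C) hΓ _ _ ds d => .recur hΓ C (fun i => (ds i).graph) d.graph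

/-! ### Algebraic context semantics -/

/-- The triples `(u, t, v)` in stacks; `u` is a term context and `t` a term for the same algebra
`𝒜 alg`, and `v` is a vertex. -/
structure Entry {n : ℕ} {𝒜 : Fin n → FreeAlg} {Γ : Ctx 𝒜} (G : IGraph Γ) where
  alg : Fin n
  ctx : AlgCtx (𝒜 alg)
  tm : AlgTerm (𝒜 alg)
  vtx : G.V

/-- The elements `(t, e, U, L)` of `S(G)`; `t` is a term for some algebra of the family. -/
structure Lab {n : ℕ} {𝒜 : Fin n → FreeAlg} {Γ : Ctx 𝒜} (G : IGraph Γ) where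
  term : Σ a, AlgTerm (𝒜 a)
  edge : G.Edge
  stack : List (Entry G)
  ctx : TyCtx 𝒜

/-- Finite ordered trees with vertices labelled in `S(G)`. -/
inductive Tree {n : ℕ} {𝒜 : Fin n → FreeAlg} {Γ : Ctx 𝒜} (G : IGraph Γ) : Type
  | node (l : Lab G) (k : ℕ) (f : Fin k → Tree G) : Tree G

/-- The label of the root. -/
def Tree.label {n : ℕ} {𝒜 : Fin n → FreeAlg} {Γ : Ctx 𝒜} {G : IGraph Γ} : Tree G → Lab G
  | .node l _ _ => l

/-- `L(T)`, the term in the label of the root. -/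
def Tree.value {n : ℕ} {𝒜 : Fin n → FreeAlg} {Γ : Ctx 𝒜} {G : IGraph Γ} (T : Tree G) :
    Σ a, AlgTerm (𝒜 a) :=
  T.label.term

/-- The tree with root label `l` and one immediate subtree `T`. -/
def Tree.unary {n : ℕ} {𝒜 : Fin n → FreeAlg} {Γ : Ctx 𝒜} {G : IGraph Γ} (l : Lab G) (T : Tree G) :
    Tree G :=
  .node l 1 fun _ => T

/-- `IsB T u S` says that `S = B(T, u, s)`, where `L(T) = u[s]`: travelling from the root of `T`
towards the leaves, guided by `u`, the last vertex found that corresponds to `u` is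
the root of `S`. -/
inductive IsB {n : ℕ} {𝒜 : Fin n → FreeAlg} {Γ : Ctx 𝒜} {G : IGraph Γ} {a : Fin n} :
    Tree G → AlgCtx (𝒜 a) → Tree G → Prop
  /-- The child carries the same term: go on. -/
  | pass {l : Lab G} {T S : Tree G} {u : AlgCtx (𝒜 a)} (ht : T.value = l.term) (h : IsB T u S) :
      IsB (.unary l T) u S
  /-- The children carry the arguments of the constructor at the root: choose the one at
  the position of the hole. -/
  | arg {l : Lab G} {c : Fin (𝒜 a).k} {f : Fin ((𝒜 a).arity c) → Tree G}
      {ts : Fin ((𝒜 a).arity c) → AlgTerm (𝒜 a)} {j : Fin ((𝒜 a).arity c)} {u : AlgCtx (𝒜 a)}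
      {S : Tree G} (hl : l.term = ⟨a, .mk c ts⟩) (hf : ∀ i, (f i).value = ⟨a, ts i⟩)
      (h : IsB (f j) u S) :
      IsB (.node l _ f) (.node c j (fun i => ts i) u) S
  /-- The hole of `u` is reached, and the children (if any) carry proper subterms: this is the vertex. -/
  | found {l : Lab G} {c : Fin (𝒜 a).k} {f : Fin ((𝒜 a).arity c) → Tree G}
      {ts : Fin ((𝒜 a).arity c) → AlgTerm (𝒜 a)}
      (hl : l.term = ⟨a, .mk c ts⟩) (hf : ∀ i, (f i).value = ⟨a, ts i⟩) :
      IsB (.node l _ f) .hole (.node l _ f)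

/-- The closure conditions `l ← l'` without side conditions, induced by the vertices labelled
`I_⊸`, `E_⊸` and `X`. -/
inductive Step {n : ℕ} {𝒜 : Fin n → FreeAlg} {Γ : Ctx 𝒜} (G : IGraph Γ) :
    Lab G → Lab G → Prop
  | lam_var {v : G.V} {e g h : G.Edge} {t U P} (hv : G.node v = .lam e g h)
      (hP : P.PosFocus (G.edgeTy e)) :
      Step G ⟨t, e, U, P⟩ ⟨t, h, U, .left P (G.edgeTy g)⟩
  | lam_arg {v : G.V} {e g h : G.Edge} {t U N} (hv : G.node v = .lam e g h)
      (hN : N.NegFocus (G.edgeTy e)) :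
      Step G ⟨t, h, U, .left N (G.edgeTy g)⟩ ⟨t, e, U, N⟩
  | lam_out {v : G.V} {e g h : G.Edge} {t U P} (hv : G.node v = .lam e g h)
      (hP : P.PosFocus (G.edgeTy g)) :
      Step G ⟨t, h, U, .right (G.edgeTy e) P⟩ ⟨t, g, U, P⟩
  | lam_body {v : G.V} {e g h : G.Edge} {t U N} (hv : G.node v = .lam e g h)
      (hN : N.NegFocus (G.edgeTy g)) :
      Step G ⟨t, g, U, N⟩ ⟨t, h, U, .right (G.edgeTy e) N⟩
  | app_arg {v : G.V} {e g h : G.Edge} {t U P} (hv : G.node v = .app e g h)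
      (hP : P.PosFocus (G.edgeTy g)) :
      Step G ⟨t, e, U, .left P (G.edgeTy h)⟩ ⟨t, g, U, P⟩
  | app_back {v : G.V} {e g h : G.Edge} {t U N} (hv : G.node v = .app e g h)
      (hN : N.NegFocus (G.edgeTy g)) :
      Step G ⟨t, g, U, N⟩ ⟨t, e, U, .left N (G.edgeTy h)⟩
  | app_fun {v : G.V} {e g h : G.Edge} {t U N} (hv : G.node v = .app e g h)
      (hN : N.NegFocus (G.edgeTy h)) :
      Step G ⟨t, e, U, .right (G.edgeTy g) N⟩ ⟨t, h, U, N⟩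
  | app_out {v : G.V} {e g h : G.Edge} {t U P} (hv : G.node v = .app e g h)
      (hP : P.PosFocus (G.edgeTy h)) :
      Step G ⟨t, h, U, P⟩ ⟨t, e, U, .right (G.edgeTy g) P⟩
  | dup_left {v : G.V} {e g h : G.Edge} {t U} (hv : G.node v = .dup e g h) :
      Step G ⟨t, e, U, .hole⟩ ⟨t, h, U, .hole⟩
  | dup_right {v : G.V} {e g h : G.Edge} {t U} (hv : G.node v = .dup e g h) :
      Step G ⟨t, g, U, .hole⟩ ⟨t, h, U, .hole⟩

/-- `InT G T` says that `T ∈ T(G)`: the smallest set of trees satisfying the closure conditions. -/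
inductive InT {n : ℕ} {𝒜 : Fin n → FreeAlg} {Γ : Ctx 𝒜} (G : IGraph Γ) : Tree G → Prop
  | step {T : Tree G} {l : Lab G} (hT : InT G T) (h : Step G l T.label) : InT G (.unary l T)
  /- Vertices `I^c_𝔸`, `c` of arity zero, outside every box. -/
  | con_zero {w : G.V} {a : Fin n} {c : Fin (𝒜 a).k} {e : G.Edge}
      {ts : Fin ((𝒜 a).arity c) → AlgTerm (𝒜 a)} {f : Fin ((𝒜 a).arity c) → Tree G}
      (hw : G.node w = .con a c e) (hc : (𝒜 a).arity c = 0) (hbox : G.boxPremise e = none) :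
      InT G (.node ⟨⟨a, .mk c ts⟩, e, [], .hole⟩ _ f)
  /- Vertices `I^c_𝔸`, `c` of arity zero, inside a box. -/
  | con_zero_box {w : G.V} {a : Fin n} {c : Fin (𝒜 a).k} {e : G.Edge}
      {ts : Fin ((𝒜 a).arity c) → AlgTerm (𝒜 a)} {f : Fin ((𝒜 a).arity c) → Tree G}
      {v : G.V} {e₀ : G.Edge} {b : Fin n} {u : AlgCtx (𝒜 b)} {t : AlgTerm (𝒜 b)}
      {U : List (Entry G)} {T₀ : Tree G}
      (hw : G.node w = .con a c e) (hc : (𝒜 a).arity c = 0) (hbox : G.boxPremise e = some v)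
      (hv : G.RecPremise v e₀) (hT₀ : InT G T₀) (hl₀ : T₀.label = ⟨⟨b, u.plug t⟩, e₀, U, .hole⟩) :
      InT G (.node ⟨⟨a, .mk c ts⟩, e, ⟨b, u, t, v⟩ :: U, .hole⟩ _ f)
  /- Vertices `I^c_𝔸`, `c` of positive arity. -/
  | con_succ {w : G.V} {a : Fin n} {c : Fin (𝒜 a).k} {e : G.Edge} {i : ℕ} {U : List (Entry G)}
      {ts : Fin ((𝒜 a).arity c) → AlgTerm (𝒜 a)} {f : Fin ((𝒜 a).arity c) → Tree G}
      (hw : G.node w = .con a c e) (hc : 0 < (𝒜 a).arity c)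
      (he : G.edgeTy e = Ty.arrows ((𝒜 a).arity c) (.base a i) (.base a i))
      (hf : ∀ j, InT G (f j))
      (hl : ∀ j, (f j).label =
        ⟨⟨a, ts j⟩, e, U, TyCtx.argAt (.base a i) j .hole (.base a i)⟩) :
      InT G (.node ⟨⟨a, .mk c ts⟩, e, U, TyCtx.arrows ((𝒜 a).arity c) (.base a i) .hole⟩ _ f)
  /- Vertices `C^N_𝔸`. -/
  | cond_out {v : G.V} {a : Fin n} {e₀ : G.Edge} {es : Fin (𝒜 a).k → G.Edge} {g : G.Edge}
      {c : Fin (𝒜 a).k} {ts : Fin ((𝒜 a).arity c) → AlgTerm (𝒜 a)} {U : List (Entry G)}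
      {T₀ T : Tree G} {t} {P : TyCtx 𝒜}
      (hv : G.node v = .cond a e₀ es g) (hT₀ : InT G T₀)
      (hl₀ : T₀.label = ⟨⟨a, .mk c ts⟩, e₀, U, .hole⟩)
      (hT : InT G T)
      (hl : T.label = ⟨t, es c, U, TyCtx.arrows ((𝒜 a).arity c) (G.edgeTy e₀) P⟩)
      (hP : P.PosFocus (G.edgeTy g)) :
      InT G (.unary ⟨t, g, U, P⟩ T)
  | cond_in {v : G.V} {a : Fin n} {e₀ : G.Edge} {es : Fin (𝒜 a).k → G.Edge} {g : G.Edge}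
      {c : Fin (𝒜 a).k} {ts : Fin ((𝒜 a).arity c) → AlgTerm (𝒜 a)} {U : List (Entry G)}
      {T₀ T : Tree G} {t} {N : TyCtx 𝒜}
      (hv : G.node v = .cond a e₀ es g) (hT₀ : InT G T₀)
      (hl₀ : T₀.label = ⟨⟨a, .mk c ts⟩, e₀, U, .hole⟩)
      (hT : InT G T) (hl : T.label = ⟨t, g, U, N⟩) (hN : N.NegFocus (G.edgeTy g)) :
      InT G (.unary ⟨t, es c, U, TyCtx.arrows ((𝒜 a).arity c) (G.edgeTy e₀) N⟩ T)
  | cond_arg {v : G.V} {a : Fin n} {e₀ : G.Edge} {es : Fin (𝒜 a).k → G.Edge} {g : G.Edge}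
      {c : Fin (𝒜 a).k} {ts : Fin ((𝒜 a).arity c) → AlgTerm (𝒜 a)} {U : List (Entry G)}
      {T₀ S : Tree G} {j : Fin ((𝒜 a).arity c)}
      (hv : G.node v = .cond a e₀ es g) (hT₀ : InT G T₀)
      (hl₀ : T₀.label = ⟨⟨a, .mk c ts⟩, e₀, U, .hole⟩)
      (hS : IsB T₀ (AlgCtx.arg c ts j) S) :
      InT G (.unary ⟨⟨a, ts j⟩, es c, U, TyCtx.argAt (G.edgeTy e₀) j .hole (G.edgeTy g)⟩ S)
  /- Vertices `C^R_𝔸`: from one copy of the box to another one. -/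
  | rec_up {v : G.V} {a : Fin n} {e₀ : G.Edge} {es : Fin (𝒜 a).k → G.Edge} {g : G.Edge}
      {c d : Fin (𝒜 a).k} {ts : Fin ((𝒜 a).arity c) → AlgTerm (𝒜 a)}
      {ss : Fin ((𝒜 a).arity d) → AlgTerm (𝒜 a)} {k : Fin ((𝒜 a).arity c)}
      {u : AlgCtx (𝒜 a)} {U : List (Entry G)} {T₀ T : Tree G} {r} {P : TyCtx 𝒜}
      (hv : G.node v = .recur a e₀ es g) (hT₀ : InT G T₀)
      (hl₀ : T₀.label = ⟨⟨a, u.plug (.mk c ts)⟩, e₀, U, .hole⟩) (hk : ts k = .mk d ss)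
      (hT : InT G T)
      (hl : T.label = ⟨r, es d, ⟨a, u.comp (AlgCtx.arg c ts k), ts k, v⟩ :: U,
        TyCtx.arrows ((𝒜 a).arity d) (G.edgeTy e₀)
          (TyCtx.arrows ((𝒜 a).arity d) (G.edgeTy g) P)⟩)
      (hP : P.PosFocus (G.edgeTy g)) :
      InT G (.unary ⟨r, es c, ⟨a, u, .mk c ts, v⟩ :: U,
        TyCtx.arrows ((𝒜 a).arity c) (G.edgeTy e₀)
          (TyCtx.argAt (G.edgeTy g) k P (G.edgeTy g))⟩ T)
  | rec_down {v : G.V} {a : Fin n} {e₀ : G.Edge} {es : Fin (𝒜 a).k → G.Edge} {g : G.Edge}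
      {c d : Fin (𝒜 a).k} {ts : Fin ((𝒜 a).arity c) → AlgTerm (𝒜 a)}
      {ss : Fin ((𝒜 a).arity d) → AlgTerm (𝒜 a)} {k : Fin ((𝒜 a).arity c)}
      {u : AlgCtx (𝒜 a)} {U : List (Entry G)} {T₀ T : Tree G} {r} {N : TyCtx 𝒜}
      (hv : G.node v = .recur a e₀ es g) (hT₀ : InT G T₀)
      (hl₀ : T₀.label = ⟨⟨a, u.plug (.mk c ts)⟩, e₀, U, .hole⟩) (hk : ts k = .mk d ss)
      (hT : InT G T)
      (hl : T.label = ⟨r, es c, ⟨a, u, .mk c ts, v⟩ :: U,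
        TyCtx.arrows ((𝒜 a).arity c) (G.edgeTy e₀)
          (TyCtx.argAt (G.edgeTy g) k N (G.edgeTy g))⟩)
      (hN : N.NegFocus (G.edgeTy g)) :
      InT G (.unary ⟨r, es d, ⟨a, u.comp (AlgCtx.arg c ts k), ts k, v⟩ :: U,
        TyCtx.arrows ((𝒜 a).arity d) (G.edgeTy e₀)
          (TyCtx.arrows ((𝒜 a).arity d) (G.edgeTy g) N)⟩ T)
  /- Vertices `C^R_𝔸`: leaving and entering the box through its conclusion. -/
  | rec_out {v : G.V} {a : Fin n} {e₀ : G.Edge} {es : Fin (𝒜 a).k → G.Edge} {g : G.Edge}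
      {c : Fin (𝒜 a).k} {ts : Fin ((𝒜 a).arity c) → AlgTerm (𝒜 a)}
      {U : List (Entry G)} {T₀ T : Tree G} {r} {P : TyCtx 𝒜}
      (hv : G.node v = .recur a e₀ es g) (hT₀ : InT G T₀)
      (hl₀ : T₀.label = ⟨⟨a, .mk c ts⟩, e₀, U, .hole⟩)
      (hT : InT G T)
      (hl : T.label = ⟨r, es c, ⟨a, .hole, .mk c ts, v⟩ :: U,
        TyCtx.arrows ((𝒜 a).arity c) (G.edgeTy e₀)
          (TyCtx.arrows ((𝒜 a).arity c) (G.edgeTy g) P)⟩)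
      (hP : P.PosFocus (G.edgeTy g)) :
      InT G (.unary ⟨r, g, U, P⟩ T)
  | rec_in {v : G.V} {a : Fin n} {e₀ : G.Edge} {es : Fin (𝒜 a).k → G.Edge} {g : G.Edge}
      {c : Fin (𝒜 a).k} {ts : Fin ((𝒜 a).arity c) → AlgTerm (𝒜 a)}
      {U : List (Entry G)} {T₀ T : Tree G} {r} {N : TyCtx 𝒜}
      (hv : G.node v = .recur a e₀ es g) (hT₀ : InT G T₀)
      (hl₀ : T₀.label = ⟨⟨a, .mk c ts⟩, e₀, U, .hole⟩)
      (hT : InT G T) (hl : T.label = ⟨r, g, U, N⟩) (hN : N.NegFocus (G.edgeTy g)) :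
      InT G (.unary ⟨r, es c, ⟨a, .hole, .mk c ts, v⟩ :: U,
        TyCtx.arrows ((𝒜 a).arity c) (G.edgeTy e₀)
          (TyCtx.arrows ((𝒜 a).arity c) (G.edgeTy g) N)⟩ T)
  /- Vertices `C^R_𝔸`: passing the subterms of the recurrence argument to the branches. -/
  | rec_arg {v : G.V} {a : Fin n} {e₀ : G.Edge} {es : Fin (𝒜 a).k → G.Edge} {g : G.Edge}
      {c : Fin (𝒜 a).k} {ts : Fin ((𝒜 a).arity c) → AlgTerm (𝒜 a)}
      {u : AlgCtx (𝒜 a)} {U : List (Entry G)} {T₀ S : Tree G} {j : Fin ((𝒜 a).arity c)}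
      (hv : G.node v = .recur a e₀ es g) (hT₀ : InT G T₀)
      (hl₀ : T₀.label = ⟨⟨a, u.plug (.mk c ts)⟩, e₀, U, .hole⟩)
      (hS : IsB T₀ (u.comp (AlgCtx.arg c ts j)) S) :
      InT G (.unary ⟨⟨a, ts j⟩, es c, ⟨a, u, .mk c ts, v⟩ :: U,
        TyCtx.argAt (G.edgeTy e₀) j .hole
          (Ty.arrows ((𝒜 a).arity c) (G.edgeTy g) (G.edgeTy g))⟩ S)
  /- Vertices `P^R_𝔸`. -/
  | box {w v : G.V} {a b : Fin n} {e g e₀ : G.Edge} {u : AlgCtx (𝒜 b)} {s : AlgTerm (𝒜 b)}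
      {U : List (Entry G)} {T₀ T : Tree G} {t}
      (hw : G.node w = .boxPrem a e g) (hbox : G.boxPremise g = some v) (hv : G.RecPremise v e₀)
      (hT₀ : InT G T₀) (hl₀ : T₀.label = ⟨⟨b, u.plug s⟩, e₀, U, .hole⟩)
      (hT : InT G T) (hl : T.label = ⟨t, e, U, .hole⟩) :
      InT G (.unary ⟨t, g, ⟨b, u, s, v⟩ :: U, .hole⟩ T)

/-- The context semantics `T(G)`. -/
def trees {n : ℕ} {𝒜 : Fin n → FreeAlg} {Γ : Ctx 𝒜} (G : IGraph Γ) : Set (Tree G) :=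
  {T | InT G T}

end LinRec

namespace LinRec

/-! ### Ports of vertices -/

/-! The trees themselves are not needed, only the labels at their roots. The closure conditions are
read as rules deriving one label from others (`Rule`, `Reach`), and `IGraph.WF.reach_label` shows
that root labels of trees are derivable. What a rule needs from the graph is collected in
`IGraph.WF`, which `Deriv.graph_wf` establishes for every ramified derivation.

The semantics is deterministic (`IGraph.WF.functional`): edge, stack and type context of a derivable
label fix its term and the way it is derived. So every derivable label has a finite acyclic
derivation, and the size of its term can be counted there. Each label has a tier, that of the base
type in its focus, and this tier does not change along derivations.

Size is treated as a flow. At a constructor vertex one unit is created; everywhere else a term is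
copied or replaced by a subterm. If no label gives away more than its own size to all its consumers
together, the size of the final term is at most the number of constructor labels in its derivation
(`IGraph.WF.size_le_card`). There are two reasons for this linearity. For word algebras all arities
are at most one, so the derivation is a path and duplication is harmless. For other algebras
duplicating vertices are forbidden by typing, and distinct consumers receive disjoint subterms.

It remains to count constructor labels. Each is determined by its vertex and its stack, and there
are at most `|M|` constructor vertices. For a label of tier `i`, ramification forces every box that
the term enters or leaves through its conclusion to have tier above `i`. Therefore the part of the
stack from the innermost box of tier at most `i` on (`anchor`) is controlled by that of the final
label, and only entries of tier above `i` are free. Such an entry is a decomposition of a recurrence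
argument of higher tier, so if those arguments have size at most `N`, there are at most `N ^ R`
stacks, where `R` is the recursion depth (`IGraph.WF.exists_stacks`, `IGraph.WF.card_con_le`).

Hence tier `i` is bounded by `|M| * N ^ R`, with `N` a bound for the tiers above `i`. Descending
from the highest tier `I`, where nothing is free, gives `|M| ^ (1 + R) ^ I`
(`IGraph.WF.size_le_pow`). -/

/-- The roles an edge can play at an incident vertex. -/
inductive Port
  | weak | dupL | dupR | dupIn | lamVar | lamBody | lamOut | appFun | appArg | appOut | con
  | condArg | condBr (i : ℕ) | condOut | recArg | recBr (i : ℕ) | recOut | boxIn | boxOut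

/-- Whether the edge at a port leaves the vertex. -/
def Port.isOut : Port → Bool
  | .dupL | .dupR | .lamVar | .lamOut | .appOut | .con | .condOut | .recOut | .boxOut => true
  | _ => false

/-- The edge `x` is attached to the port `p` of the vertex. -/
def Node.At {n : ℕ} {𝒜 : Fin n → FreeAlg} {E : Type} (N : Node 𝒜 E) (p : Port) (x : E) : Prop :=
  match N with
  | .weak e => p = .weak ∧ x = e
  | .dup e g h => (p = .dupL ∧ x = e) ∨ (p = .dupR ∧ x = g) ∨ (p = .dupIn ∧ x = h)
  | .lam e g h => (p = .lamVar ∧ x = e) ∨ (p = .lamBody ∧ x = g) ∨ (p = .lamOut ∧ x = h)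
  | .app e g h => (p = .appFun ∧ x = e) ∨ (p = .appArg ∧ x = g) ∨ (p = .appOut ∧ x = h)
  | .con _ _ e => p = .con ∧ x = e
  | .cond a e₀ es g =>
      (p = .condArg ∧ x = e₀) ∨ (p = .condOut ∧ x = g) ∨ ∃ c : Fin (𝒜 a).k, p = .condBr c ∧ x = es c
  | .recur a e₀ es g =>
      (p = .recArg ∧ x = e₀) ∨ (p = .recOut ∧ x = g) ∨ ∃ c : Fin (𝒜 a).k, p = .recBr c ∧ x = es c
  | .boxPrem _ e g => (p = .boxIn ∧ x = e) ∨ (p = .boxOut ∧ x = g)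

theorem Node.at_map {n : ℕ} {𝒜 : Fin n → FreeAlg} {E F : Type} {f : E → F} {N : Node 𝒜 E}
    {p : Port} {x : F} (h : (N.map f).At p x) : ∃ e, x = f e ∧ N.At p e := by
  cases N <;> simp only [Node.map, Node.At] at h ⊢ <;> aesop

/-! ### Well-formed graphs -/

/-- At most `k` boxes are nested around the box of the given vertex (inclusive). -/
inductive BoxDepth {n : ℕ} {𝒜 : Fin n → FreeAlg} {Γ : Ctx 𝒜} (G : IGraph Γ) :
    ℕ → Option G.V → Prop
  | none {k : ℕ} : BoxDepth G k none
  | some {k : ℕ} {v : G.V} {a : Fin n} {e₀ : G.Edge} {es : Fin (𝒜 a).k → G.Edge} {g : G.Edge}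
      (hv : G.node v = .recur a e₀ es g) (h : BoxDepth G k (G.boxPremise e₀)) :
      BoxDepth G (k + 1) (some v)

theorem BoxDepth.mono {n : ℕ} {𝒜 : Fin n → FreeAlg} {Γ : Ctx 𝒜} {G : IGraph Γ} {k : ℕ}
    {o : Option G.V} (h : BoxDepth G k o) : ∀ {l : ℕ}, k ≤ l → BoxDepth G l o := by
  induction h with
  | none => exact fun _ => .none
  | some hv _ ih =>
    intro l hl
    obtain ⟨l, rfl⟩ : ∃ l', l = l' + 1 := ⟨l - 1, by omega⟩
    exact .some hv (ih (by omega))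

/-- Local typing and box conditions at a vertex; `D` is the set of the types that may be
duplicated and `I` bounds the tiers. -/
def IGraph.NodeOK {n : ℕ} {𝒜 : Fin n → FreeAlg} {Γ : Ctx 𝒜} (G : IGraph Γ) (D : Set (Ty 𝒜))
    (I : ℕ) (v : G.V) : Node 𝒜 G.Edge → Prop
  | .weak _ => True
  | .dup e g h => G.edgeTy e = G.edgeTy h ∧ G.edgeTy g = G.edgeTy h ∧ G.edgeTy h ∈ D ∧
      G.boxPremise e = G.boxPremise h ∧ G.boxPremise g = G.boxPremise h
  | .lam e g h => G.edgeTy h = .arr (G.edgeTy e) (G.edgeTy g) ∧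
      G.boxPremise e = G.boxPremise h ∧ G.boxPremise g = G.boxPremise h
  | .app e g h => G.edgeTy e = .arr (G.edgeTy g) (G.edgeTy h) ∧
      G.boxPremise e = G.boxPremise h ∧ G.boxPremise g = G.boxPremise h
  | .con a c e => ∃ i, G.edgeTy e = Ty.arrows ((𝒜 a).arity c) (.base a i) (.base a i)
  | .cond a e₀ es g => (∃ m, G.edgeTy e₀ = .base a m) ∧
      (∀ c, G.edgeTy (es c) = Ty.arrows ((𝒜 a).arity c) (G.edgeTy e₀) (G.edgeTy g)) ∧
      G.boxPremise e₀ = G.boxPremise g ∧ ∀ c, G.boxPremise (es c) = G.boxPremise g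
  | .recur a e₀ es g =>
      (∃ m, G.edgeTy e₀ = .base a m ∧ (G.edgeTy g).level < m ∧ m ≤ I) ∧
      (∀ c, G.edgeTy (es c) = Ty.arrows ((𝒜 a).arity c) (G.edgeTy e₀)
        (Ty.arrows ((𝒜 a).arity c) (G.edgeTy g) (G.edgeTy g))) ∧
      G.boxPremise e₀ = G.boxPremise g ∧ ∀ c, G.boxPremise (es c) = some v
  | .boxPrem _ e g => G.edgeTy e = G.edgeTy g ∧ G.edgeTy g ∈ D ∧
      ∃ v' b e₀ es g', G.boxPremise g = some v' ∧ G.node v' = .recur b e₀ es g' ∧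
        G.boxPremise e = G.boxPremise e₀

/-- Well-formed graphs with conclusion of type `A`, box depth at most `R` and tiers at
most `I`. -/
structure IGraph.WF {n : ℕ} {𝒜 : Fin n → FreeAlg} {Γ : Ctx 𝒜} (G : IGraph Γ) (A : Ty 𝒜)
    (D : Set (Ty 𝒜)) (R I : ℕ) : Prop where
  uniq : ∀ {v p e v' p'}, (G.node v).At p e → (G.node v').At p' e → p.isOut = p'.isOut →
    v = v' ∧ p = p'
  noSrc : ∀ {v p x}, (G.node v).At p (.inl x) → p.isOut = false
  noTgt : ∀ {v p}, (G.node v).At p G.out → p.isOut = true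
  outBox : G.boxPremise G.out = none
  outTy : G.edgeTy G.out = A
  ok : ∀ v, G.NodeOK D I v (G.node v)
  depth : ∀ e, BoxDepth G R (G.boxPremise e)

/-- A copy of a graph in a bigger one. -/
structure IGraph.Copy {n : ℕ} {𝒜 : Fin n → FreeAlg} {Γ' : Ctx 𝒜} (G' : IGraph Γ') where
  Γ : Ctx 𝒜
  G : IGraph Γ
  fV : G.V → G'.V
  fE : G.Edge → G'.Edge
  τ : Option G.V → Option G'.V
  node_eq : ∀ v, G'.node (fV v) = (G.node v).map fE
  ty_eq : ∀ e, G'.edgeTy (fE e) = G.edgeTy e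
  box_eq : ∀ e, G'.boxPremise (fE e) = τ (G.boxPremise e)
  τ_some : ∀ v, τ (some v) = some (fV v)
  inj : ∀ e e', fE e = fE e' → e = e'

/-- The condition speaks only of the edges at the vertex, their types and their boxes, all of which
a copy transports. Boxes are transported by `τ`, which may place unboxed edges into an outer box
without affecting equality of boxes. -/
theorem IGraph.Copy.nodeOK {n : ℕ} {𝒜 : Fin n → FreeAlg} {Γ' : Ctx 𝒜} {G' : IGraph Γ'}
    (C : G'.Copy) {D : Set (Ty 𝒜)} {J I : ℕ} (hJ : J ≤ I) {v : C.G.V}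
    (h : C.G.NodeOK D J v (C.G.node v)) :
    G'.NodeOK D I (C.fV v) (G'.node (C.fV v)) := by
  rw [C.node_eq]
  cases hN : C.G.node v with
  | weak e => trivial
  | boxPrem a e g =>
    rw [hN] at h
    obtain ⟨h1, h2, v', b, e₀, es, g', h3, h4, h5⟩ := h
    refine ⟨by simp only [C.ty_eq, h1], by simpa only [C.ty_eq] using h2, C.fV v', b, C.fE e₀,
      fun i => C.fE (es i), C.fE g', by rw [C.box_eq, h3, C.τ_some], by rw [C.node_eq, h4]; rfl,
      by simp only [C.box_eq, h5]⟩
  | recur a e₀ es g =>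
    rw [hN] at h
    obtain ⟨⟨m, h1, h2, h3⟩, h4, h5, h6⟩ := h
    refine ⟨⟨m, by rw [C.ty_eq, h1], by rw [C.ty_eq]; exact h2, h3.trans hJ⟩, fun c => ?_, ?_,
      fun c => ?_⟩
    · simp only [C.ty_eq, h4]
    · simp only [C.box_eq, h5]
    · simp only [C.box_eq, h6, C.τ_some]
  | _ =>
    rw [hN] at h
    simpa +contextual [IGraph.NodeOK, Node.map, C.ty_eq, C.box_eq] using
      (by revert h; simp +contextual [IGraph.NodeOK])

/-- `τ none` is the box into which the whole copy has been put; the `s` levels around it are added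
at the bottom of the nesting. -/
theorem IGraph.Copy.boxDepth {n : ℕ} {𝒜 : Fin n → FreeAlg} {Γ' : Ctx 𝒜} {G' : IGraph Γ'}
    (C : G'.Copy) {s : ℕ} (hs : BoxDepth G' s (C.τ none)) {k : ℕ} {o : Option C.G.V}
    (h : BoxDepth C.G k o) : BoxDepth G' (k + s) (C.τ o) := by
  induction h with
  | none => exact hs.mono (by omega)
  | @some k v a e₀ es g hv _ ih =>
    rw [C.τ_some, show k + 1 + s = k + s + 1 by omega]
    refine .some (a := a) (e₀ := C.fE e₀) (es := fun i => C.fE (es i)) (g := C.fE g)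
      (by rw [C.node_eq, hv]; rfl) ?_
    rw [C.box_eq]
    exact ih

/-- A graph glued from copies of well-formed graphs and fresh vertices is well-formed. -/
theorem IGraph.WF.glue {n : ℕ} {𝒜 : Fin n → FreeAlg} {Γ' : Ctx 𝒜} {G' : IGraph Γ'} {K : Type*}
    (C : K → G'.Copy) {A : K → Ty 𝒜} {D : Set (Ty 𝒜)} {R J s : K → ℕ}
    {A' : Ty 𝒜} {R' I : ℕ}
    (hwf : ∀ k, (C k).G.WF (A k) D (R k) (J k)) (hJ : ∀ k, J k ≤ I)
    (hR : ∀ k, R k + s k ≤ R')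
    (hs : ∀ k, BoxDepth G' (s k) ((C k).τ none))
    (disj : ∀ {k k' e e'}, (C k).fE e = (C k').fE e' → k = k')
    (fresh : Set G'.V)
    (cover : ∀ v, v ∈ fresh ∨ ∃ k w, v = (C k).fV w)
    (coverE : ∀ e, G'.boxPremise e = none ∨ ∃ k x, e = (C k).fE x)
    (freshOut : ∀ {v p k x}, v ∈ fresh → (G'.node v).At p ((C k).fE x) → p.isOut = true →
      ∃ z, x = .inl z)
    (freshIn : ∀ {v p k x}, v ∈ fresh → (G'.node v).At p ((C k).fE x) → p.isOut = false →
      x = (C k).G.out)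
    (freshUniq : ∀ {v p e v' p'}, v ∈ fresh → v' ∈ fresh → (G'.node v).At p e →
      (G'.node v').At p' e → p.isOut = p'.isOut → v = v' ∧ p = p')
    (freshSrc : ∀ {v p x}, v ∈ fresh → (G'.node v).At p (.inl x) → p.isOut = false)
    (copySrc : ∀ {k e x}, (C k).fE e = .inl x → ∃ z, e = .inl z)
    (freshTgt : ∀ {v p}, v ∈ fresh → (G'.node v).At p G'.out → p.isOut = true)
    (copyTgt : ∀ {k e}, (C k).fE e = G'.out → e = (C k).G.out)
    (freshOK : ∀ v ∈ fresh, G'.NodeOK D I v (G'.node v))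
    (outBox : G'.boxPremise G'.out = none) (outTy : G'.edgeTy G'.out = A') :
    G'.WF A' D R' I where
  uniq := by
    -- A fresh vertex meets a copy only at the premises of the copy, as their source, or at its
    -- conclusion, as its target. Inside the copy a premise has no source and the conclusion no
    -- target, so there is no clash.
    have key : ∀ {k w p e v' p'}, (G'.node ((C k).fV w)).At p e → v' ∈ fresh →
        (G'.node v').At p' e → p.isOut = p'.isOut → False := by
      intro k w p e v' p' h hv' h' hp
      rw [(C k).node_eq] at h
      obtain ⟨x, rfl, hx⟩ := Node.at_map h
      cases hb : p'.isOut with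
      | true =>
        obtain ⟨z, rfl⟩ := freshOut hv' h' hb
        exact absurd ((hwf k).noSrc hx) (by simp [hp, hb])
      | false =>
        obtain rfl := freshIn hv' h' hb
        exact absurd ((hwf k).noTgt hx) (by simp [hp, hb])
    intro v p e v' p' h h' hp
    rcases cover v with hv | ⟨k, w, rfl⟩ <;> rcases cover v' with hv' | ⟨k', w', rfl⟩
    · exact freshUniq hv hv' h h' hp
    · exact (key h' hv h hp.symm).elim
    · exact (key h hv' h' hp).elim
    · rw [(C k).node_eq] at h
      rw [(C k').node_eq] at h'
      obtain ⟨x, rfl, hx⟩ := Node.at_map h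
      obtain ⟨x', he, hx'⟩ := Node.at_map h'
      obtain rfl := disj he
      obtain rfl := (C k).inj _ _ he
      obtain ⟨rfl, rfl⟩ := (hwf k).uniq hx hx' hp
      exact ⟨rfl, rfl⟩
  noSrc := by
    intro v p x h
    rcases cover v with hv | ⟨k, w, rfl⟩
    · exact freshSrc hv h
    · rw [(C k).node_eq] at h
      obtain ⟨y, hy, hx⟩ := Node.at_map h
      obtain ⟨z, rfl⟩ := copySrc hy.symm
      exact (hwf k).noSrc hx
  noTgt := by
    intro v p h
    rcases cover v with hv | ⟨k, w, rfl⟩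
    · exact freshTgt hv h
    · rw [(C k).node_eq] at h
      obtain ⟨y, hy, hx⟩ := Node.at_map h
      obtain rfl := copyTgt hy.symm
      exact (hwf k).noTgt hx
  outBox := outBox
  outTy := outTy
  ok := by
    intro v
    rcases cover v with hv | ⟨k, w, rfl⟩
    · exact freshOK v hv
    · exact (C k).nodeOK (hJ k) ((hwf k).ok w)
  depth := by
    intro e
    rcases coverE e with he | ⟨k, x, rfl⟩
    · rw [he]; exact .none
    · rw [(C k).box_eq]
      exact ((C k).boxDepth (hs k) ((hwf k).depth x)).mono (hR k)

/-! ### Well-formedness is preserved by the graph of every typing rule -/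

theorem IGraph.edgeTy_inl_congr {n : ℕ} {𝒜 : Fin n → FreeAlg} {Γ Γ' : Ctx 𝒜} {G : IGraph Γ}
    {G' : IGraph Γ'} {x : Γ.Dom} {y : Γ'.Dom} (h : Γ' y.1 = Γ x.1) :
    G'.edgeTy (.inl y) = G.edgeTy (.inl x) := by
  simp only [IGraph.edgeTy, h]

theorem IGraph.edgeTy_inl {n : ℕ} {𝒜 : Fin n → FreeAlg} {Γ : Ctx 𝒜} {G : IGraph Γ}
    {x : Γ.Dom} {A : Ty 𝒜} : G.edgeTy (.inl x) = A ↔ Γ x.1 = some A := by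
  simp only [IGraph.edgeTy, Option.eq_some_iff_get_eq, x.2, exists_true_left]

theorem Ctx.Union.eq_left {n : ℕ} {𝒜 : Fin n → FreeAlg} {Γ₁ Γ₂ Γ : Ctx 𝒜}
    (h : Ctx.Union Γ₁ Γ₂ Γ) {x : ℕ} (hx : (Γ₁ x).isSome = true) : Γ x = Γ₁ x := by
  obtain ⟨A, hA⟩ := Option.isSome_iff_exists.mp hx
  rw [hA]
  exact (h.2 x A).mpr (Or.inl hA)

theorem Ctx.Union.eq_right {n : ℕ} {𝒜 : Fin n → FreeAlg} {Γ₁ Γ₂ Γ : Ctx 𝒜}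
    (h : Ctx.Union Γ₁ Γ₂ Γ) {x : ℕ} (hx : (Γ₂ x).isSome = true) : Γ x = Γ₂ x := by
  obtain ⟨A, hA⟩ := Option.isSome_iff_exists.mp hx
  rw [hA]
  exact (h.2 x A).mpr (Or.inr hA)

theorem Ctx.UnionAll.eq_branch {n : ℕ} {𝒜 : Fin n → FreeAlg} {k : ℕ} {Γs : Fin k → Ctx 𝒜}
    {Δ Γ : Ctx 𝒜} (h : Ctx.UnionAll Γs Δ Γ) {i : Fin k} {x : ℕ}
    (hx : (Γs i x).isSome = true) : Γ x = Γs i x := by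
  obtain ⟨A, hA⟩ := Option.isSome_iff_exists.mp hx
  rw [hA]
  exact (h.2.2 x A).mpr (Or.inl ⟨i, hA⟩)

theorem Ctx.UnionAll.eq_main {n : ℕ} {𝒜 : Fin n → FreeAlg} {k : ℕ} {Γs : Fin k → Ctx 𝒜}
    {Δ Γ : Ctx 𝒜} (h : Ctx.UnionAll Γs Δ Γ) {x : ℕ}
    (hx : (Δ x).isSome = true) : Γ x = Δ x := by
  obtain ⟨A, hA⟩ := Option.isSome_iff_exists.mp hx
  rw [hA]
  exact (h.2.2 x A).mpr (Or.inr hA)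

theorem IGraph.ax_wf {n : ℕ} {𝒜 : Fin n → FreeAlg} {Γ' : Ctx 𝒜} (x : ℕ) (A : Ty 𝒜)
    (hΓ' : Γ' = Ctx.empty.insert x A) (D : Set (Ty 𝒜)) (R I : ℕ) :
    (IGraph.ax x A hΓ').WF A D R I where
  uniq := fun {v} => v.elim
  noSrc := fun {v} => v.elim
  noTgt := fun {v} => v.elim
  outBox := rfl
  outTy := by
    subst hΓ'
    exact IGraph.edgeTy_inl.mpr (by simp [Ctx.insert])
  ok := fun v => v.elim
  depth := by
    rintro (e | e)
    · exact .none
    · exact e.elim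

theorem IGraph.con_wf {n : ℕ} {𝒜 : Fin n → FreeAlg} (Γ' : Ctx 𝒜) (a : Fin n)
    (c : Fin (𝒜 a).k) (i : ℕ) (D : Set (Ty 𝒜)) (R I : ℕ) :
    (IGraph.con Γ' a c i).WF (Ty.arrows ((𝒜 a).arity c) (.base a i) (.base a i)) D R I where
  uniq := by
    rintro v p e v' p' ⟨rfl, -⟩ ⟨rfl, -⟩ -
    exact ⟨rfl, rfl⟩
  noSrc := by
    rintro v p x ⟨-, h⟩
    cases h
  noTgt := by
    rintro v p ⟨rfl, -⟩
    rfl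
  outBox := rfl
  outTy := rfl
  ok := fun _ => ⟨i, rfl⟩
  depth := by
    rintro (e | e)
    · exact .none
    · exact .none

theorem IGraph.WF.weak {n : ℕ} {𝒜 : Fin n → FreeAlg} {Γ Γ' : Ctx 𝒜} {x : ℕ} {A B : Ty 𝒜}
    (hx : Γ x = none) (hΓ' : Γ' = Γ.insert x A) {G : IGraph Γ} {D : Set (Ty 𝒜)} {R I : ℕ}
    (h : G.WF B D R I) : (G.weak x A hΓ').WF B D R I := by
  subst hΓ'
  have hne : ∀ w : Γ.Dom, w.1 ≠ x := by
    rintro ⟨w, hw⟩ rfl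
    simp [hx] at hw
  let C : (G.weak x A rfl).Copy :=
    { Γ := Γ
      G := G
      fV := some
      fE := Sum.map (fun w => ⟨w.1, Ctx.isSome_insert Γ x A w.1 w.2⟩) id
      τ := Option.map some
      node_eq := fun _ => rfl
      ty_eq := by
        rintro (w | e)
        · exact IGraph.edgeTy_inl_congr (by simp [Ctx.insert, hne w])
        · rfl
      box_eq := by rintro (w | e) <;> rfl
      τ_some := fun _ => rfl
      inj := by
        rintro (⟨w, hw⟩ | e) (⟨w', hw'⟩ | e') he <;> cases he <;> rfl }
  refine IGraph.WF.glue (K := Unit) (fun _ => C) (fun _ => h) (fun _ => le_rfl)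
    (s := fun _ => 0) (fun _ => le_rfl) (fun _ => .none) (fun _ => rfl) {none} ?_ ?_ ?_ ?_ ?_ ?_ ?_
    ?_ ?_ ?_ ?_ ?_
  · rintro (_ | v)
    · exact Or.inl rfl
    · exact Or.inr ⟨(), v, rfl⟩
  · rintro (e | e)
    · exact Or.inl rfl
    · exact Or.inr ⟨(), .inr e, rfl⟩
  · rintro v p k (z | e) rfl ⟨-, he⟩ -
    · exact ⟨z, rfl⟩
    · cases he
  · rintro v p k (z | e) rfl ⟨-, he⟩ -
    · exact absurd (congrArg Subtype.val (Sum.inl.inj he)) (hne z)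
    · cases he
  · rintro v p e v' p' rfl rfl ⟨rfl, -⟩ ⟨rfl, -⟩ -
    exact ⟨rfl, rfl⟩
  · rintro v p e rfl ⟨rfl, -⟩
    rfl
  · rintro k (z | e) y he
    · exact ⟨z, rfl⟩
    · cases he
  · rintro v p rfl ⟨-, he⟩
    exfalso
    have he' : C.fE G.out = _ := he
    rcases hG : G.out with z | e
    · rw [hG] at he'
      exact absurd (congrArg Subtype.val (Sum.inl.inj he')) (hne z)
    · rw [hG] at he'
      cases he'
  · rintro k e he
    exact C.inj _ _ he
  · rintro v rfl
    trivial
  · exact (C.box_eq G.out).trans (by rw [show C.G.boxPremise G.out = none from h.outBox]; rfl)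
  · exact (C.ty_eq G.out).trans h.outTy

theorem IGraph.WF.lam {n : ℕ} {𝒜 : Fin n → FreeAlg} {Γ : Ctx 𝒜} {A B : Ty 𝒜}
    {G : IGraph (Γ.cons A)} {D : Set (Ty 𝒜)} {R I : ℕ}
    (h : G.WF B D R I) : (G.lam A B).WF (.arr A B) D R I := by
  let C : (G.lam A B).Copy :=
    { Γ := Γ.cons A
      G := G
      fV := some
      fE := fun
        | .inl ⟨0, _⟩ => .inr (.inl false)
        | .inl ⟨x + 1, hx⟩ => .inl ⟨x, hx⟩
        | .inr e => .inr (.inr e)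
      τ := Option.map some
      node_eq := fun _ => rfl
      ty_eq := by
        rintro (⟨_ | w, hw⟩ | e)
        · rfl
        · exact IGraph.edgeTy_inl_congr rfl
        · rfl
      box_eq := by rintro (⟨_ | w, hw⟩ | e) <;> rfl
      τ_some := fun _ => rfl
      inj := by
        rintro (⟨_ | w, hw⟩ | e) (⟨_ | w', hw'⟩ | e') he <;> cases he <;> rfl }
  have hout : C.fE G.out ≠ .inr (.inl true) := by
    intro he
    rcases hG : G.out with ⟨_ | w, hw⟩ | e <;> rw [hG] at he <;> cases he
  refine IGraph.WF.glue (K := Unit) (fun _ => C) (fun _ => h) (fun _ => le_rfl)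
    (s := fun _ => 0) (fun _ => le_rfl) (fun _ => .none) (fun _ => rfl) {none} ?_ ?_ ?_ ?_ ?_ ?_ ?_
    ?_ ?_ ?_ ?_ ?_
  · rintro (_ | v)
    · exact Or.inl rfl
    · exact Or.inr ⟨(), v, rfl⟩
  · rintro (e | e | e)
    · exact Or.inl rfl
    · exact Or.inl rfl
    · exact Or.inr ⟨(), .inr e, rfl⟩
  · rintro v p k x rfl (⟨rfl, he⟩ | ⟨rfl, he⟩ | ⟨rfl, he⟩) hp
    · rcases x with z | e
      · exact ⟨z, rfl⟩
      · cases he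
    · cases hp
    · rcases x with ⟨_ | w, hw⟩ | e <;> cases he
  · rintro v p k x rfl (⟨rfl, he⟩ | ⟨rfl, he⟩ | ⟨rfl, he⟩) hp
    · cases hp
    · exact C.inj _ _ he
    · cases hp
  · rintro v p e v' p' rfl rfl (⟨rfl, he⟩ | ⟨rfl, he⟩ | ⟨rfl, he⟩)
      (⟨rfl, he'⟩ | ⟨rfl, he'⟩ | ⟨rfl, he'⟩) hp <;> 
      first | exact ⟨rfl, rfl⟩ | (cases hp; done) | (rw [he] at he'; cases he')
  · rintro v p e rfl (⟨rfl, he⟩ | ⟨rfl, he⟩ | ⟨rfl, he⟩)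
    · cases he
    · rfl
    · cases he
  · rintro k (z | e) y he
    · exact ⟨z, rfl⟩
    · cases he
  · rintro v p rfl (⟨rfl, he⟩ | ⟨rfl, he⟩ | ⟨rfl, he⟩)
    · rfl
    · exact absurd he.symm hout
    · rfl
  · rintro k (⟨_ | w, hw⟩ | e) he <;> cases he
  · rintro v rfl
    refine ⟨?_, rfl, ?_⟩
    · exact congrArg (Ty.arr A) ((C.ty_eq G.out).trans h.outTy).symm
    · exact (C.box_eq G.out).trans (by rw [show C.G.boxPremise G.out = none from h.outBox]; rfl)
  · rfl
  · rfl

theorem IGraph.WF.contr {n : ℕ} {𝒜 : Fin n → FreeAlg} {Γ Γ' Γ'' : Ctx 𝒜} {x y z : ℕ}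
    {A B : Ty 𝒜} (hxy : x ≠ y) (hz : Γ z = none) (hΓ'' : Γ'' = (Γ.insert x A).insert y A)
    (hΓ' : Γ' = Γ.insert z A) {G : IGraph Γ''} {D : Set (Ty 𝒜)} (hA : A ∈ D) {R I : ℕ}
    (h : G.WF B D R I) : (G.contr x y z A hΓ'' hΓ').WF B D R I := by
  subst hΓ' hΓ''
  have hty : ∀ hz', (G.contr x y z A rfl rfl).edgeTy (.inl ⟨z, hz'⟩) = A := fun _ =>
    IGraph.edgeTy_inl.mpr (by simp [Ctx.insert])
  have hne : ∀ w : ℕ, w ≠ x → w ≠ y → (((Γ.insert x A).insert y A) w).isSome = true →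
      w ≠ z := by
    rintro w hx hy hw rfl
    simp [Ctx.insert, hx, hy, hz] at hw
  let C : (G.contr x y z A rfl rfl).Copy :=
    { Γ := (Γ.insert x A).insert y A
      G := G
      fV := some
      fE := fun
        | .inl w =>
            if hx : w.1 = x then .inr (.inl false)
            else if hy : w.1 = y then .inr (.inl true)
            else .inl ⟨w.1, Ctx.isSome_insert Γ z A w.1 (Ctx.isSome_of_insert Γ x A w.1 hx
              (Ctx.isSome_of_insert (Γ.insert x A) y A w.1 hy w.2))⟩
        | .inr e => .inr (.inr e)
      τ := Option.map some
      node_eq := by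
        intro v
        refine congrFun (congrArg Node.map (funext ?_)) (G.node v)
        rintro (w | e) <;> rfl
      ty_eq := by
        rintro (⟨w, hw⟩ | e)
        · by_cases hx : w = x
          · subst hx
            simp only [dite_true]
            change A = _
            exact (IGraph.edgeTy_inl.mpr (by simp [Ctx.insert])).symm
          · by_cases hy : w = y
            · subst hy
              simp only [hx, dite_true, dite_false]
              change A = _
              exact (IGraph.edgeTy_inl.mpr (by simp [Ctx.insert])).symm
            · simp only [hx, hy, dite_false]
              exact IGraph.edgeTy_inl_congr (by simp [Ctx.insert, hx, hy, hne w hx hy hw])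
        · rfl
      box_eq := by
        rintro (⟨w, hw⟩ | e)
        · dsimp only
          split_ifs <;> rfl
        · rfl
      τ_some := fun _ => rfl
      inj := by
        rintro (⟨w, hw⟩ | e) (⟨w', hw'⟩ | e') he
        · dsimp only at he
          split_ifs at he <;> first | cases he; done | cases he; rfl | simp_all
        · dsimp only at he
          split_ifs at he <;> cases he
        · dsimp only at he
          split_ifs at he <;> cases he
        · cases he
          rfl }
  have hC : ∀ e hz', C.fE e ≠ .inl ⟨z, hz'⟩ := by
    rintro (⟨w, hw⟩ | e) hz' he
    · dsimp only [C] at he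
      split_ifs at he with h1 h2
      exact hne w h1 h2 hw (congrArg Subtype.val (Sum.inl.inj he))
    · cases he
  have hout : (G.contr x y z A rfl rfl).out = C.fE G.out := by
    rcases hG : G.out with w | e <;> simp only [IGraph.contr, hG, C]
  refine IGraph.WF.glue (K := Unit) (fun _ => C) (fun _ => h) (fun _ => le_rfl)
    (s := fun _ => 0) (fun _ => le_rfl) (fun _ => .none) (fun _ => rfl) {none} ?_ ?_ ?_ ?_ ?_ ?_ ?_
    ?_ ?_ ?_ ?_ ?_
  · rintro (_ | v)
    · exact Or.inl rfl
    · exact Or.inr ⟨(), v, rfl⟩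
  · rintro (e | e | e)
    · exact Or.inl rfl
    · exact Or.inl rfl
    · exact Or.inr ⟨(), .inr e, rfl⟩
  · rintro v p k (w | e) rfl (⟨rfl, he⟩ | ⟨rfl, he⟩ | ⟨rfl, he⟩) hp <;>
      first | exact ⟨w, rfl⟩ | cases he
  · rintro v p k w rfl (⟨rfl, he⟩ | ⟨rfl, he⟩ | ⟨rfl, he⟩) hp
    · cases hp
    · cases hp
    · exact absurd he (hC _ _)
  · rintro v p e v' p' rfl rfl (⟨rfl, he⟩ | ⟨rfl, he⟩ | ⟨rfl, he⟩)
      (⟨rfl, he'⟩ | ⟨rfl, he'⟩ | ⟨rfl, he'⟩) hp <;> 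
      first | exact ⟨rfl, rfl⟩ | (cases hp; done) | (rw [he] at he'; cases he')
  · rintro v p e rfl (⟨rfl, he⟩ | ⟨rfl, he⟩ | ⟨rfl, he⟩)
    · cases he
    · cases he
    · rfl
  · rintro k (z | e) y he
    · exact ⟨z, rfl⟩
    · cases he
  · rintro v p rfl (⟨rfl, he⟩ | ⟨rfl, he⟩ | ⟨rfl, he⟩)
    · rfl
    · rfl
    · exact absurd (hout.symm.trans he) (hC _ _)
  · rintro k e he
    exact C.inj _ _ (he.trans hout)
  · rintro v rfl
    exact ⟨(hty _).symm, (hty _).symm, (hty _).symm ▸ hA, rfl, rfl⟩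
  · rw [hout]
    exact (C.box_eq G.out).trans (by rw [show C.G.boxPremise G.out = none from h.outBox]; rfl)
  · rw [hout]
    exact (C.ty_eq G.out).trans h.outTy

theorem Ctx.false_of_isSome {n : ℕ} {𝒜 : Fin n → FreeAlg} {Γ : Ctx 𝒜} {x : ℕ}
    (hx : (Γ x).isSome = true) (h : Γ x = none) : False := by
  rw [h] at hx
  cases hx

theorem IGraph.WF.app {n : ℕ} {𝒜 : Fin n → FreeAlg} {Γ Γ₁ Γ₂ : Ctx 𝒜}
    (hΓ : Ctx.Union Γ₁ Γ₂ Γ) {A B : Ty 𝒜} {G₁ : IGraph Γ₁} {G₂ : IGraph Γ₂} {D : Set (Ty 𝒜)}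
    {R₁ R₂ I₁ I₂ : ℕ} (h₁ : G₁.WF (.arr A B) D R₁ I₁) (h₂ : G₂.WF A D R₂ I₂) :
    (IGraph.app hΓ B G₁ G₂).WF B D (max R₁ R₂) (max I₁ I₂) := by
  let C₁ : (IGraph.app hΓ B G₁ G₂).Copy :=
    { Γ := Γ₁
      G := G₁
      fV := fun v => some (.inl v)
      fE := Sum.map (fun w => ⟨w.1, hΓ.left w.1 w.2⟩) fun e => some (.inl e)
      τ := Option.map fun v => some (.inl v)
      node_eq := fun _ => rfl
      ty_eq := by
        rintro (w | e)
        · exact IGraph.edgeTy_inl_congr (hΓ.eq_left w.2)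
        · rfl
      box_eq := by rintro (w | e) <;> rfl
      τ_some := fun _ => rfl
      inj := by
        rintro (⟨w, hw⟩ | e) (⟨w', hw'⟩ | e') he <;> cases he <;> rfl }
  let C₂ : (IGraph.app hΓ B G₁ G₂).Copy :=
    { Γ := Γ₂
      G := G₂
      fV := fun v => some (.inr v)
      fE := Sum.map (fun w => ⟨w.1, hΓ.right w.1 w.2⟩) fun e => some (.inr e)
      τ := Option.map fun v => some (.inr v)
      node_eq := fun _ => rfl
      ty_eq := by
        rintro (w | e)
        · exact IGraph.edgeTy_inl_congr (hΓ.eq_right w.2)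
        · rfl
      box_eq := by rintro (w | e) <;> rfl
      τ_some := fun _ => rfl
      inj := by
        rintro (⟨w, hw⟩ | e) (⟨w', hw'⟩ | e') he <;> cases he <;> rfl }
  have hdisj : ∀ e e', C₁.fE e ≠ C₂.fE e' := by
    rintro (⟨w, hw⟩ | e) (⟨w', hw'⟩ | e') he
    · obtain rfl : w = w' := congrArg Subtype.val (Sum.inl.inj he)
      exact (hΓ.1 w).elim (Ctx.false_of_isSome hw) (Ctx.false_of_isSome hw')
    all_goals cases he
  have ho₁ : ∀ e, C₁.fE e ≠ .inr none := by rintro (e | e) he <;> cases he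
  have ho₂ : ∀ e, C₂.fE e ≠ .inr none := by rintro (e | e) he <;> cases he
  refine IGraph.WF.glue (K := Bool) (fun b => if b then C₁ else C₂)
    (A := fun b => if b then .arr A B else A) (R := fun b => if b then R₁ else R₂)
    (J := fun b => if b then I₁ else I₂) (s := fun _ => 0)
    ?_ ?_ ?_ ?_ ?_ {none} ?_ ?_ ?_ ?_ ?_ ?_ ?_ ?_ ?_ ?_ ?_ ?_
  · rintro (_ | _)
    · exact h₂
    · exact h₁
  · rintro (_ | _)
    · exact le_max_right _ _
    · exact le_max_left _ _
  · rintro (_ | _)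
    · exact le_max_right _ _
    · exact le_max_left _ _
  · rintro (_ | _)
    · exact .none
    · exact .none
  · rintro (_ | _) (_ | _) e e' he
    · rfl
    · exact absurd he.symm (hdisj _ _)
    · exact absurd he (hdisj _ _)
    · rfl
  · rintro (_ | v | v)
    · exact Or.inl rfl
    · exact Or.inr ⟨true, v, rfl⟩
    · exact Or.inr ⟨false, v, rfl⟩
  · rintro (e | _ | e | e)
    · exact Or.inl rfl
    · exact Or.inl rfl
    · exact Or.inr ⟨true, .inr e, rfl⟩
    · exact Or.inr ⟨false, .inr e, rfl⟩
  · rintro v p (_ | _) x rfl (⟨rfl, he⟩ | ⟨rfl, he⟩ | ⟨rfl, he⟩) hp <;>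
      try cases hp
    · exact absurd he (ho₂ _)
    · exact absurd he (ho₁ _)
  · rintro v p (_ | _) x rfl (⟨rfl, he⟩ | ⟨rfl, he⟩ | ⟨rfl, he⟩) hp <;>
      try cases hp
    · exact absurd he.symm (hdisj _ _)
    · exact C₂.inj _ _ he
    · exact C₁.inj _ _ he
    · exact absurd he (hdisj _ _)
  · rintro v p e v' p' rfl rfl (⟨rfl, he⟩ | ⟨rfl, he⟩ | ⟨rfl, he⟩)
      (⟨rfl, he'⟩ | ⟨rfl, he'⟩ | ⟨rfl, he'⟩) hp <;> first | exact ⟨rfl, rfl⟩ | cases hp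
    · exact absurd (he.symm.trans he') (hdisj _ _)
    · exact absurd (he'.symm.trans he) (hdisj _ _)
  · rintro v p e rfl (⟨rfl, he⟩ | ⟨rfl, he⟩ | ⟨rfl, he⟩)
    · rfl
    · rfl
    · cases he
  · rintro (_ | _) (z | e) y he <;> first | exact ⟨z, rfl⟩ | cases he
  · rintro v p rfl (⟨rfl, he⟩ | ⟨rfl, he⟩ | ⟨rfl, he⟩)
    · exact absurd he.symm (ho₁ _)
    · exact absurd he.symm (ho₂ _)
    · rfl
  · rintro (_ | _) e he
    · exact absurd he (ho₂ _)
    · exact absurd he (ho₁ _)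
  · rintro v rfl
    refine ⟨?_, ?_, ?_⟩
    · exact ((C₁.ty_eq G₁.out).trans h₁.outTy).trans
        (congrArg (Ty.arr · B) ((C₂.ty_eq G₂.out).trans h₂.outTy).symm)
    · exact (C₁.box_eq G₁.out).trans (by rw [show C₁.G.boxPremise G₁.out = none from h₁.outBox]; rfl)
    · exact (C₂.box_eq G₂.out).trans (by rw [show C₂.G.boxPremise G₂.out = none from h₂.outBox]; rfl)
  · rfl
  · rfl

theorem IGraph.WF.cond {n : ℕ} {𝒜 : Fin n → FreeAlg} {a : Fin n} {Γs : Fin (𝒜 a).k → Ctx 𝒜}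
    {Δ Γ : Ctx 𝒜} (hΓ : Ctx.UnionAll Γs Δ Γ) {C : Ty 𝒜} {m : ℕ}
    {Gs : ∀ i, IGraph (Γs i)} {G₀ : IGraph Δ} {D : Set (Ty 𝒜)} {R R₀ I I₀ : ℕ}
    {Rs Is : Fin (𝒜 a).k → ℕ}
    (hs : ∀ i, (Gs i).WF (Ty.arrows ((𝒜 a).arity i) (.base a m) C) D (Rs i) (Is i))
    (h₀ : G₀.WF (.base a m) D R₀ I₀) (hRs : ∀ i, Rs i ≤ R) (hR₀ : R₀ ≤ R)
    (hIs : ∀ i, Is i ≤ I) (hI₀ : I₀ ≤ I) :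
    (IGraph.cond hΓ C Gs G₀).WF C D R I := by
  let C₀ : (IGraph.cond hΓ C Gs G₀).Copy :=
    { Γ := Δ
      G := G₀
      fV := fun v => some (.inr v)
      fE := Sum.map (fun w => ⟨w.1, hΓ.main w.1 w.2⟩) fun e => some (.inr e)
      τ := Option.map fun v => some (.inr v)
      node_eq := fun _ => rfl
      ty_eq := by
        rintro (w | e)
        · exact IGraph.edgeTy_inl_congr (hΓ.eq_main w.2)
        · rfl
      box_eq := by rintro (w | e) <;> rfl
      τ_some := fun _ => rfl
      inj := by
        rintro (⟨w, hw⟩ | e) (⟨w', hw'⟩ | e') he <;> cases he <;> rfl }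
  let Cs (i : Fin (𝒜 a).k) : (IGraph.cond hΓ C Gs G₀).Copy :=
    { Γ := Γs i
      G := Gs i
      fV := fun v => some (.inl ⟨i, v⟩)
      fE := Sum.map (fun w => ⟨w.1, hΓ.branch i w.1 w.2⟩) fun e => some (.inl ⟨i, e⟩)
      τ := Option.map fun v => some (.inl ⟨i, v⟩)
      node_eq := fun _ => rfl
      ty_eq := by
        rintro (w | e)
        · exact IGraph.edgeTy_inl_congr (hΓ.eq_branch w.2)
        · rfl
      box_eq := by rintro (w | e) <;> rfl
      τ_some := fun _ => rfl
      inj := by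
        rintro (⟨w, hw⟩ | e) (⟨w', hw'⟩ | e') he <;> cases he <;> rfl }
  have hdisj₀ : ∀ i e e', (Cs i).fE e ≠ C₀.fE e' := by
    rintro i (⟨w, hw⟩ | e) (⟨w', hw'⟩ | e') he
    · obtain rfl : w = w' := congrArg Subtype.val (Sum.inl.inj he)
      exact (hΓ.2.1 i w).elim (Ctx.false_of_isSome hw) (Ctx.false_of_isSome hw')
    all_goals cases he
  have hdisj : ∀ i j e e', (Cs i).fE e = (Cs j).fE e' → i = j := by
    rintro i j (⟨w, hw⟩ | e) (⟨w', hw'⟩ | e') he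
    · obtain rfl : w = w' := congrArg Subtype.val (Sum.inl.inj he)
      by_contra hij
      exact (hΓ.1 i j hij w).elim (Ctx.false_of_isSome hw) (Ctx.false_of_isSome hw')
    all_goals cases he
    rfl
  have ho₀ : ∀ e, C₀.fE e ≠ .inr none := by rintro (e | e) he <;> cases he
  have hos : ∀ i e, (Cs i).fE e ≠ .inr none := by rintro i (e | e) he <;> cases he
  refine IGraph.WF.glue (K := Option (Fin (𝒜 a).k)) (fun o => o.elim C₀ Cs)
    (A := fun o => o.elim (.base a m) fun i => Ty.arrows ((𝒜 a).arity i) (.base a m) C)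
    (R := fun o => o.elim R₀ Rs) (J := fun o => o.elim I₀ Is) (s := fun _ => 0)
    ?_ ?_ ?_ ?_ ?_ {none} ?_ ?_ ?_ ?_ ?_ ?_ ?_ ?_ ?_ ?_ ?_ ?_
  · rintro (_ | i)
    · exact h₀
    · exact hs i
  · rintro (_ | i)
    · exact hI₀
    · exact hIs i
  · rintro (_ | i)
    · exact hR₀
    · exact hRs i
  · rintro (_ | i)
    · exact .none
    · exact .none
  · rintro (_ | i) (_ | j) e e' he
    · rfl
    · exact absurd he.symm (hdisj₀ _ _ _)
    · exact absurd he (hdisj₀ _ _ _)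
    · rw [hdisj _ _ _ _ he]
  · rintro (_ | ⟨i, v⟩ | v)
    · exact Or.inl rfl
    · exact Or.inr ⟨some i, v, rfl⟩
    · exact Or.inr ⟨none, v, rfl⟩
  · rintro (e | _ | ⟨i, e⟩ | e)
    · exact Or.inl rfl
    · exact Or.inl rfl
    · exact Or.inr ⟨some i, .inr e, rfl⟩
    · exact Or.inr ⟨none, .inr e, rfl⟩
  · rintro v p (_ | i) x rfl (⟨rfl, he⟩ | ⟨rfl, he⟩ | ⟨c, rfl, he⟩) hp <;>
      try cases hp
    · exact absurd he (ho₀ _)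
    · exact absurd he (hos _ _)
  · rintro v p (_ | i) x rfl (⟨rfl, he⟩ | ⟨rfl, he⟩ | ⟨c, rfl, he⟩) hp <;>
      try cases hp
    · exact C₀.inj _ _ he
    · exact absurd he.symm (hdisj₀ _ _ _)
    · exact absurd he (hdisj₀ _ _ _)
    · obtain rfl := hdisj _ _ _ _ he
      exact (Cs i).inj _ _ he
  · rintro v p e v' p' rfl rfl (⟨rfl, he⟩ | ⟨rfl, he⟩ | ⟨c, rfl, he⟩)
      (⟨rfl, he'⟩ | ⟨rfl, he'⟩ | ⟨c', rfl, he'⟩) hp <;>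
      first | exact ⟨rfl, rfl⟩ | cases hp
    · exact absurd (he'.symm.trans he) (hdisj₀ _ _ _)
    · exact absurd (he.symm.trans he') (hdisj₀ _ _ _)
    · obtain rfl := hdisj _ _ _ _ (he.symm.trans he')
      exact ⟨rfl, rfl⟩
  · rintro v p e rfl (⟨rfl, he⟩ | ⟨rfl, he⟩ | ⟨c, rfl, he⟩)
    · rfl
    · cases he
    · rfl
  · rintro (_ | i) (z | e) y he <;> first | exact ⟨z, rfl⟩ | cases he
  · rintro v p rfl (⟨rfl, he⟩ | ⟨rfl, he⟩ | ⟨c, rfl, he⟩)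
    · exact absurd he.symm (ho₀ _)
    · rfl
    · exact absurd he.symm (hos _ _)
  · rintro (_ | i) e he
    · exact absurd he (ho₀ _)
    · exact absurd he (hos _ _)
  · rintro v rfl
    have ht₀ := (C₀.ty_eq G₀.out).trans h₀.outTy
    refine ⟨⟨m, ht₀⟩, fun c => ?_, ?_, fun c => ?_⟩
    · exact ((Cs c).ty_eq (Gs c).out).trans ((hs c).outTy.trans
        (congrArg (Ty.arrows _ · C) ht₀.symm))
    · exact (C₀.box_eq G₀.out).trans (by rw [show C₀.G.boxPremise G₀.out = none from h₀.outBox]; rfl)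
    · exact ((Cs c).box_eq (Gs c).out).trans
        (by rw [show (Cs c).G.boxPremise (Gs c).out = none from (hs c).outBox]; rfl)
  · rfl
  · rfl

/-- Unlike in the other constructions, the premises of the branches become internal edges with fresh
sources `P^R`, so the vertex `C^R` is not the only fresh one. The branches are put into a new box,
which costs one level of depth; the graph of the recurrence argument stays outside. -/
theorem IGraph.WF.recur {n : ℕ} {𝒜 : Fin n → FreeAlg} {a : Fin n} {Γs : Fin (𝒜 a).k → Ctx 𝒜}
    {Δ Γ : Ctx 𝒜} (hΓ : Ctx.UnionAll Γs Δ Γ) {C : Ty 𝒜} {m : ℕ}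
    {Gs : ∀ i, IGraph (Γs i)} {G₀ : IGraph Δ} {D : Set (Ty 𝒜)} {R R₀ I I₀ : ℕ}
    {Rs Is : Fin (𝒜 a).k → ℕ} (hdup : ∀ i x A, Γs i x = some A → A ∈ D) (hm : C.level < m)
    (hs : ∀ i, (Gs i).WF (Ty.arrows ((𝒜 a).arity i) (.base a m)
      (Ty.arrows ((𝒜 a).arity i) C C)) D (Rs i) (Is i))
    (h₀ : G₀.WF (.base a m) D R₀ I₀) (hRs : ∀ i, Rs i + 1 ≤ R) (hR₀ : R₀ ≤ R)
    (hIs : ∀ i, Is i ≤ I) (hI₀ : I₀ ≤ I) (hmI : m ≤ I) :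
    (IGraph.recur hΓ C Gs G₀).WF C D R I := by
  let C₀ : (IGraph.recur hΓ C Gs G₀).Copy :=
    { Γ := Δ
      G := G₀
      fV := fun v => some (.inr v)
      fE := Sum.map (fun w => ⟨w.1, hΓ.main w.1 w.2⟩) fun e => some (.inr e)
      τ := Option.map fun v => some (.inr v)
      node_eq := fun _ => rfl
      ty_eq := by
        rintro (w | e)
        · exact IGraph.edgeTy_inl_congr (hΓ.eq_main w.2)
        · rfl
      box_eq := by rintro (w | e) <;> rfl
      τ_some := fun _ => rfl
      inj := by
        rintro (⟨w, hw⟩ | e) (⟨w', hw'⟩ | e') he <;> cases he <;> rfl }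
  let Cs (i : Fin (𝒜 a).k) : (IGraph.recur hΓ C Gs G₀).Copy :=
    { Γ := Γs i
      G := Gs i
      fV := fun v => some (.inl ⟨i, .inr v⟩)
      fE := fun e => .inr (some (.inl ⟨i, e⟩))
      τ := fun
        | none => some none
        | some v => some (some (.inl ⟨i, .inr v⟩))
      node_eq := fun _ => rfl
      ty_eq := fun _ => rfl
      box_eq := fun _ => rfl
      τ_some := fun _ => rfl
      inj := by
        rintro e e' he
        cases he
        rfl }
  have hdisj₀ : ∀ i e e', (Cs i).fE e ≠ C₀.fE e' := by
    rintro i e (⟨w', hw'⟩ | e') he <;> cases he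
  have hdisj : ∀ i j e e', (Cs i).fE e = (Cs j).fE e' → i = j := by
    rintro i j e e' he
    cases he
    rfl
  have ho₀ : ∀ e, C₀.fE e ≠ .inr none := by rintro (e | e) he <;> cases he
  have hos : ∀ i e, (Cs i).fE e ≠ .inr none := by rintro i e he; cases he
  have hbox₀ : (IGraph.recur hΓ C Gs G₀).boxPremise (C₀.fE G₀.out) = none :=
    (C₀.box_eq G₀.out).trans (by rw [show C₀.G.boxPremise G₀.out = none from h₀.outBox]; rfl)
  have hboxs : ∀ i e, (Gs i).boxPremise e = none →
      (IGraph.recur hΓ C Gs G₀).boxPremise ((Cs i).fE e) = some none := fun i e h =>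
    ((Cs i).box_eq e).trans (by rw [show (Cs i).G.boxPremise e = none from h]; rfl)
  have hprem₀ : ∀ j (y : (Γs j).Dom) e, C₀.fE e ≠ .inl ⟨y.1, hΓ.branch j y.1 y.2⟩ := by
    rintro j y (x | e) he
    · have h1 : x.1 = y.1 := congrArg Subtype.val (Sum.inl.inj he)
      have h3 := y.2
      rw [← h1] at h3
      exact (hΓ.2.1 j x.1).elim (Ctx.false_of_isSome h3) (Ctx.false_of_isSome x.2)
    · cases he
  have hpremTy : ∀ i (x : (Γs i).Dom), (IGraph.recur hΓ C Gs G₀).edgeTy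
      (.inl ⟨x.1, hΓ.branch i x.1 x.2⟩) = (Gs i).edgeTy (.inl x) := fun i x =>
    IGraph.edgeTy_inl_congr (hΓ.eq_branch x.2)
  refine IGraph.WF.glue (K := Option (Fin (𝒜 a).k)) (fun o => o.elim C₀ Cs)
    (A := fun o => o.elim (.base a m) fun i => Ty.arrows ((𝒜 a).arity i) (.base a m)
      (Ty.arrows ((𝒜 a).arity i) C C))
    (R := fun o => o.elim R₀ Rs) (J := fun o => o.elim I₀ Is) (s := fun o => o.elim 0 fun _ => 1)
    ?_ ?_ ?_ ?_ ?_ {v | v = none ∨ ∃ i x, v = some (.inl ⟨i, .inl x⟩)} ?_ ?_ ?_ ?_ ?_ ?_ ?_ ?_ ?_ ?_ ?_ ?_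
  · rintro (_ | i)
    · exact h₀
    · exact hs i
  · rintro (_ | i)
    · exact hI₀
    · exact hIs i
  · rintro (_ | i)
    · exact hR₀
    · exact hRs i
  · rintro (_ | i)
    · exact .none
    -- The recursive premise of the new vertex lies in no box, so the new box has depth exactly one.
    · exact .some (G := IGraph.recur hΓ C Gs G₀) (k := 0) (v := none) (a := a)
        (e₀ := C₀.fE G₀.out) (es := fun i => (Cs i).fE (Gs i).out) (g := .inr none) rfl
        (by rw [hbox₀]; exact .none)
  · rintro (_ | i) (_ | j) e e' he
    · rfl
    · exact absurd he.symm (hdisj₀ _ _ _)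
    · exact absurd he (hdisj₀ _ _ _)
    · rw [hdisj _ _ _ _ he]
  · rintro (_ | ⟨i, x | v⟩ | v)
    · exact Or.inl (Or.inl rfl)
    · exact Or.inl (Or.inr ⟨i, x, rfl⟩)
    · exact Or.inr ⟨some i, v, rfl⟩
    · exact Or.inr ⟨none, v, rfl⟩
  · rintro (e | _ | ⟨i, e⟩ | e)
    · exact Or.inl rfl
    · exact Or.inl rfl
    · exact Or.inr ⟨some i, e, rfl⟩
    · exact Or.inr ⟨none, .inr e, rfl⟩
  · rintro v p (_ | i) x (rfl | ⟨j, y, rfl⟩) h hp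
    · rcases h with ⟨rfl, he⟩ | ⟨rfl, he⟩ | ⟨c, rfl, he⟩
      · cases hp
      · exact absurd he (ho₀ _)
      · cases hp
    · rcases h with ⟨rfl, he⟩ | ⟨rfl, he⟩
      · cases hp
      · exact absurd he.symm (hdisj₀ j (.inl y) x)
    · rcases h with ⟨rfl, he⟩ | ⟨rfl, he⟩ | ⟨c, rfl, he⟩
      · cases hp
      · exact absurd he (hos _ _)
      · cases hp
    · rcases h with ⟨rfl, he⟩ | ⟨rfl, he⟩
      · cases hp
      · have he' : (Cs i).fE x = (Cs j).fE (.inl y) := he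
        cases he'
        exact ⟨y, rfl⟩
  · rintro v p (_ | i) x (rfl | ⟨j, y, rfl⟩) h hp
    · rcases h with ⟨rfl, he⟩ | ⟨rfl, he⟩ | ⟨c, rfl, he⟩
      · exact C₀.inj _ _ he
      · cases hp
      · exact absurd he.symm (hdisj₀ _ _ _)
    · rcases h with ⟨rfl, he⟩ | ⟨rfl, he⟩
      · exact absurd he (hprem₀ _ _ _)
      · cases hp
    · rcases h with ⟨rfl, he⟩ | ⟨rfl, he⟩ | ⟨c, rfl, he⟩
      · exact absurd he (hdisj₀ _ _ _)
      · cases hp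
      · obtain rfl := hdisj _ _ _ _ he
        exact (Cs i).inj _ _ he
    · rcases h with ⟨rfl, he⟩ | ⟨rfl, he⟩
      · cases he
      · cases hp
  · rintro v p e v' p' (rfl | ⟨j, y, rfl⟩) (rfl | ⟨j', y', rfl⟩) h h' hp
    · rcases h with ⟨rfl, he⟩ | ⟨rfl, he⟩ | ⟨c, rfl, he⟩ <;>
        rcases h' with ⟨rfl, he'⟩ | ⟨rfl, he'⟩ | ⟨c', rfl, he'⟩ <;>
        first | exact ⟨rfl, rfl⟩ | cases hp
      · exact absurd (he'.symm.trans he) (hdisj₀ _ _ _)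
      · exact absurd (he.symm.trans he') (hdisj₀ _ _ _)
      · obtain rfl := hdisj _ _ _ _ (he.symm.trans he')
        exact ⟨rfl, rfl⟩
    · rcases h with ⟨rfl, he⟩ | ⟨rfl, he⟩ | ⟨c, rfl, he⟩ <;>
        rcases h' with ⟨rfl, he'⟩ | ⟨rfl, he'⟩ <;>
      try cases hp
      · exact absurd (he.symm.trans he') (hprem₀ _ _ _)
      · cases he.symm.trans he'
      · cases he.symm.trans he'
    · rcases h with ⟨rfl, he⟩ | ⟨rfl, he⟩ <;>
        rcases h' with ⟨rfl, he'⟩ | ⟨rfl, he'⟩ | ⟨c, rfl, he'⟩ <;>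
      try cases hp
      · exact absurd (he'.symm.trans he) (hprem₀ _ _ _)
      · cases he.symm.trans he'
      · cases he.symm.trans he'
    · rcases h with ⟨rfl, he⟩ | ⟨rfl, he⟩ <;>
        rcases h' with ⟨rfl, he'⟩ | ⟨rfl, he'⟩ <;>
      try cases hp
      -- Two vertices `P^R` entered by the same outer edge come from the same branch, because the
      -- contexts of the branches are disjoint.
      · have h1 : y.1 = y'.1 := congrArg Subtype.val (Sum.inl.inj (he.symm.trans he'))
        by_cases hj : j = j'
        · subst hj
          obtain rfl := Subtype.ext h1
          exact ⟨rfl, rfl⟩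
        · have h3 := y'.2
          rw [← h1] at h3
          exact ((hΓ.1 j j' hj y.1).elim (Ctx.false_of_isSome y.2)
            (Ctx.false_of_isSome h3)).elim
      · cases he.symm.trans he'
        exact ⟨rfl, rfl⟩
  · rintro v p e (rfl | ⟨j, y, rfl⟩) h
    · rcases h with ⟨rfl, he⟩ | ⟨rfl, he⟩ | ⟨c, rfl, he⟩
      · rfl
      · cases he
      · rfl
    · rcases h with ⟨rfl, he⟩ | ⟨rfl, he⟩
      · rfl
      · cases he
  · rintro (_ | i) (z | e) y he <;> first | exact ⟨z, rfl⟩ | cases he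
  · rintro v p (rfl | ⟨j, y, rfl⟩) h
    · rcases h with ⟨rfl, he⟩ | ⟨rfl, he⟩ | ⟨c, rfl, he⟩
      · exact absurd he.symm (ho₀ _)
      · rfl
      · exact absurd he.symm (hos _ _)
    · rcases h with ⟨rfl, he⟩ | ⟨rfl, he⟩
      · cases he
      · rfl
  · rintro (_ | i) e he
    · exact absurd he (ho₀ _)
    · exact absurd he (hos _ _)
  · rintro v (rfl | ⟨j, y, rfl⟩)
    · have ht₀ := (C₀.ty_eq G₀.out).trans h₀.outTy
      refine ⟨⟨m, ht₀, hm, hmI⟩, fun c => ?_, hbox₀, fun c => hboxs c _ (hs c).outBox⟩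
      exact ((Cs c).ty_eq (Gs c).out).trans ((hs c).outTy.trans
        (congrArg (Ty.arrows _ · _) ht₀.symm))
    · refine ⟨hpremTy j y, ?_, none, a, _, _, _, hboxs j (.inl y) rfl, rfl, hbox₀.symm⟩
      refine hdup j y.1 _ ?_
      exact (IGraph.edgeTy_inl (G := Gs j)).mp rfl
  · rfl
  · rfl

/-- Ramification is used here only, at the recursion rule, to put the level of the result strictly
below the tier of the recurrence argument. The recursion depth bounds the nesting of boxes and the
highest tier bounds the tiers of the vertices `C^R`. -/
theorem Deriv.graph_wf {n : ℕ} {𝒜 : Fin n → FreeAlg} {S : System 𝒜} (hS : S.ramified) {Γ : Ctx 𝒜}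
    {M : Term 𝒜} {A : Ty 𝒜} (π : Deriv S Γ M A) :
    π.graph.WF A S.dup π.recDepth π.highTier := by
  induction π with
  | ax x A hΓ' => exact IGraph.ax_wf x A hΓ' _ _ _
  | weak x A hx hΓ' d ih => exact ih.weak hx hΓ'
  | contr x y z A hxy hx hy hz hA hΓ'' hΓ' hM' d ih => exact ih.contr hxy hz hΓ'' hΓ' hA
  | lam d ih => exact ih.lam
  | app hΓ d₁ d₂ ih₁ ih₂ => exact IGraph.WF.app hΓ ih₁ ih₂
  | con a c i hΓ' => exact IGraph.con_wf _ a c i _ _ _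
  | cond hΓ ds d ihs ih =>
    exact IGraph.WF.cond hΓ ihs ih
      (fun i => le_max_of_le_left (Finset.le_sup (f := fun i => (ds i).recDepth) (Finset.mem_univ i)))
      (le_max_right _ _)
      (fun i => le_max_of_le_left (Finset.le_sup (f := fun i => (ds i).highTier) (Finset.mem_univ i)))
      (le_max_right _ _)
  | recur hΓ hdup hram ds d ihs ih =>
    refine IGraph.WF.recur hΓ hdup (hram hS) ihs ih (fun i => ?_) ?_ (fun i => ?_) ?_
      (le_max_left _ _)
    · have := Finset.le_sup (f := fun i => (ds i).recDepth) (Finset.mem_univ i)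
      simp only [Deriv.recDepth]
      omega
    · simp only [Deriv.recDepth]
      omega
    · exact le_max_of_le_right (le_max_of_le_left
        (Finset.le_sup (f := fun i => (ds i).highTier) (Finset.mem_univ i)))
    · exact le_max_of_le_right (le_max_right _ _)

/-! ### Constructor vertices and the size of the term -/

theorem Term.size_rename {n : ℕ} {𝒜 : Fin n → FreeAlg} (M : Term 𝒜) :
    ∀ σ : ℕ → ℕ, (M.rename σ).size = M.size := by
  induction M with
  | var x => exact fun _ => rfl
  | con a c => exact fun _ => rfl
  | app M N ihM ihN => exact fun σ => by simp only [Term.rename, Term.size, ihM, ihN]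
  | lam M ih => exact fun σ => by simp only [Term.rename, Term.size, ih]
  | cond L M ihL ih => exact fun σ => by simp only [Term.rename, Term.size, ihL, ih]
  | recur L M ihL ih => exact fun σ => by simp only [Term.rename, Term.size, ihL, ih]

/-- The number of constructor vertices is bounded by the size of the term. -/
theorem Deriv.exists_conVertices {n : ℕ} {𝒜 : Fin n → FreeAlg} {S : System 𝒜} {Γ : Ctx 𝒜}
    {M : Term 𝒜} {A : Ty 𝒜} (π : Deriv S Γ M A) :
    ∃ F : Finset π.graph.V, (∀ v a c e, π.graph.node v = .con a c e → v ∈ F) ∧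
      F.card ≤ M.size := by
  classical
  have hmap : ∀ {E E' : Type} {f : E → E'} {N : Node 𝒜 E} {a c e}, N.map f = .con a c e →
      ∃ e', N = .con a c e' := by
    intro E E' f N a c e h
    cases N <;> cases h
    exact ⟨_, rfl⟩
  induction π with
  | ax x A hΓ' => exact ⟨∅, fun v => v.elim, Nat.zero_le _⟩
  | weak x A hx hΓ' d ih =>
    obtain ⟨F, hF, hc⟩ := ih
    refine ⟨F.map .some, ?_, (Finset.card_map Function.Embedding.some).trans_le hc⟩
    rintro (_ | v) a c e h
    · cases h
    · obtain ⟨e', he'⟩ := hmap h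
      exact Finset.mem_map_of_mem _ (hF v a c e' he')
  | contr x y z A hxy hx hy hz hA hΓ'' hΓ' hM' d ih =>
    obtain ⟨F, hF, hc⟩ := ih
    refine ⟨F.map .some, ?_, ?_⟩
    · rintro (_ | v) a c e h
      · cases h
      · obtain ⟨e', he'⟩ := hmap h
        exact Finset.mem_map_of_mem _ (hF v a c e' he')
    · refine (Finset.card_map Function.Embedding.some).trans_le (hc.trans_eq ?_)
      rw [hM', Term.contract, Term.size_rename]
  | lam d ih =>
    obtain ⟨F, hF, hc⟩ := ih
    refine ⟨F.map .some, ?_, (Finset.card_map Function.Embedding.some).trans_le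
      (hc.trans (Nat.le_succ _))⟩
    rintro (_ | v) a c e h
    · cases h
    · obtain ⟨e', he'⟩ := hmap h
      exact Finset.mem_map_of_mem _ (hF v a c e' he')
  | app hΓ d₁ d₂ ih₁ ih₂ =>
    obtain ⟨F₁, hF₁, hc₁⟩ := ih₁
    obtain ⟨F₂, hF₂, hc₂⟩ := ih₂
    refine ⟨(F₁.disjSum F₂).map .some, ?_, ?_⟩
    · rintro (_ | v | v) a c e h
      · cases h
      · obtain ⟨e', he'⟩ := hmap h
        exact Finset.mem_map_of_mem _ (Finset.inl_mem_disjSum.mpr (hF₁ v a c e' he'))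
      · obtain ⟨e', he'⟩ := hmap h
        exact Finset.mem_map_of_mem _ (Finset.inr_mem_disjSum.mpr (hF₂ v a c e' he'))
    · refine (Finset.card_map Function.Embedding.some).trans_le ?_
      rw [Finset.card_disjSum]
      exact Nat.add_le_add hc₁ hc₂
  | con a c i hΓ' => exact ⟨{()}, fun v _ _ _ _ => Finset.mem_singleton_self _, le_rfl⟩
  | @cond a m Γs Δ Γ L M C hΓ ds d ihs ih =>
    obtain ⟨F, hF, hc⟩ := ih
    choose Fs hFs hcs using ihs
    refine ⟨((Finset.univ.sigma Fs).disjSum F).map .some, ?_, ?_⟩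
    · rintro (_ | ⟨i, v⟩ | v) a c e h
      · cases h
      · obtain ⟨e', he'⟩ := hmap h
        exact Finset.mem_map_of_mem _ (Finset.inl_mem_disjSum.mpr
          (Finset.mem_sigma.mpr ⟨Finset.mem_univ _, hFs i v a c e' he'⟩))
      · obtain ⟨e', he'⟩ := hmap h
        exact Finset.mem_map_of_mem _ (Finset.inr_mem_disjSum.mpr (hF v a c e' he'))
    · refine (Finset.card_map Function.Embedding.some).trans_le ?_
      rw [Finset.card_disjSum, Finset.card_sigma, Term.size]
      have := Finset.sum_le_sum fun i (_ : i ∈ Finset.univ) => hcs i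
      omega
  | @recur a m Γs Δ Γ L M C hΓ hdup hram ds d ihs ih =>
    obtain ⟨F, hF, hc⟩ := ih
    choose Fs hFs hcs using ihs
    refine ⟨((Finset.univ.sigma fun i => (Fs i).map .inr).disjSum F).map .some, ?_, ?_⟩
    · rintro (_ | ⟨i, x | v⟩ | v) a c e h
      · cases h
      · cases h
      · obtain ⟨e', he'⟩ := hmap h
        exact Finset.mem_map_of_mem _ (Finset.inl_mem_disjSum.mpr
          (Finset.mem_sigma.mpr ⟨Finset.mem_univ _,
            Finset.mem_map_of_mem _ (hFs i v a c e' he')⟩))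
      · obtain ⟨e', he'⟩ := hmap h
        exact Finset.mem_map_of_mem _ (Finset.inr_mem_disjSum.mpr (hF v a c e' he'))
    · refine (Finset.card_map Function.Embedding.some).trans_le ?_
      rw [Finset.card_disjSum, Finset.card_sigma, Term.size]
      simp only [Finset.card_map]
      have := Finset.sum_le_sum fun i (_ : i ∈ Finset.univ) => hcs i
      omega

theorem Term.one_le_size {n : ℕ} {𝒜 : Fin n → FreeAlg} (M : Term 𝒜) : 1 ≤ M.size := by
  induction M with
  | var x => exact le_rfl
  | con a c => exact le_rfl
  | app M N ihM ihN => exact ihM.trans (Nat.le_add_right _ _)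
  | lam M ih => exact ih.trans (Nat.le_add_right _ _)
  | cond L M ihL ih => rw [Term.size]; omega
  | recur L M ihL ih => rw [Term.size]; omega

/-! ### Terms, term contexts, types and type contexts -/

/-- This separates the outermost copy of a box, whose context is the hole, from the copies reached
by recursive calls. -/
theorem AlgCtx.comp_arg_ne_hole {B : FreeAlg} (u : AlgCtx B) (c : Fin B.k)
    (ts : Fin (B.arity c) → AlgTerm B) (k : Fin (B.arity c)) : u.comp (.arg c ts k) ≠ .hole := by
  cases u <;> simp [AlgCtx.comp, AlgCtx.arg]

/-- The context forgets only the argument in the hole, so that argument has to be given in addition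
to recover the whole tuple. -/
theorem AlgCtx.arg_inj {B : FreeAlg} {c c' : Fin B.k}
    {ts : Fin (B.arity c) → AlgTerm B} {ts' : Fin (B.arity c') → AlgTerm B}
    {k : Fin (B.arity c)} {k' : Fin (B.arity c')} (h : AlgCtx.arg c ts k = .arg c' ts' k')
    (hk : ts k = ts' k') :
    (⟨c, ts, k⟩ : Σ c : Fin B.k, (Fin (B.arity c) → AlgTerm B) × Fin (B.arity c)) =
      ⟨c', ts', k'⟩ := by
  simp only [AlgCtx.arg, AlgCtx.node.injEq] at h
  obtain ⟨rfl, hk', hts, -⟩ := h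
  obtain rfl := eq_of_heq hk'
  have : ts = ts' := by
    funext l
    by_cases hl : l = k
    · rw [hl, hk]
    · exact congrFun (eq_of_heq hts) ⟨l, hl⟩
  rw [this]

/-- The last node on the path to the hole can be read off. For recursion this means that a copy of
the box other than the outermost one has a unique caller. -/
theorem AlgCtx.comp_arg_inj {B : FreeAlg} {c c' : Fin B.k}
    {ts : Fin (B.arity c) → AlgTerm B} {ts' : Fin (B.arity c') → AlgTerm B}
    {k : Fin (B.arity c)} {k' : Fin (B.arity c')} :
    ∀ {u u' : AlgCtx B}, u.comp (.arg c ts k) = u'.comp (.arg c' ts' k') →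
      u = u' ∧ AlgCtx.arg c ts k = .arg c' ts' k'
  | .hole, .hole, h => ⟨rfl, h⟩
  | .hole, .node d j ss u', h => by
    simp only [AlgCtx.comp, AlgCtx.arg, AlgCtx.node.injEq] at h
    exact absurd h.2.2.2.symm (AlgCtx.comp_arg_ne_hole _ _ _ _)
  | .node d j ss u, .hole, h => by
    simp only [AlgCtx.comp, AlgCtx.arg, AlgCtx.node.injEq] at h
    exact absurd h.2.2.2 (AlgCtx.comp_arg_ne_hole _ _ _ _)
  | .node d j ss u, .node d' j' ss' u', h => by
    simp only [AlgCtx.comp, AlgCtx.node.injEq] at h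
    obtain ⟨rfl, hj, hs, hu⟩ := h
    obtain rfl := eq_of_heq hj
    obtain rfl := eq_of_heq hs
    obtain ⟨rfl, h'⟩ := AlgCtx.comp_arg_inj hu
    exact ⟨rfl, h'⟩

theorem AlgCtx.plug_comp {B : FreeAlg} (u w : AlgCtx B) (t : AlgTerm B) :
    (u.comp w).plug t = u.plug (w.plug t) := by
  induction u with
  | hole => rfl
  | node c j ts u ih => simp only [AlgCtx.comp, AlgCtx.plug, ih]

theorem AlgCtx.plug_arg {B : FreeAlg} (c : Fin B.k) (ts : Fin (B.arity c) → AlgTerm B)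
    (k : Fin (B.arity c)) : (AlgCtx.arg c ts k).plug (ts k) = .mk c ts := by
  simp only [AlgCtx.arg, AlgCtx.plug]
  congr 1
  funext l
  split_ifs with h
  · rw [h]
  · rfl

theorem AlgCtx.size_le_plug {B : FreeAlg} (u : AlgCtx B) (t : AlgTerm B) :
    t.size ≤ (u.plug t).size := by
  induction u with
  | hole => exact le_rfl
  | node c j ts u ih =>
    rw [AlgCtx.plug, AlgTerm.size]
    refine ih.trans ((Eq.le ?_).trans ((Finset.single_le_sum (fun _ _ => Nat.zero_le _)
      (Finset.mem_univ j)).trans (Nat.le_add_left _ _)))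
    rw [dif_pos rfl]

/-- The decompositions of a term as `u[s]` are at most as many as its constructors. -/
theorem AlgTerm.exists_decompositions {B : FreeAlg} (t : AlgTerm B) :
    ∃ F : Finset (AlgCtx B × AlgTerm B), F.card ≤ t.size ∧
      ∀ u s, AlgCtx.plug u s = t → (u, s) ∈ F := by
  classical
  induction t with
  | mk c ts ih =>
    choose F hF hmem using ih
    refine ⟨insert (.hole, .mk c ts) (Finset.univ.biUnion fun j => (F j).image fun q =>
      (.node c j (fun l => ts l) q.1, q.2)), ?_, ?_⟩
    · refine (Finset.card_insert_le _ _).trans ?_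
      rw [AlgTerm.size, add_comm]
      refine Nat.add_le_add_left (Finset.card_biUnion_le.trans (Finset.sum_le_sum fun j _ => ?_)) _
      exact Finset.card_image_le.trans (hF j)
    · rintro (_ | ⟨d, j, ss, u⟩) s h
      · rw [AlgCtx.plug] at h
        rw [h]
        exact Finset.mem_insert_self _ _
      · simp only [AlgCtx.plug, AlgTerm.mk.injEq] at h
        obtain ⟨rfl, h⟩ := h
        have h := congrFun (eq_of_heq h)
        have hj := h j
        rw [dif_pos rfl] at hj
        refine Finset.mem_insert_of_mem (Finset.mem_biUnion.mpr ⟨j, Finset.mem_univ _,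
          Finset.mem_image.mpr ⟨(u, s), hmem j u s hj, ?_⟩⟩)
        have : (fun l : {l // l ≠ j} => ts l) = ss := by
          funext l
          rw [← h l, dif_neg l.2]
        rw [this]

section Types

variable {n : ℕ} {𝒜 : Fin n → FreeAlg}

theorem Ty.arrows_inj {A : Ty 𝒜} : ∀ {r : ℕ} {X Y : Ty 𝒜},
    Ty.arrows r A X = Ty.arrows r A Y ↔ X = Y
  | 0, _, _ => Iff.rfl
  | r + 1, X, Y => by simp [Ty.arrows, Ty.arrows_inj (r := r)]

theorem Ty.arrows_base_inj {a : Fin n} {i j : ℕ} : ∀ {r : ℕ},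
    Ty.arrows r (.base a i) (.base a i) = Ty.arrows (𝒜 := 𝒜) r (.base a j) (.base a j) → i = j
  | 0, h => by simpa [Ty.arrows] using h
  | r + 1, h => by
    simp only [Ty.arrows, Ty.arr.injEq, Ty.base.injEq, true_and] at h
    exact h.1

theorem Ty.arrows_split (A B : Ty 𝒜) : ∀ {r j : ℕ}, j < r →
    Ty.arrows r A B = Ty.arrows j A (.arr A (Ty.arrows (r - j - 1) A B))
  | 0, j, h => absurd h (Nat.not_lt_zero j)
  | r + 1, 0, _ => rfl
  | r + 1, j + 1, h => by
    rw [Ty.arrows, Ty.arrows, Ty.arrows_split A B (r := r) (j := j) (by omega),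
      show r + 1 - (j + 1) - 1 = r - j - 1 by omega]

theorem TyCtx.arrows_inj {A : Ty 𝒜} : ∀ {r : ℕ} {X Y : TyCtx 𝒜},
    TyCtx.arrows r A X = TyCtx.arrows r A Y ↔ X = Y
  | 0, _, _ => Iff.rfl
  | r + 1, X, Y => by simp [TyCtx.arrows, TyCtx.arrows_inj (r := r)]

/-- The number of `right`s before the first `left` is the position of the argument. -/
theorem TyCtx.arrows_left_inj {A B B' : Ty 𝒜} {X Y : TyCtx 𝒜} : ∀ {r s : ℕ},
    TyCtx.arrows r A (.left X B) = TyCtx.arrows s A (.left Y B') → r = s ∧ X = Y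
  | 0, 0, h => by
    simp only [TyCtx.arrows, TyCtx.left.injEq] at h
    exact ⟨rfl, h.1⟩
  | 0, s + 1, h => by simp [TyCtx.arrows] at h
  | r + 1, 0, h => by simp [TyCtx.arrows] at h
  | r + 1, s + 1, h => by
    simp only [TyCtx.arrows, TyCtx.right.injEq, true_and] at h
    obtain ⟨rfl, h'⟩ := TyCtx.arrows_left_inj h
    exact ⟨rfl, h'⟩

theorem TyCtx.argAt_inj {A B : Ty 𝒜} {r : ℕ} {j k : Fin r} {X Y : TyCtx 𝒜}
    (h : TyCtx.argAt A j X B = TyCtx.argAt A k Y B) : j = k ∧ X = Y := by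
  obtain ⟨h, h'⟩ := TyCtx.arrows_left_inj h
  exact ⟨Fin.ext h, h'⟩

theorem TyCtx.arrows_left_ne {A B : Ty 𝒜} {X Y : TyCtx 𝒜} : ∀ {j r : ℕ}, j < r →
    TyCtx.arrows j A (.left X B) ≠ TyCtx.arrows r A Y
  | 0, r + 1, _, h => by simp [TyCtx.arrows] at h
  | j + 1, r + 1, hj, h => by
    simp only [TyCtx.arrows, TyCtx.right.injEq, true_and] at h
    exact TyCtx.arrows_left_ne (by omega) h

theorem TyCtx.argAt_ne_arrows {A B : Ty 𝒜} {r : ℕ} {j : Fin r} {X Y : TyCtx 𝒜} :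
    TyCtx.argAt A j X B ≠ TyCtx.arrows r A Y :=
  TyCtx.arrows_left_ne j.2

theorem TyCtx.positive_arrows {A : Ty 𝒜} {L : TyCtx 𝒜} : ∀ {r : ℕ},
    (TyCtx.arrows r A L).positive = L.positive
  | 0 => rfl
  | r + 1 => by rw [TyCtx.arrows, TyCtx.positive, TyCtx.positive_arrows]

theorem TyCtx.positive_argAt {A B : Ty 𝒜} {L : TyCtx 𝒜} {r : ℕ} {j : Fin r} :
    (TyCtx.argAt A j L B).positive = !L.positive := by
  rw [TyCtx.argAt, TyCtx.positive_arrows, TyCtx.positive]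

theorem TyCtx.fill_arrows {A X : Ty 𝒜} {L : TyCtx 𝒜} : ∀ {r : ℕ},
    (TyCtx.arrows r A L).fill X = Ty.arrows r A (L.fill X)
  | 0 => rfl
  | r + 1 => by rw [TyCtx.arrows, TyCtx.fill, TyCtx.fill_arrows, Ty.arrows]

theorem TyCtx.eq_fill_argAt {A B X : Ty 𝒜} {L : TyCtx 𝒜} {r : ℕ} {j : Fin r} :
    Ty.arrows r A B = (TyCtx.argAt A j L B).fill X ↔ A = L.fill X := by
  rw [TyCtx.argAt, TyCtx.fill_arrows, TyCtx.fill, Ty.arrows_split A B j.2, Ty.arrows_inj,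
    Ty.arr.injEq, and_iff_left rfl]

/-- This turns the bound on the level of the result of a recursion into a bound on the tier of every
term that crosses its conclusion. -/
theorem TyCtx.le_level_fill {a : Fin n} {i : ℕ} : ∀ {L : TyCtx 𝒜},
    i ≤ (L.fill (.base a i)).level
  | .hole => le_rfl
  | .left _ _ => TyCtx.le_level_fill.trans (le_max_left _ _)
  | .right _ _ => TyCtx.le_level_fill.trans (le_max_right _ _)

end Types

/-! ### Derivability of labels -/

section Labels

variable {n : ℕ} {𝒜 : Fin n → FreeAlg} {Γ : Ctx 𝒜} {G : IGraph Γ}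

/-- A label without its term. -/
structure Cfg (G : IGraph Γ) where
  edge : G.Edge
  stack : List (Entry G)
  ctx : TyCtx 𝒜

def Lab.cfg (l : Lab G) : Cfg G := ⟨l.edge, l.stack, l.ctx⟩

theorem Lab.eq_of_term_of_cfg {l l' : Lab G} (ht : l.term = l'.term) (hc : l.cfg = l'.cfg) :
    l = l' := by
  cases l
  cases l'
  cases hc
  cases ht
  rfl

/-- The two ends of the moves at a vertex that leave the term unchanged and can be used in both
directions; `R` decides the side conditions. -/
inductive Wire (R : Lab G → Prop) : G.V → Port → Cfg G → Port → Cfg G → Prop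
  | lamVar {v e g h U P} (hv : G.node v = .lam e g h) :
      Wire R v .lamVar ⟨e, U, P⟩ .lamOut ⟨h, U, .left P (G.edgeTy g)⟩
  | lamBody {v e g h U P} (hv : G.node v = .lam e g h) :
      Wire R v .lamBody ⟨g, U, P⟩ .lamOut ⟨h, U, .right (G.edgeTy e) P⟩
  | appArg {v e g h U P} (hv : G.node v = .app e g h) :
      Wire R v .appArg ⟨g, U, P⟩ .appFun ⟨e, U, .left P (G.edgeTy h)⟩
  | appOut {v e g h U P} (hv : G.node v = .app e g h) :
      Wire R v .appOut ⟨h, U, P⟩ .appFun ⟨e, U, .right (G.edgeTy g) P⟩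
  | cond {v a e₀ es g U P} {c : Fin (𝒜 a).k} {ts} (hv : G.node v = .cond a e₀ es g)
      (hR : R ⟨⟨a, .mk c ts⟩, e₀, U, .hole⟩) :
      Wire R v .condOut ⟨g, U, P⟩ (.condBr c)
        ⟨es c, U, TyCtx.arrows ((𝒜 a).arity c) (G.edgeTy e₀) P⟩
  | recOut {v a e₀ es g U P} {c : Fin (𝒜 a).k} {ts} (hv : G.node v = .recur a e₀ es g)
      (hR : R ⟨⟨a, .mk c ts⟩, e₀, U, .hole⟩) :
      Wire R v .recOut ⟨g, U, P⟩ (.recBr c)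
        ⟨es c, ⟨a, .hole, .mk c ts, v⟩ :: U, TyCtx.arrows ((𝒜 a).arity c) (G.edgeTy e₀)
          (TyCtx.arrows ((𝒜 a).arity c) (G.edgeTy g) P)⟩
  | recCall {v a e₀ es g U P} {c d : Fin (𝒜 a).k} {ts ss} {k : Fin ((𝒜 a).arity c)}
      {u : AlgCtx (𝒜 a)} (hv : G.node v = .recur a e₀ es g)
      (hR : R ⟨⟨a, u.plug (.mk c ts)⟩, e₀, U, .hole⟩) (hk : ts k = .mk d ss) :
      Wire R v (.recBr c)
        ⟨es c, ⟨a, u, .mk c ts, v⟩ :: U, TyCtx.arrows ((𝒜 a).arity c) (G.edgeTy e₀)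
          (TyCtx.argAt (G.edgeTy g) k P (G.edgeTy g))⟩ (.recBr d)
        ⟨es d, ⟨a, u.comp (AlgCtx.arg c ts k), ts k, v⟩ :: U,
          TyCtx.arrows ((𝒜 a).arity d) (G.edgeTy e₀)
            (TyCtx.arrows ((𝒜 a).arity d) (G.edgeTy g) P)⟩

/-- `R` contains at most one label for each configuration. -/
def Functional (R : Lab G → Prop) : Prop :=
  ∀ l l', R l → R l' → l.cfg = l'.cfg → l = l'

theorem Functional.term_eq {R : Lab G → Prop} (hR : Functional R) {a : Fin n}
    {t t' : AlgTerm (𝒜 a)} {e : G.Edge} {U : List (Entry G)} {L : TyCtx 𝒜}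
    (h : R ⟨⟨a, t⟩, e, U, L⟩) (h' : R ⟨⟨a, t'⟩, e, U, L⟩) : t = t' := by
  have := congrArg Lab.term (hR _ _ h h' rfl)
  exact eq_of_heq (Sigma.mk.inj this).2

/-- The left end at the conclusion of a `C^N` or `C^R` does not say which branch is chosen; the term
at `e₀` does, and `Functional` makes it unique. At a recursive call the stack entry and the argument
position in the type context determine the callee. -/
theorem Wire.right_eq {R : Lab G → Prop} (hR : Functional R) {v v' : G.V} {p p' q q' : Port}
    {x x' y y' : Cfg G} (h : Wire R v p x q y) (h' : Wire R v' p' x' q' y') (hv : v = v')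
    (hp : p = p') (hx : x = x') : q = q' ∧ y = y' := by
  rcases h with ⟨hn⟩ | ⟨hn⟩ | ⟨hn⟩ | ⟨hn⟩ | ⟨hn, hT⟩ | ⟨hn, hT⟩ | ⟨hn, hT, hk⟩ <;>
    rcases h' with ⟨hn'⟩ | ⟨hn'⟩ | ⟨hn'⟩ | ⟨hn'⟩ | ⟨hn', hT'⟩ | ⟨hn', hT'⟩ | ⟨hn', hT', hk'⟩ <;>
    simp only [reduceCtorEq, Port.recBr.injEq] at hp <;> subst hv <;> cases hn.symm.trans hn'
  · cases hx
    exact ⟨rfl, rfl⟩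
  · cases hx
    exact ⟨rfl, rfl⟩
  · cases hx
    exact ⟨rfl, rfl⟩
  · cases hx
    exact ⟨rfl, rfl⟩
  · cases hx
    cases hR.term_eq hT hT'
    exact ⟨rfl, rfl⟩
  · cases hx
    cases hR.term_eq hT hT'
    exact ⟨rfl, rfl⟩
  · obtain rfl := Fin.ext hp
    simp only [Cfg.mk.injEq, true_and, List.cons.injEq, Entry.mk.injEq, heq_eq_eq, and_true,
      AlgTerm.mk.injEq, TyCtx.arrows_inj] at hx
    obtain ⟨⟨⟨rfl, rfl⟩, rfl⟩, hx⟩ := hx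
    obtain ⟨rfl, rfl⟩ := TyCtx.argAt_inj hx
    cases hk.symm.trans hk'
    exact ⟨rfl, rfl⟩

/-- Here determinism of `R` is not needed: the branch is given by the port, and at a `C^R` the stack
entry names the copy of the box. A hole in the entry means leaving the box, and otherwise
`AlgCtx.comp_arg_inj` finds the calling copy. -/
theorem Wire.left_eq {R : Lab G → Prop} {v v' : G.V} {p p' q q' : Port}
    {x x' y y' : Cfg G} (h : Wire R v p x q y) (h' : Wire R v' p' x' q' y') (hv : v = v')
    (hq : q = q') (hy : y = y') : p = p' ∧ x = x' := by
  rcases h with ⟨hn⟩ | ⟨hn⟩ | ⟨hn⟩ | ⟨hn⟩ | ⟨hn, hT⟩ | ⟨hn, hT⟩ | ⟨hn, hT, hk⟩ <;>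
    rcases h' with ⟨hn'⟩ | ⟨hn'⟩ | ⟨hn'⟩ | ⟨hn'⟩ | ⟨hn', hT'⟩ | ⟨hn', hT'⟩ | ⟨hn', hT', hk'⟩ <;>
    simp only [reduceCtorEq, Port.recBr.injEq, Port.condBr.injEq] at hq <;> subst hv <;>
    cases hn.symm.trans hn'
  · simp only [Cfg.mk.injEq, TyCtx.left.injEq] at hy
    obtain ⟨-, rfl, rfl, -⟩ := hy
    exact ⟨rfl, rfl⟩
  · simp only [Cfg.mk.injEq, reduceCtorEq, and_false] at hy
  · simp only [Cfg.mk.injEq, reduceCtorEq, and_false] at hy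
  · simp only [Cfg.mk.injEq, TyCtx.right.injEq] at hy
    obtain ⟨-, rfl, -, rfl⟩ := hy
    exact ⟨rfl, rfl⟩
  · simp only [Cfg.mk.injEq, TyCtx.left.injEq] at hy
    obtain ⟨-, rfl, rfl, -⟩ := hy
    exact ⟨rfl, rfl⟩
  · simp only [Cfg.mk.injEq, reduceCtorEq, and_false] at hy
  · simp only [Cfg.mk.injEq, reduceCtorEq, and_false] at hy
  · simp only [Cfg.mk.injEq, TyCtx.right.injEq] at hy
    obtain ⟨-, rfl, -, rfl⟩ := hy
    exact ⟨rfl, rfl⟩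
  · obtain rfl := Fin.ext hq
    simp only [Cfg.mk.injEq, true_and, TyCtx.arrows_inj] at hy
    obtain ⟨rfl, rfl⟩ := hy
    exact ⟨rfl, rfl⟩
  · obtain rfl := Fin.ext hq
    simp only [Cfg.mk.injEq, true_and, TyCtx.arrows_inj, List.cons.injEq] at hy
    obtain ⟨⟨-, rfl⟩, rfl⟩ := hy
    exact ⟨rfl, rfl⟩
  · obtain rfl := Fin.ext hq
    simp only [Cfg.mk.injEq, List.cons.injEq, Entry.mk.injEq, heq_eq_eq, true_and] at hy
    exact absurd hy.1.1.1.symm (AlgCtx.comp_arg_ne_hole _ _ _ _)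
  · obtain rfl := Fin.ext hq
    simp only [Cfg.mk.injEq, List.cons.injEq, Entry.mk.injEq, heq_eq_eq, true_and] at hy
    exact absurd hy.1.1.1 (AlgCtx.comp_arg_ne_hole _ _ _ _)
  · obtain rfl := Fin.ext hq
    simp only [Cfg.mk.injEq, true_and, List.cons.injEq, Entry.mk.injEq, heq_eq_eq, and_true,
      TyCtx.arrows_inj] at hy
    obtain ⟨⟨⟨hu, ht⟩, rfl⟩, rfl⟩ := hy
    obtain ⟨rfl, hu'⟩ := AlgCtx.comp_arg_inj hu
    cases AlgCtx.arg_inj hu' ht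
    exact ⟨rfl, rfl⟩

/-- Only the branch ports of a recursion occur on both sides. There the type contexts differ: on the
left the focus is in an argument of the step function, on the right it is in the result. -/
theorem Wire.right_ne_left {R : Lab G → Prop} {v v' : G.V} {p p' q q' : Port}
    {x x' y y' : Cfg G} (h : Wire R v p x q y) (h' : Wire R v' p' x' q' y') (hv : v = v')
    (hp : q = p') (hx : y = x') : False := by
  rcases h with ⟨hn⟩ | ⟨hn⟩ | ⟨hn⟩ | ⟨hn⟩ | ⟨hn, hT⟩ | ⟨hn, hT⟩ | ⟨hn, hT, hk⟩ <;>
    rcases h' with ⟨hn'⟩ | ⟨hn'⟩ | ⟨hn'⟩ | ⟨hn'⟩ | ⟨hn', hT'⟩ | ⟨hn', hT'⟩ | ⟨hn', hT', hk'⟩ <;>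
    simp only [reduceCtorEq, Port.recBr.injEq] at hp <;> subst hv <;> cases hn.symm.trans hn'
  all_goals
    obtain rfl := Fin.ext hp
    simp only [Cfg.mk.injEq, true_and, TyCtx.arrows_inj] at hx
    exact TyCtx.argAt_ne_arrows hx.2.symm

/-- `Wire` in both directions. -/
def Link (R : Lab G → Prop) (v : G.V) (p : Port) (x : Cfg G) (q : Port) (y : Cfg G) : Prop :=
  Wire R v p x q y ∨ Wire R v q y p x

theorem Link.symm {R : Lab G → Prop} {v : G.V} {p q : Port} {x y : Cfg G}
    (h : Link R v p x q y) : Link R v q y p x :=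
  Or.symm h

theorem Link.unique {R : Lab G → Prop} (hR : Functional R) {v : G.V} {p q q' : Port}
    {x y y' : Cfg G} (h : Link R v p x q y) (h' : Link R v p x q' y') : q = q' ∧ y = y' := by
  rcases h with h | h <;> rcases h' with h' | h'
  · exact h.right_eq hR h' rfl rfl rfl
  · exact (h'.right_ne_left h rfl rfl rfl).elim
  · exact (h.right_ne_left h' rfl rfl rfl).elim
  · exact h.left_eq h' rfl rfl rfl

theorem Wire.mono {R R' : Lab G → Prop} (hR : ∀ l, R l → R' l) {v : G.V} {p q : Port}
    {x y : Cfg G} (h : Wire R v p x q y) : Wire R' v p x q y := by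
  rcases h with ⟨hn⟩ | ⟨hn⟩ | ⟨hn⟩ | ⟨hn⟩ | ⟨hn, hT⟩ | ⟨hn, hT⟩ | ⟨hn, hT, hk⟩
  · exact .lamVar hn
  · exact .lamBody hn
  · exact .appArg hn
  · exact .appOut hn
  · exact .cond hn (hR _ hT)
  · exact .recOut hn (hR _ hT)
  · exact .recCall hn (hR _ hT) hk

theorem Link.mono {R R' : Lab G → Prop} (hR : ∀ l, R l → R' l) {v : G.V} {p q : Port}
    {x y : Cfg G} (h : Link R v p x q y) : Link R' v p x q y :=
  h.imp (Wire.mono hR) (Wire.mono hR)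

theorem Wire.at_left {R : Lab G → Prop} {v : G.V} {p q : Port} {x y : Cfg G}
    (h : Wire R v p x q y) : (G.node v).At p x.edge := by
  rcases h with ⟨hn⟩ | ⟨hn⟩ | ⟨hn⟩ | ⟨hn⟩ | ⟨hn, hT⟩ | ⟨hn, hT⟩ | ⟨hn, hT, hk⟩ <;>
    simp [hn, Node.At]
  exact ⟨_, rfl, rfl⟩

theorem Wire.at_right {R : Lab G → Prop} {v : G.V} {p q : Port} {x y : Cfg G}
    (h : Wire R v p x q y) : (G.node v).At q y.edge := by
  rcases h with ⟨hn⟩ | ⟨hn⟩ | ⟨hn⟩ | ⟨hn⟩ | ⟨hn, hT⟩ | ⟨hn, hT⟩ | ⟨hn, hT, hk⟩ <;>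
    simp [hn, Node.At]
  all_goals exact ⟨_, rfl, rfl⟩

theorem Link.at_left {R : Lab G → Prop} {v : G.V} {p q : Port} {x y : Cfg G}
    (h : Link R v p x q y) : (G.node v).At p x.edge :=
  h.elim Wire.at_left Wire.at_right

theorem Link.at_right {R : Lab G → Prop} {v : G.V} {p q : Port} {x y : Cfg G}
    (h : Link R v p x q y) : (G.node v).At q y.edge :=
  h.symm.at_left

theorem Wire.parity {R : Lab G → Prop} {v : G.V} {p q : Port} {x y : Cfg G}
    (h : Wire R v p x q y) :
    (x.ctx.positive = p.isOut ↔ y.ctx.positive = !q.isOut) := by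
  rcases h with ⟨hn⟩ | ⟨hn⟩ | ⟨hn⟩ | ⟨hn⟩ | ⟨hn, hT⟩ | ⟨hn, hT⟩ | ⟨hn, hT, hk⟩ <;>
    simp [TyCtx.positive, TyCtx.positive_arrows, TyCtx.positive_argAt, Port.isOut]

/-- A term that leaves a vertex through the port `p` has entered it through `q`. -/
theorem Link.parity {R : Lab G → Prop} {v : G.V} {p q : Port} {x y : Cfg G}
    (h : Link R v p x q y) (hp : x.ctx.positive = p.isOut) : y.ctx.positive = !q.isOut := by
  rcases h with h | h
  · exact h.parity.mp hp
  · have := h.parity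
    revert hp this
    cases x.ctx.positive <;> cases y.ctx.positive <;> cases p.isOut <;> cases q.isOut <;> decide

/-- The top of the stack `U` is an entry for the box of the vertex `o`, with the rest of the stack
that of the recursive premise. -/
def StackOK (R : Lab G → Prop) (o : Option G.V) (U : List (Entry G)) : Prop :=
  (o = none ∧ U = []) ∨ ∃ v e₀ b u t U', o = some v ∧ G.RecPremise v e₀ ∧
    R ⟨⟨b, AlgCtx.plug u t⟩, e₀, U', .hole⟩ ∧ U = ⟨b, u, t, v⟩ :: U'

/-- `Rule R v p ps l`: the label `l` is derived from the labels in `ps` at the port `p` of the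
vertex `v`; `R` decides the other side conditions. -/
inductive Rule (R : Lab G → Prop) : G.V → Port → Set (Lab G) → Lab G → Prop
  | link {v p q l l'} (h : Link R v p l.cfg q l'.cfg) (hp : l.ctx.positive = p.isOut)
      (ht : l.term = l'.term) : Rule R v p {l'} l
  | dupL {v e g h t U} (hv : G.node v = .dup e g h) :
      Rule R v .dupL {⟨t, h, U, .hole⟩} ⟨t, e, U, .hole⟩
  | dupR {v e g h t U} (hv : G.node v = .dup e g h) :
      Rule R v .dupR {⟨t, h, U, .hole⟩} ⟨t, g, U, .hole⟩
  | box {w v a b e g e₀ u s U t} (hw : G.node w = .boxPrem a e g)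
      (hbox : G.boxPremise g = some v) (hv : G.RecPremise v e₀)
      (hR : R ⟨⟨b, AlgCtx.plug u s⟩, e₀, U, .hole⟩) :
      Rule R w .boxOut {⟨t, e, U, .hole⟩} ⟨t, g, ⟨b, u, s, v⟩ :: U, .hole⟩
  | con {w a c e i U ts} (hw : G.node w = .con a c e)
      (he : G.edgeTy e = Ty.arrows ((𝒜 a).arity c) (.base a i) (.base a i))
      (hU : (𝒜 a).arity c = 0 → StackOK R (G.boxPremise e) U) :
      Rule R w .con
        (Set.range fun j => ⟨⟨a, ts j⟩, e, U, TyCtx.argAt (.base a i) j .hole (.base a i)⟩)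
        ⟨⟨a, .mk c ts⟩, e, U, TyCtx.arrows ((𝒜 a).arity c) (.base a i) .hole⟩
  | condArg {v a e₀ es g} {c : Fin (𝒜 a).k} {ts U} {j : Fin ((𝒜 a).arity c)}
      (hv : G.node v = .cond a e₀ es g) :
      Rule R v (.condBr c) {⟨⟨a, .mk c ts⟩, e₀, U, .hole⟩}
        ⟨⟨a, ts j⟩, es c, U, TyCtx.argAt (G.edgeTy e₀) j .hole (G.edgeTy g)⟩
  | recArg {v a e₀ es g} {c : Fin (𝒜 a).k} {ts U} {u : AlgCtx (𝒜 a)}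
      {j : Fin ((𝒜 a).arity c)} (hv : G.node v = .recur a e₀ es g) :
      Rule R v (.recBr c) {⟨⟨a, u.plug (.mk c ts)⟩, e₀, U, .hole⟩}
        ⟨⟨a, ts j⟩, es c, ⟨a, u, .mk c ts, v⟩ :: U, TyCtx.argAt (G.edgeTy e₀) j .hole
          (Ty.arrows ((𝒜 a).arity c) (G.edgeTy g) (G.edgeTy g))⟩

theorem StackOK.mono {R R' : Lab G → Prop} (hR : ∀ l, R l → R' l) {o : Option G.V}
    {U : List (Entry G)} (h : StackOK R o U) : StackOK R' o U := by
  rcases h with h | ⟨v, e₀, b, u, t, U', h1, h2, h3, h4⟩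
  · exact Or.inl h
  · exact Or.inr ⟨v, e₀, b, u, t, U', h1, h2, hR _ h3, h4⟩

theorem Rule.mono {R R' : Lab G → Prop} (hR : ∀ l, R l → R' l) {v : G.V} {p : Port}
    {ps : Set (Lab G)} {l : Lab G} (h : Rule R v p ps l) : Rule R' v p ps l := by
  cases h with
  | link h hp ht => exact .link (h.mono hR) hp ht
  | dupL hv => exact .dupL hv
  | dupR hv => exact .dupR hv
  | box hw hbox hv h => exact .box hw hbox hv (hR _ h)
  | con hw he hU => exact .con hw he fun h => (hU h).mono hR
  | condArg hv => exact .condArg hv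
  | recArg hv => exact .recArg hv

theorem Rule.at {R : Lab G → Prop} {v : G.V} {p : Port} {ps : Set (Lab G)} {l : Lab G}
    (h : Rule R v p ps l) : (G.node v).At p l.edge := by
  cases h with
  | link h hp ht => exact h.at_left
  | condArg hv => exact hv ▸ Or.inr (Or.inr ⟨_, rfl, rfl⟩)
  | recArg hv => exact hv ▸ Or.inr (Or.inr ⟨_, rfl, rfl⟩)
  | dupL hv => simp [hv, Node.At]
  | dupR hv => simp [hv, Node.At]
  | box hw hbox hv h => simp [hw, Node.At]
  | con hw he hU => simp [hw, Node.At]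

theorem Rule.positive {R : Lab G → Prop} {v : G.V} {p : Port} {ps : Set (Lab G)} {l : Lab G}
    (h : Rule R v p ps l) : l.ctx.positive = p.isOut := by
  cases h with
  | link h hp ht => exact hp
  | con hw he hU => simp [TyCtx.positive_arrows, TyCtx.positive, Port.isOut]
  | _ => simp [TyCtx.positive_argAt, TyCtx.positive, Port.isOut]

theorem Link.port_ne {R : Lab G → Prop} {v : G.V} {p q : Port} {x y : Cfg G}
    (h : Link R v p x q y) : p ≠ .dupL ∧ p ≠ .dupR ∧ p ≠ .boxOut ∧ p ≠ .con ∧ p ≠ .condArg ∧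
      p ≠ .recArg ∧ p ≠ .dupIn ∧ p ≠ .boxIn := by
  rcases h with h | h <;> cases h <;> simp

/-- A branch port is used both by links and by the rule that passes subterms of the argument. The
focus of a link lies behind all the arguments, which tells the two apart by `TyCtx.argAt_ne_arrows`.
-/
theorem Link.ctx_condBr {R : Lab G → Prop} {v : G.V} {p q : Port} {x y : Cfg G}
    (h : Link R v p x q y) {a : Fin n} {e₀ : G.Edge} {es : Fin (𝒜 a).k → G.Edge} {g : G.Edge}
    (hv : G.node v = .cond a e₀ es g) {c : Fin (𝒜 a).k} (hp : p = .condBr c) :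
    ∃ P, x.ctx = TyCtx.arrows ((𝒜 a).arity c) (G.edgeTy e₀) P := by
  rcases h with h | h <;>
    rcases h with ⟨hn⟩ | ⟨hn⟩ | ⟨hn⟩ | ⟨hn⟩ | ⟨hn, hT⟩ | ⟨hn, hT⟩ | ⟨hn, hT, hk⟩ <;>
    simp only [reduceCtorEq, Port.condBr.injEq] at hp
  cases hn.symm.trans hv
  obtain rfl := Fin.ext hp
  exact ⟨_, rfl⟩

theorem Link.ctx_recBr {R : Lab G → Prop} {v : G.V} {p q : Port} {x y : Cfg G}
    (h : Link R v p x q y) {a : Fin n} {e₀ : G.Edge} {es : Fin (𝒜 a).k → G.Edge} {g : G.Edge}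
    (hv : G.node v = .recur a e₀ es g) {c : Fin (𝒜 a).k} (hp : p = .recBr c) :
    ∃ P, x.ctx = TyCtx.arrows ((𝒜 a).arity c) (G.edgeTy e₀) P := by
  rcases h with h | h <;>
    rcases h with ⟨hn⟩ | ⟨hn⟩ | ⟨hn⟩ | ⟨hn⟩ | ⟨hn, hT⟩ | ⟨hn, hT⟩ | ⟨hn, hT, hk⟩ <;>
    simp only [reduceCtorEq, Port.recBr.injEq] at hp <;>
    cases hn.symm.trans hv <;> obtain rfl := Fin.ext hp <;> exact ⟨_, rfl⟩

/-- At a given port, the configuration of a label determines its term and its predecessors. -/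
theorem Rule.unique {R : Lab G → Prop} (hR : Functional R) {v v' : G.V} {p p' : Port}
    {ps ps' : Set (Lab G)} {l l' : Lab G} (h : Rule R v p ps l) (hps : ∀ x ∈ ps, R x)
    (h' : Rule R v' p' ps' l') (hps' : ∀ x ∈ ps', R x) (hv : v = v') (hp : p = p')
    (hl : l.cfg = l'.cfg) : l = l' ∧ ps = ps' := by
  suffices key : l.term = l'.term ∧ ps = ps' from ⟨Lab.eq_of_term_of_cfg key.1 hl, key.2⟩
  subst hv
  rcases h with ⟨hk, hpos, ht⟩ | ⟨hn⟩ | ⟨hn⟩ | ⟨hn, hbox, hpr, hT⟩ | ⟨hn, he, hU⟩ | ⟨hn⟩ | ⟨hn⟩ <;>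
    rcases h' with
      ⟨hk', hpos', ht'⟩ | ⟨hn'⟩ | ⟨hn'⟩ | ⟨hn', hbox', hpr', hT'⟩ | ⟨hn', he', hU'⟩ | ⟨hn'⟩ | ⟨hn'⟩ <;>
    try simp only [reduceCtorEq, Port.recBr.injEq, Port.condBr.injEq] at hp
  · subst hp
    rw [hl] at hk
    obtain ⟨-, he⟩ := hk.unique hR hk'
    have := hR _ _ (hps _ rfl) (hps' _ rfl) he
    subst this
    exact ⟨ht.trans ht'.symm, rfl⟩
  · exact absurd hp hk.port_ne.1
  · exact absurd hp hk.port_ne.2.1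
  · exact absurd hp hk.port_ne.2.2.1
  · exact absurd hp hk.port_ne.2.2.2.1
  · obtain ⟨P, hP⟩ := hk.ctx_condBr hn' hp
    exact absurd ((congrArg Cfg.ctx hl).symm.trans hP) TyCtx.argAt_ne_arrows
  · obtain ⟨P, hP⟩ := hk.ctx_recBr hn' hp
    exact absurd ((congrArg Cfg.ctx hl).symm.trans hP) TyCtx.argAt_ne_arrows
  · exact absurd hp.symm hk'.port_ne.1
  · cases hn.symm.trans hn'
    simp only [Lab.cfg, Cfg.mk.injEq, true_and, and_true] at hl
    subst hl
    have := hR _ _ (hps _ rfl) (hps' _ rfl) rfl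
    have ht := congrArg Lab.term this
    rw [this]
    exact ⟨ht, rfl⟩
  · exact absurd hp.symm hk'.port_ne.2.1
  · cases hn.symm.trans hn'
    simp only [Lab.cfg, Cfg.mk.injEq, true_and, and_true] at hl
    subst hl
    have := hR _ _ (hps _ rfl) (hps' _ rfl) rfl
    have ht := congrArg Lab.term this
    rw [this]
    exact ⟨ht, rfl⟩
  · exact absurd hp.symm hk'.port_ne.2.2.1
  · cases hn.symm.trans hn'
    simp only [Lab.cfg, Cfg.mk.injEq, List.cons.injEq, true_and, and_true] at hl
    obtain ⟨-, rfl⟩ := hl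
    have := hR _ _ (hps _ rfl) (hps' _ rfl) rfl
    have ht := congrArg Lab.term this
    rw [this]
    exact ⟨ht, rfl⟩
  · exact absurd hp.symm hk'.port_ne.2.2.2.1
  · cases hn.symm.trans hn'
    obtain rfl := Ty.arrows_base_inj (he.symm.trans he')
    simp only [Lab.cfg, Cfg.mk.injEq, true_and, and_true] at hl
    subst hl
    obtain rfl := funext fun j => hR.term_eq (hps _ ⟨j, rfl⟩) (hps' _ ⟨j, rfl⟩)
    exact ⟨rfl, rfl⟩
  · obtain ⟨P, hP⟩ := hk'.ctx_condBr hn hp.symm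
    exact absurd ((congrArg Cfg.ctx hl).trans hP) TyCtx.argAt_ne_arrows
  · cases hn.symm.trans hn'
    obtain rfl := Fin.ext hp
    simp only [Lab.cfg, Cfg.mk.injEq, true_and] at hl
    obtain ⟨rfl, hj⟩ := hl
    obtain ⟨rfl, -⟩ := TyCtx.argAt_inj hj
    cases hR.term_eq (hps _ rfl) (hps' _ rfl)
    exact ⟨rfl, rfl⟩
  · obtain ⟨P, hP⟩ := hk'.ctx_recBr hn hp.symm
    exact absurd ((congrArg Cfg.ctx hl).trans hP) TyCtx.argAt_ne_arrows
  · cases hn.symm.trans hn'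
    obtain rfl := Fin.ext hp
    simp only [Lab.cfg, Cfg.mk.injEq, List.cons.injEq, Entry.mk.injEq, heq_eq_eq, true_and,
      and_true, AlgTerm.mk.injEq] at hl
    obtain ⟨⟨⟨rfl, rfl⟩, rfl⟩, hj⟩ := hl
    obtain ⟨rfl, -⟩ := TyCtx.argAt_inj hj
    exact ⟨rfl, rfl⟩

/-! ### Uniqueness of derivations -/

/-- The labels derivable in at most `k` rounds. -/
def Derivable (G : IGraph Γ) : ℕ → Lab G → Prop
  | 0, _ => False
  | k + 1, l => ∃ v p ps, Rule (Derivable G k) v p ps l ∧ ∀ x ∈ ps, Derivable G k x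

/-- The derivable labels. -/
def Reach (G : IGraph Γ) (l : Lab G) : Prop :=
  ∃ k, Derivable G k l

theorem Derivable.succ {k : ℕ} : ∀ {l : Lab G}, Derivable G k l → Derivable G (k + 1) l := by
  induction k with
  | zero => exact fun h => h.elim
  | succ k ih =>
    rintro l ⟨v, p, ps, h, hps⟩
    exact ⟨v, p, ps, h.mono fun _ => ih, fun x hx => ih (hps x hx)⟩

theorem Derivable.mono {k m : ℕ} (hkm : k ≤ m) {l : Lab G} (h : Derivable G k l) :
    Derivable G m l := by
  induction hkm with
  | refl => exact h
  | step _ ih => exact ih.succ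

theorem Derivable.reach {k : ℕ} {l : Lab G} (h : Derivable G k l) : Reach G l :=
  ⟨k, h⟩

variable {A : Ty 𝒜} {D : Set (Ty 𝒜)} {B I : ℕ}

/-- The polarity of the focus says at which end of its edge a label was derived, so the
configuration fixes vertex and port. Premises and side conditions belong to earlier rounds, where
the induction hypothesis makes them unique; hence `Rule.unique` applies. -/
theorem IGraph.WF.functional_derivable (hG : G.WF A D B I) (k : ℕ) :
    Functional (Derivable G k) := by
  induction k with
  | zero => exact fun _ _ h => h.elim
  | succ k ih =>
    rintro l l' ⟨v, p, ps, h, hps⟩ ⟨v', p', ps', h', hps'⟩ hl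
    have hpos : p.isOut = p'.isOut := by
      rw [← h.positive, ← h'.positive]
      exact congrArg (fun c => c.ctx.positive) hl
    have hat := h'.at
    rw [← show l.edge = l'.edge from congrArg Cfg.edge hl] at hat
    obtain ⟨rfl, rfl⟩ := hG.uniq h.at hat hpos
    exact (h.unique ih hps h' hps' rfl rfl hl).1

theorem IGraph.WF.functional (hG : G.WF A D B I) : Functional (Reach G) := by
  rintro l l' ⟨k, h⟩ ⟨k', h'⟩
  exact hG.functional_derivable (max k k') _ _ (h.mono (le_max_left _ _))
    (h'.mono (le_max_right _ _))

/-- `p` is a predecessor of `l`. -/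
def Pred (G : IGraph Γ) (x l : Lab G) : Prop :=
  ∃ v p ps, Rule (Reach G) v p ps l ∧ (∀ y ∈ ps, Reach G y) ∧ x ∈ ps

/-- The least number of rounds in which a label is derivable. -/
noncomputable def rank (l : Lab G) : ℕ := sInf {k | Derivable G k l}

theorem Reach.derivable_rank {l : Lab G} (h : Reach G l) : Derivable G (rank l) l :=
  Nat.sInf_mem h

theorem Reach.exists_rule {l : Lab G} (h : Reach G l) :
    ∃ v p ps, Rule (Reach G) v p ps l ∧ ∀ x ∈ ps, Reach G x ∧ rank x < rank l := by
  have := h.derivable_rank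
  cases hr : rank l with
  | zero =>
    rw [hr] at this
    exact this.elim
  | succ k =>
    rw [hr] at this
    obtain ⟨v, p, ps, h', hps⟩ := this
    exact ⟨v, p, ps, h'.mono fun _ => Derivable.reach, fun x hx =>
      ⟨(hps x hx).reach, Nat.lt_succ_of_le (Nat.sInf_le (hps x hx))⟩⟩

theorem IGraph.WF.rule_unique (hG : G.WF A D B I) {v v' : G.V} {p p' : Port}
    {ps ps' : Set (Lab G)} {l : Lab G} (h : Rule (Reach G) v p ps l) (hps : ∀ x ∈ ps, Reach G x)
    (h' : Rule (Reach G) v' p' ps' l) (hps' : ∀ x ∈ ps', Reach G x) :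
    v = v' ∧ p = p' ∧ ps = ps' := by
  obtain ⟨rfl, rfl⟩ := hG.uniq h.at h'.at (h.positive.symm.trans h'.positive)
  exact ⟨rfl, rfl, (h.unique hG.functional hps h' hps' rfl rfl rfl).2⟩

/-- `rank` decreases by construction along one derivation of `l`, and by uniqueness every
predecessor of `l` belongs to that derivation. In particular `Pred` has no cycles among derivable
labels. -/
theorem IGraph.WF.rank_lt (hG : G.WF A D B I) {x l : Lab G} (hl : Reach G l) (h : Pred G x l) :
    rank x < rank l := by
  obtain ⟨v, p, ps, hr, hps, hx⟩ := h
  obtain ⟨v', p', ps', hr', hps'⟩ := hl.exists_rule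
  obtain ⟨-, -, rfl⟩ := hG.rule_unique hr hps hr' fun x hx => (hps' x hx).1
  exact (hps' x hx).2

theorem Pred.reach {x l : Lab G} (h : Pred G x l) : Reach G x := by
  obtain ⟨v, p, ps, hr, hps, hx⟩ := h
  exact hps x hx

/-! ### The labels of the trees in `T(G)` are derivable -/

theorem Wire.exists_derivable {v : G.V} {p q : Port} {x y : Cfg G}
    (h : Wire (Reach G) v p x q y) : ∃ k, Wire (Derivable G k) v p x q y := by
  rcases h with ⟨hn⟩ | ⟨hn⟩ | ⟨hn⟩ | ⟨hn⟩ | ⟨hn, k, hT⟩ | ⟨hn, k, hT⟩ | ⟨hn, ⟨k, hT⟩, hk⟩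
  · exact ⟨0, .lamVar hn⟩
  · exact ⟨0, .lamBody hn⟩
  · exact ⟨0, .appArg hn⟩
  · exact ⟨0, .appOut hn⟩
  · exact ⟨k, .cond hn hT⟩
  · exact ⟨k, .recOut hn hT⟩
  · exact ⟨k, .recCall hn hT hk⟩

theorem Rule.exists_derivable {v : G.V} {p : Port} {ps : Set (Lab G)} {l : Lab G}
    (h : Rule (Reach G) v p ps l) : ∃ k, Rule (Derivable G k) v p ps l := by
  cases h with
  | link h hp ht =>
    rcases h with h | h
    · obtain ⟨k, h⟩ := h.exists_derivable
      exact ⟨k, .link (Or.inl h) hp ht⟩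
    · obtain ⟨k, h⟩ := h.exists_derivable
      exact ⟨k, .link (Or.inr h) hp ht⟩
  | dupL hv => exact ⟨0, .dupL hv⟩
  | dupR hv => exact ⟨0, .dupR hv⟩
  | box hw hbox hv h =>
    obtain ⟨k, h⟩ := h
    exact ⟨k, .box hw hbox hv h⟩
  | @con a c e _ U _ hw he hU =>
    by_cases hc : (𝒜 a).arity c = 0
    · rcases hU hc with h | ⟨v, e₀, b, u, t, U', h1, h2, ⟨k, h3⟩, h4⟩
      · exact ⟨0, .con hw he fun _ => Or.inl h⟩
      · exact ⟨k, .con hw he fun _ => Or.inr ⟨v, e₀, b, u, t, U', h1, h2, h3, h4⟩⟩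
    · exact ⟨0, .con hw he fun h => absurd h hc⟩
  | condArg hv => exact ⟨0, .condArg hv⟩
  | recArg hv => exact ⟨0, .recArg hv⟩

theorem Rule.finite {R : Lab G → Prop} {v : G.V} {p : Port} {ps : Set (Lab G)} {l : Lab G}
    (h : Rule R v p ps l) : ps.Finite := by
  cases h with
  | con hw he hU => exact Set.finite_range _
  | _ => exact Set.finite_singleton _

/-- A rule has finitely many premises and at most one side condition, so a common number of rounds
serves all of them. -/
theorem Rule.reach {v : G.V} {p : Port} {ps : Set (Lab G)} {l : Lab G}
    (h : Rule (Reach G) v p ps l) (hps : ∀ x ∈ ps, Reach G x) : Reach G l := by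
  obtain ⟨k, hk⟩ := h.exists_derivable
  obtain ⟨m, hm⟩ := (h.finite.image rank).bddAbove
  refine ⟨max k m + 1, v, p, ps, hk.mono fun _ h => h.mono (le_max_left _ _), fun x hx => ?_⟩
  exact (hps x hx).derivable_rank.mono
    ((hm (Set.mem_image_of_mem _ hx)).trans (le_max_right _ _))

theorem Rule.reach_of_singleton {v : G.V} {p : Port} {x l : Lab G}
    (h : Rule (Reach G) v p {x} l) (hx : Reach G x) : Reach G l :=
  h.reach fun _ hy => hy ▸ hx

theorem Wire.reach_left {v : G.V} {p q : Port} {x y : Cfg G} {t : Σ a, AlgTerm (𝒜 a)}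
    (h : Wire (Reach G) v p x q y) (hp : x.ctx.positive = p.isOut)
    (hy : Reach G ⟨t, y.edge, y.stack, y.ctx⟩) : Reach G ⟨t, x.edge, x.stack, x.ctx⟩ :=
  Rule.reach_of_singleton (x := ⟨t, y.edge, y.stack, y.ctx⟩) (.link (Or.inl h) hp rfl) hy

theorem Wire.reach_right {v : G.V} {p q : Port} {x y : Cfg G} {t : Σ a, AlgTerm (𝒜 a)}
    (h : Wire (Reach G) v p x q y) (hq : y.ctx.positive = q.isOut)
    (hx : Reach G ⟨t, x.edge, x.stack, x.ctx⟩) : Reach G ⟨t, y.edge, y.stack, y.ctx⟩ :=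
  Rule.reach_of_singleton (x := ⟨t, x.edge, x.stack, x.ctx⟩) (.link (Or.inr h) hq rfl) hx

theorem Step.reach {l l' : Lab G} (h : Step G l l') (hl' : Reach G l') : Reach G l := by
  rcases h with ⟨hv, hP⟩ | ⟨hv, hP⟩ | ⟨hv, hP⟩ | ⟨hv, hP⟩ | ⟨hv, hP⟩ | ⟨hv, hP⟩ | ⟨hv, hP⟩ |
    ⟨hv, hP⟩ | hv | hv
  · exact (Wire.lamVar hv).reach_left hP.1 hl'
  · exact (Wire.lamVar hv).reach_right (by simp [TyCtx.positive, hP.1, Port.isOut]) hl'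
  · exact (Wire.lamBody hv).reach_right hP.1 hl'
  · exact (Wire.lamBody hv).reach_left hP.1 hl'
  · exact (Wire.appArg hv).reach_right (by simp [TyCtx.positive, hP.1, Port.isOut]) hl'
  · exact (Wire.appArg hv).reach_left hP.1 hl'
  · exact (Wire.appOut hv).reach_right hP.1 hl'
  · exact (Wire.appOut hv).reach_left hP.1 hl'
  · exact Rule.reach_of_singleton (.dupL hv) hl'
  · exact Rule.reach_of_singleton (.dupR hv) hl'

/-- For the subterms `t_j` passed to a branch, the subtree `B(T, u, t_j)` is disregarded: the label
is derived from the label on `e₀` instead, whose term has `t_j` as a subterm. This is all that the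
count of sizes needs. -/
theorem IGraph.WF.reach_label (hG : G.WF A D B I) {T : Tree G} (h : InT G T) :
    Reach G T.label := by
  induction h with
  | step hT h ih => exact h.reach ih
  | @con_zero w a c e ts f hw hc hbox =>
    have hn := hG.ok w
    rw [hw] at hn
    obtain ⟨i, hi⟩ := hn
    have h := Rule.con (R := Reach G) (U := []) (ts := ts) hw hi fun _ => Or.inl ⟨hbox, rfl⟩
    -- `Rule.con` treats all arities uniformly; for arity zero its type context is the hole and it
    -- has no premises.
    have : TyCtx.arrows ((𝒜 a).arity c) (.base a i) .hole = TyCtx.hole (𝒜 := 𝒜) := by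
      rw [hc]; rfl
    rw [this] at h
    refine h.reach ?_
    rintro _ ⟨j, rfl⟩
    exact absurd j.2 (by omega)
  | @con_zero_box w a c e ts f v e₀ b u t U T₀ hw hc hbox hv hT₀ hl₀ ih =>
    have hn := hG.ok w
    rw [hw] at hn
    obtain ⟨i, hi⟩ := hn
    have h := Rule.con (R := Reach G) (U := ⟨b, u, t, v⟩ :: U) (ts := ts) hw hi fun _ =>
      Or.inr ⟨v, e₀, b, u, t, U, hbox, hv, hl₀ ▸ ih, rfl⟩
    have : TyCtx.arrows ((𝒜 a).arity c) (.base a i) .hole = TyCtx.hole (𝒜 := 𝒜) := by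
      rw [hc]; rfl
    rw [this] at h
    refine h.reach ?_
    rintro _ ⟨j, rfl⟩
    exact absurd j.2 (by omega)
  | con_succ hw hc he hf hl ih =>
    refine (Rule.con hw he fun h => absurd h hc.ne').reach ?_
    rintro _ ⟨j, rfl⟩
    have := ih j
    rwa [hl j] at this
  | cond_out hv hT₀ hl₀ hT hl hP ih₀ ih =>
    rw [hl₀] at ih₀
    rw [hl] at ih
    exact (Wire.cond hv ih₀).reach_left hP.1 ih
  | cond_in hv hT₀ hl₀ hT hl hN ih₀ ih =>
    rw [hl₀] at ih₀
    rw [hl] at ih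
    exact (Wire.cond hv ih₀).reach_right
      (by simp [TyCtx.positive_arrows, hN.1, Port.isOut]) ih
  | cond_arg hv hT₀ hl₀ hS ih₀ =>
    rw [hl₀] at ih₀
    exact Rule.reach_of_singleton (.condArg hv) ih₀
  | rec_up hv hT₀ hl₀ hk hT hl hP ih₀ ih =>
    rw [hl₀] at ih₀
    rw [hl] at ih
    exact (Wire.recCall hv ih₀ hk).reach_left
      (by simp [TyCtx.positive_arrows, TyCtx.positive_argAt, hP.1, Port.isOut]) ih
  | rec_down hv hT₀ hl₀ hk hT hl hN ih₀ ih =>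
    rw [hl₀] at ih₀
    rw [hl] at ih
    exact (Wire.recCall hv ih₀ hk).reach_right
      (by simp [TyCtx.positive_arrows, hN.1, Port.isOut]) ih
  | rec_out hv hT₀ hl₀ hT hl hP ih₀ ih =>
    rw [hl₀] at ih₀
    rw [hl] at ih
    exact (Wire.recOut hv ih₀).reach_left hP.1 ih
  | rec_in hv hT₀ hl₀ hT hl hN ih₀ ih =>
    rw [hl₀] at ih₀
    rw [hl] at ih
    exact (Wire.recOut hv ih₀).reach_right
      (by simp [TyCtx.positive_arrows, hN.1, Port.isOut]) ih
  | rec_arg hv hT₀ hl₀ hS ih₀ =>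
    rw [hl₀] at ih₀
    exact Rule.reach_of_singleton (.recArg hv) ih₀
  | box hw hbox hv hT₀ hl₀ hT hl ih₀ ih =>
    rw [hl₀] at ih₀
    rw [hl] at ih
    exact Rule.reach_of_singleton (.box hw hbox hv ih₀) ih

/-! ### Tiers -/

/-- The base type in the focus of the label has tier `i`. -/
def HasTier (l : Lab G) (i : ℕ) : Prop :=
  G.edgeTy l.edge = l.ctx.fill (.base l.term.1 i)

theorem IGraph.WF.wire_fill (hG : G.WF A D B I) {R : Lab G → Prop} {v : G.V} {p q : Port}
    {x y : Cfg G} (h : Wire R v p x q y) {X : Ty 𝒜} :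
    G.edgeTy x.edge = x.ctx.fill X ↔ G.edgeTy y.edge = y.ctx.fill X := by
  have hn' := hG.ok v
  rcases h with ⟨hn⟩ | ⟨hn⟩ | ⟨hn⟩ | ⟨hn⟩ | ⟨hn, hT⟩ | ⟨hn, hT⟩ | ⟨hn, hT, hk⟩ <;> rw [hn] at hn'
  · simp [hn'.1, TyCtx.fill]
  · simp [hn'.1, TyCtx.fill]
  · simp [hn'.1, TyCtx.fill]
  · simp [hn'.1, TyCtx.fill]
  · simp [hn'.2.1, TyCtx.fill_arrows, Ty.arrows_inj]
  · simp [hn'.2.1, TyCtx.fill_arrows, Ty.arrows_inj]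
  · simp only [hn'.2.1, TyCtx.fill_arrows, Ty.arrows_inj, TyCtx.eq_fill_argAt]

theorem IGraph.WF.link_fill (hG : G.WF A D B I) {R : Lab G → Prop} {v : G.V} {p q : Port}
    {x y : Cfg G} (h : Link R v p x q y) {X : Ty 𝒜} :
    G.edgeTy x.edge = x.ctx.fill X ↔ G.edgeTy y.edge = y.ctx.fill X :=
  h.elim (fun h => hG.wire_fill h) fun h => (hG.wire_fill h).symm

/-- A rule moves the focus between occurrences of one and the same base type, since the types of the
edges at a vertex are built from each other. Thus algebra and tier are constant along derivations.
-/
theorem IGraph.WF.rule_tier (hG : G.WF A D B I) {R : Lab G → Prop} {v : G.V} {p : Port}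
    {ps : Set (Lab G)} {l x : Lab G} (h : Rule R v p ps l) (hx : x ∈ ps) {i : ℕ} :
    x.term.1 = l.term.1 ∧ (HasTier x i ↔ HasTier l i) := by
  have hn' := hG.ok v
  cases h with
  | link h hp ht =>
    obtain rfl := hx
    refine ⟨by rw [ht], ?_⟩
    unfold HasTier
    rw [ht]
    exact (hG.link_fill h).symm
  | dupL hv =>
    obtain rfl := hx
    rw [hv] at hn'
    simp [HasTier, hn'.1]
  | dupR hv =>
    obtain rfl := hx
    rw [hv] at hn'
    simp [HasTier, hn'.2.1]
  | box hw hbox hv h =>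
    obtain rfl := hx
    rw [hw] at hn'
    simp [HasTier, hn'.1]
  | con hw he hU =>
    obtain ⟨j, rfl⟩ := hx
    refine ⟨rfl, ?_⟩
    simp only [HasTier, he, TyCtx.eq_fill_argAt, TyCtx.fill_arrows, Ty.arrows_inj]
  | condArg hv =>
    obtain rfl := hx
    rw [hv] at hn'
    refine ⟨rfl, ?_⟩
    simp only [HasTier, hn'.2.1, TyCtx.eq_fill_argAt]
  | recArg hv =>
    obtain rfl := hx
    rw [hv] at hn'
    refine ⟨rfl, ?_⟩
    simp only [HasTier, hn'.2.1, TyCtx.eq_fill_argAt]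

theorem IGraph.WF.exists_tier (hG : G.WF A D B I) {l : Lab G} (h : Reach G l) :
    ∃ i, HasTier l i := by
  induction hr : rank l using Nat.strong_induction_on generalizing l with
  | _ k ih =>
    subst hr
    obtain ⟨v, p, ps, hrule, hps⟩ := h.exists_rule
    have key : ∀ x ∈ ps, ∃ i, HasTier l i := by
      intro x hx
      obtain ⟨i, hi⟩ := ih _ (hps x hx).2 (hps x hx).1 rfl
      exact ⟨i, (hG.rule_tier hrule hx).2.mp hi⟩
    cases hrule with
    -- A nullary constructor has no premises to inherit a tier from, so the tier is taken from the
    -- type of its edge.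
    | @con _ _ _ i _ _ hw he hU =>
      refine ⟨i, ?_⟩
      simp only [HasTier, he, TyCtx.fill_arrows]
      rfl
    | _ => exact key _ rfl

/-- The tier of the recurrence argument of a vertex `C^R`. -/
def IGraph.tier (G : IGraph Γ) (v : G.V) : ℕ :=
  match G.node v with
  | .recur _ e₀ _ _ => (G.edgeTy e₀).level
  | _ => 0

/-- The rest of the stack from the innermost box of tier at most `i` on. -/
def anchor (i : ℕ) (U : List (Entry G)) : List (Entry G) :=
  U.dropWhile fun x => decide (i < G.tier x.vtx)

theorem anchor_cons_of_lt {i : ℕ} {x : Entry G} {U : List (Entry G)} (h : i < G.tier x.vtx) :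
    anchor i (x :: U) = anchor i U := by
  simp [anchor, h]

theorem anchor_cons_of_le {i : ℕ} {x : Entry G} {U : List (Entry G)} (h : G.tier x.vtx ≤ i) :
    anchor i (x :: U) = x :: U := by
  simp [anchor, h]

theorem anchor_suffix_cons {i : ℕ} {x : Entry G} {U : List (Entry G)} :
    anchor i U <:+ anchor i (x :: U) := by
  rcases lt_or_ge i (G.tier x.vtx) with h | h
  · rw [anchor_cons_of_lt h]
  · rw [anchor_cons_of_le h]
    exact (List.dropWhile_suffix _).trans (List.suffix_cons _ _)

/-- A term of tier `i` passing between copies of a box, or through its conclusion, has its focus in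
the type of the result, so `i` is below the tier of the box. The stack entries for this box are
therefore discarded by `anchor i`. -/
theorem IGraph.WF.wire_anchor (hG : G.WF A D B I) {R : Lab G → Prop} {v : G.V} {p q : Port}
    {x y : Cfg G} (h : Wire R v p x q y) {b : Fin n} {i : ℕ}
    (hx : G.edgeTy x.edge = x.ctx.fill (.base b i)) : anchor i x.stack = anchor i y.stack := by
  have hn' := hG.ok v
  have htier : ∀ {a e₀ es g P}, G.node v = .recur a e₀ es g →
      G.edgeTy g = TyCtx.fill P (.base b i) → i < G.tier v := by
    intro a e₀ es g P hn hg
    rw [hn] at hn'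
    obtain ⟨⟨m, h1, h2, -⟩, -⟩ := hn'
    simp only [IGraph.tier, hn, h1, Ty.level]
    refine lt_of_le_of_lt ?_ h2
    rw [hg]
    exact TyCtx.le_level_fill
  rcases h with ⟨hn⟩ | ⟨hn⟩ | ⟨hn⟩ | ⟨hn⟩ | ⟨hn, hT⟩ | ⟨hn, hT⟩ | ⟨hn, hT, hk⟩
  · rfl
  · rfl
  · rfl
  · rfl
  · rfl
  · exact (anchor_cons_of_lt (htier hn hx)).symm
  · rw [hn] at hn'
    simp only [hn'.2.1, TyCtx.fill_arrows, Ty.arrows_inj, TyCtx.eq_fill_argAt] at hx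
    exact (anchor_cons_of_lt (htier hn hx)).trans (anchor_cons_of_lt (htier hn hx)).symm

/-- Links preserve the anchor. The other rules that change the stack lead into a box, from outside
through a `P^R` or from the recurrence argument, and can only add an entry. -/
theorem IGraph.WF.rule_anchor (hG : G.WF A D B I) {R : Lab G → Prop} {v : G.V} {p : Port}
    {ps : Set (Lab G)} {l x : Lab G} (h : Rule R v p ps l) (hx : x ∈ ps) {i : ℕ}
    (hi : HasTier l i) : anchor i x.stack <:+ anchor i l.stack := by
  cases h with
  | link h hp ht =>
    obtain rfl := hx
    rcases h with h | h
    · exact (hG.wire_anchor h hi).symm ▸ List.suffix_rfl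
    · exact (hG.wire_anchor h ((hG.wire_fill h).mpr hi)) ▸ List.suffix_rfl
  | dupL hv => cases hx; exact List.suffix_rfl
  | dupR hv => cases hx; exact List.suffix_rfl
  | box hw hbox hv h => cases hx; exact anchor_suffix_cons
  | con hw he hU =>
    obtain ⟨j, rfl⟩ := hx
    exact List.suffix_rfl
  | condArg hv => cases hx; exact List.suffix_rfl
  | recArg hv => cases hx; exact anchor_suffix_cons

/-! ### Stacks -/

/-- The stacks that go with the edges whose innermost box is `o`. -/
inductive StackValid (G : IGraph Γ) : Option G.V → List (Entry G) → Prop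
  | nil : StackValid G none []
  | cons {v e₀ b u t U} (hv : G.RecPremise v e₀)
      (hR : Reach G ⟨⟨b, AlgCtx.plug u t⟩, e₀, U, .hole⟩)
      (h : StackValid G (G.boxPremise e₀) U) : StackValid G (some v) (⟨b, u, t, v⟩ :: U)

theorem IGraph.RecPremise.unique {v : G.V} {e e' : G.Edge} (h : G.RecPremise v e)
    (h' : G.RecPremise v e') : e = e' := by
  obtain ⟨a, es, g, h⟩ := h
  obtain ⟨a', es', g', h'⟩ := h'
  cases h.symm.trans h'
  rfl

theorem StackValid.tail {v : G.V} {x : Entry G} {U : List (Entry G)}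
    (h : StackValid G (some v) (x :: U)) {e₀ : G.Edge} (hv : G.RecPremise v e₀) :
    StackValid G (G.boxPremise e₀) U := by
  cases h with
  | cons hv' hR h => exact hv.unique hv' ▸ h

/-- The length is the number of boxes around the edge, which depends on the graph only. -/
theorem StackValid.length_eq {o : Option G.V} {U : List (Entry G)} (h : StackValid G o U) :
    ∀ {U'}, StackValid G o U' → U.length = U'.length := by
  induction h with
  | nil =>
    intro U' h'
    cases h'
    rfl
  | cons hv hR h ih =>
    intro U' h'
    cases h' with
    | cons hv' hR' h' =>
      rw [hv.unique hv'] at ih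
      simp [ih h']

theorem IGraph.WF.wire_stack (hG : G.WF A D B I) {v : G.V} {p q : Port}
    {x y : Cfg G} (h : Wire (Reach G) v p x q y) :
    StackValid G (G.boxPremise x.edge) x.stack ↔ StackValid G (G.boxPremise y.edge) y.stack := by
  have hn' := hG.ok v
  rcases h with ⟨hn⟩ | ⟨hn⟩ | ⟨hn⟩ | ⟨hn⟩ | ⟨hn, hT⟩ | ⟨hn, hT⟩ | ⟨hn, hT, hk⟩ <;> rw [hn] at hn'
  · simp [hn'.2]
  · simp [hn'.2]
  · simp [hn'.2]
  · simp [hn'.2]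
  · simp [hn'.2.2]
  · simp only [hn'.2.2]
    have hp : G.RecPremise v _ := ⟨_, _, _, hn⟩
    rw [← hn'.2.2.1]
    exact ⟨fun h => .cons hp hT h, fun h => h.tail hp⟩
  · simp only [hn'.2.2]
    have hp : G.RecPremise v _ := ⟨_, _, _, hn⟩
    refine ⟨fun h => .cons hp ?_ (h.tail hp), fun h => .cons hp hT (h.tail hp)⟩
    rwa [AlgCtx.plug_comp, AlgCtx.plug_arg]

theorem IGraph.WF.stackValid (hG : G.WF A D B I) {l : Lab G} (h : Reach G l) :
    StackValid G (G.boxPremise l.edge) l.stack := by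
  obtain ⟨k, h⟩ := h
  -- The induction is on rounds because it is also needed for the labels in side conditions, which
  -- are not predecessors.
  induction k generalizing l with
  | zero => exact h.elim
  | succ k ih =>
    obtain ⟨v, p, ps, hr, hps⟩ := h
    have hn' := hG.ok v
    cases hr with
    | link h hp ht =>
      have := ih (hps _ rfl)
      rcases h.mono fun _ => Derivable.reach with h | h
      · exact (hG.wire_stack h).mpr this
      · exact (hG.wire_stack h).mp this
    | dupL hv =>
      rw [hv] at hn'
      have := ih (hps _ rfl)
      simpa [hn'.2.2.2] using this
    | dupR hv =>
      rw [hv] at hn'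
      have := ih (hps _ rfl)
      simpa [hn'.2.2.2] using this
    | box hw hbox hv hR =>
      simp only [hbox]
      exact .cons hv hR.reach (ih hR)
    | @con a c e i U ts hw he hU =>
      by_cases hc : (𝒜 a).arity c = 0
      · rcases hU hc with ⟨h1, h2⟩ | ⟨v, e₀, b, u, t, U', h1, h2, h3, h4⟩
        · simp only [h1, h2]
          exact .nil
        · simp only [h1, h4]
          exact .cons h2 h3.reach (ih h3)
      · have := ih (hps _ ⟨⟨0, Nat.pos_of_ne_zero hc⟩, rfl⟩)
        exact this
    | condArg hv =>
      rw [hv] at hn'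
      have := ih (hps _ rfl)
      simpa [hn'.2.2] using this
    | recArg hv =>
      rw [hv] at hn'
      simp only [hn'.2.2]
      exact .cons ⟨_, _, _, hv⟩ (hps _ rfl).reach (ih (hps _ rfl))

/-! ### The labels that a label depends on -/

def Lab.size (l : Lab G) : ℕ := l.term.2.size

/-- `x` occurs in the derivation of `l`. -/
def Anc (G : IGraph Γ) (x l : Lab G) : Prop := Relation.ReflTransGen (Pred G) x l

theorem IGraph.WF.pred_iff (hG : G.WF A D B I) {v : G.V} {p : Port} {ps : Set (Lab G)}
    {x l : Lab G} (h : Rule (Reach G) v p ps l) (hps : ∀ y ∈ ps, Reach G y) :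
    Pred G x l ↔ x ∈ ps := by
  refine ⟨?_, fun hx => ⟨v, p, ps, h, hps, hx⟩⟩
  rintro ⟨v', p', ps', h', hps', hx⟩
  obtain ⟨-, -, rfl⟩ := hG.rule_unique h hps h' hps'
  exact hx

theorem Anc.reach {x l : Lab G} (h : Anc G x l) (hl : Reach G l) : Reach G x := by
  induction h using Relation.ReflTransGen.head_induction_on with
  | refl => exact hl
  | head h _ _ => exact h.reach

theorem IGraph.WF.rank_le (hG : G.WF A D B I) {x l : Lab G} (h : Anc G x l) (hl : Reach G l) :
    rank x ≤ rank l := by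
  induction h using Relation.ReflTransGen.head_induction_on with
  | refl => exact le_rfl
  | head h h' ih => exact (hG.rank_lt (Anc.reach h' hl) h).le.trans ih

/-- Every rule has finitely many premises, and these have smaller rank. -/
theorem IGraph.WF.finite_anc (hG : G.WF A D B I) {l : Lab G} (hl : Reach G l) :
    {x | Anc G x l}.Finite := by
  induction hr : rank l using Nat.strong_induction_on generalizing l with
  | _ k ih =>
    subst hr
    obtain ⟨v, p, ps, h, hps⟩ := hl.exists_rule
    refine ((Set.finite_singleton l).union (h.finite.biUnion fun x hx =>
      ih _ (hps x hx).2 (hps x hx).1 rfl)).subset fun x hx => ?_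
    rcases Relation.ReflTransGen.cases_tail hx with rfl | ⟨y, hxy, hy⟩
    · exact Or.inl rfl
    · exact Or.inr (Set.mem_biUnion ((hG.pred_iff h fun x hx => (hps x hx).1).mp hy) hxy)

theorem IGraph.WF.anc_invariant (hG : G.WF A D B I) {x l : Lab G} (h : Anc G x l) {i : ℕ}
    (hi : HasTier l i) :
    x.term.1 = l.term.1 ∧ HasTier x i ∧ anchor i x.stack <:+ anchor i l.stack := by
  induction h using Relation.ReflTransGen.head_induction_on with
  | refl => exact ⟨rfl, hi, List.suffix_rfl⟩
  | head h _ ih =>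
    obtain ⟨v, p, ps, hr, -, hx⟩ := h
    obtain ⟨h1, h2, h3⟩ := ih
    obtain ⟨h4, h5⟩ := hG.rule_tier hr hx (i := i)
    exact ⟨h4.trans h1, h5.mpr h2, (hG.rule_anchor hr hx h2).trans h3⟩

/-! ### The consumers of a label -/

/-- `Enters R v q x l`: the label `l` is derived from `x`, among others, at the vertex `v`, which
the term of `x` enters through the port `q`. -/
inductive Enters (R : Lab G → Prop) : G.V → Port → Lab G → Lab G → Prop
  | link {v q p x l} (h : Link R v q x.cfg p l.cfg) (ht : l.term = x.term) : Enters R v q x l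
  | dup {v e g h t U l} (hv : G.node v = .dup e g h) : Enters R v .dupIn ⟨t, h, U, .hole⟩ l
  | box {w a e g t U l} (hw : G.node w = .boxPrem a e g) : Enters R w .boxIn ⟨t, e, U, .hole⟩ l
  | con {w a c e i U ts j} (hw : G.node w = .con a c e)
      (he : G.edgeTy e = Ty.arrows ((𝒜 a).arity c) (.base a i) (.base a i)) :
      Enters R w .con ⟨⟨a, ts j⟩, e, U, TyCtx.argAt (.base a i) j .hole (.base a i)⟩
        ⟨⟨a, .mk c ts⟩, e, U, TyCtx.arrows ((𝒜 a).arity c) (.base a i) .hole⟩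
  | condArg {v a e₀ es g} {c : Fin (𝒜 a).k} {ts U} {j : Fin ((𝒜 a).arity c)}
      (hv : G.node v = .cond a e₀ es g) :
      Enters R v .condArg ⟨⟨a, .mk c ts⟩, e₀, U, .hole⟩
        ⟨⟨a, ts j⟩, es c, U, TyCtx.argAt (G.edgeTy e₀) j .hole (G.edgeTy g)⟩
  | recArg {v a e₀ es g} {c : Fin (𝒜 a).k} {ts U} {u : AlgCtx (𝒜 a)}
      {j : Fin ((𝒜 a).arity c)} (hv : G.node v = .recur a e₀ es g) :
      Enters R v .recArg ⟨⟨a, u.plug (.mk c ts)⟩, e₀, U, .hole⟩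
        ⟨⟨a, ts j⟩, es c, ⟨a, u, .mk c ts, v⟩ :: U, TyCtx.argAt (G.edgeTy e₀) j .hole
          (Ty.arrows ((𝒜 a).arity c) (G.edgeTy g) (G.edgeTy g))⟩

theorem Rule.exists_enters {R : Lab G → Prop} {v : G.V} {p : Port} {ps : Set (Lab G)}
    {x l : Lab G} (h : Rule R v p ps l) (hx : x ∈ ps) :
    ∃ q, (G.node v).At q x.edge ∧ x.ctx.positive = (!q.isOut) ∧ Enters R v q x l := by
  cases h with
  | link h hp ht =>
    obtain rfl := hx
    exact ⟨_, h.at_right, h.parity hp, .link h.symm ht⟩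
  | dupL hv =>
    obtain rfl := hx
    exact ⟨.dupIn, by simp [hv, Node.At], rfl, .dup hv⟩
  | dupR hv =>
    obtain rfl := hx
    exact ⟨.dupIn, by simp [hv, Node.At], rfl, .dup hv⟩
  | box hw hbox hv h =>
    obtain rfl := hx
    exact ⟨.boxIn, by simp [hw, Node.At], rfl, .box hw⟩
  | con hw he hU =>
    obtain ⟨j, rfl⟩ := hx
    exact ⟨.con, by simp [hw, Node.At], by simp [TyCtx.positive_argAt, TyCtx.positive, Port.isOut],
      .con hw he⟩
  | condArg hv =>
    obtain rfl := hx
    exact ⟨.condArg, by simp [hv, Node.At], rfl, .condArg hv⟩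
  | recArg hv =>
    obtain rfl := hx
    exact ⟨.recArg, by simp [hv, Node.At], rfl, .recArg hv⟩

theorem Enters.of_con {R : Lab G → Prop} {v : G.V} {q : Port} {x l : Lab G}
    (h : Enters R v q x l) (hq : q = .con) : ∃ a c e i U ts j, G.node v = .con a c e ∧
      G.edgeTy e = Ty.arrows ((𝒜 a).arity c) (.base a i) (.base a i) ∧
      x = ⟨⟨a, ts j⟩, e, U, TyCtx.argAt (.base a i) j .hole (.base a i)⟩ ∧
      l = ⟨⟨a, .mk c ts⟩, e, U, TyCtx.arrows ((𝒜 a).arity c) (.base a i) .hole⟩ := by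
  cases h with
  | link h ht => exact absurd hq h.port_ne.2.2.2.1
  | con hw he => exact ⟨_, _, _, _, _, _, _, hw, he, rfl, rfl⟩
  | _ => simp at hq

theorem Enters.of_condArg {R : Lab G → Prop} {v : G.V} {q : Port} {x l : Lab G}
    (h : Enters R v q x l) (hq : q = .condArg) : ∃ a e₀ es g, ∃ c : Fin (𝒜 a).k,
      ∃ ts U j, G.node v = .cond a e₀ es g ∧ x = ⟨⟨a, .mk c ts⟩, e₀, U, .hole⟩ ∧
      l = ⟨⟨a, ts j⟩, es c, U, TyCtx.argAt (G.edgeTy e₀) j .hole (G.edgeTy g)⟩ := by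
  cases h with
  | link h ht => exact absurd hq h.port_ne.2.2.2.2.1
  | condArg hv => exact ⟨_, _, _, _, _, _, _, _, hv, rfl, rfl⟩
  | _ => simp at hq

theorem Enters.of_recArg {R : Lab G → Prop} {v : G.V} {q : Port} {x l : Lab G}
    (h : Enters R v q x l) (hq : q = .recArg) : ∃ a e₀ es g, ∃ c : Fin (𝒜 a).k,
      ∃ ts U, ∃ u : AlgCtx (𝒜 a), ∃ j, G.node v = .recur a e₀ es g ∧
      x = ⟨⟨a, u.plug (.mk c ts)⟩, e₀, U, .hole⟩ ∧
      l = ⟨⟨a, ts j⟩, es c, ⟨a, u, .mk c ts, v⟩ :: U, TyCtx.argAt (G.edgeTy e₀) j .hole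
          (Ty.arrows ((𝒜 a).arity c) (G.edgeTy g) (G.edgeTy g))⟩ := by
  cases h with
  | link h ht => exact absurd hq h.port_ne.2.2.2.2.2.1
  | recArg hv => exact ⟨_, _, _, _, _, _, _, _, _, hv, rfl, rfl⟩
  | _ => simp at hq

theorem AlgTerm.sum_size_lt {C : FreeAlg} {c : Fin C.k} {ts : Fin (C.arity c) → AlgTerm C} :
    ∑ j, (ts j).size < (AlgTerm.mk c ts).size := by
  rw [AlgTerm.size]
  omega

theorem AlgTerm.arg_size_lt {C : FreeAlg} {c : Fin C.k} {ts : Fin (C.arity c) → AlgTerm C}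
    {j : Fin (C.arity c)} : (ts j).size < (AlgTerm.mk c ts).size :=
  (Finset.single_le_sum (f := fun j => (ts j).size) (fun _ _ => Nat.zero_le _)
    (Finset.mem_univ j)).trans_lt AlgTerm.sum_size_lt

theorem sum_image_min_le {r N : ℕ} {f : Fin r → Lab G} [DecidableEq (Lab G)]
    {x : Lab G} (h : ∑ j, (f j).size ≤ N) :
    ∑ l ∈ Finset.univ.image f, min x.size l.size ≤ N :=
  (Finset.sum_image_le_of_nonneg fun _ _ => Nat.zero_le _).trans
    ((Finset.sum_le_sum fun _ _ => min_le_right _ _).trans h)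

theorem IGraph.WF.tier_eq (hG : G.WF A D B I) {v : G.V} {a : Fin n} {e₀ : G.Edge}
    {es : Fin (𝒜 a).k → G.Edge} {g : G.Edge} (hv : G.node v = .recur a e₀ es g) :
    G.edgeTy e₀ = .base a (G.tier v) ∧ G.tier v ≤ I := by
  have h := hG.ok v
  rw [hv] at h
  obtain ⟨⟨m, h1, -, h2⟩, -⟩ := h
  simp only [IGraph.tier, hv, h1, Ty.level, h2, and_self]

/-- Consumers of a label whose type cannot be duplicated: all of them together use its term at
most once. -/
theorem IGraph.WF.sum_consumers_le_of_not_dup (hG : G.WF A D B I) {E : Finset (Lab G)}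
    {x : Lab G} {i : ℕ} {α : List (Entry G)} (hxi : HasTier x i)
    (hD : Ty.base x.term.1 i ∉ D)
    (hE : ∀ l ∈ E, Pred G x l ∧ Reach G l ∧ anchor i l.stack <:+ α) :
    ∑ l ∈ E, min x.size l.size ≤ x.size := by
  classical
  -- It is convenient to enlarge `E` to the labels of all the arguments of one constructor, whether
  -- or not they are consumers.
  suffices key : ∃ F : Finset (Lab G), E ⊆ F ∧ ∑ l ∈ F, min x.size l.size ≤ x.size by
    obtain ⟨F, hF, h⟩ := key
    exact (Finset.sum_le_sum_of_subset hF).trans h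
  rcases E.eq_empty_or_nonempty with rfl | ⟨l₀, hl₀⟩
  · exact ⟨∅, subset_rfl, by simp⟩
  obtain ⟨⟨v, p, ps, hr, hps, hx⟩, hl₀R, hl₀α⟩ := hE l₀ hl₀
  obtain ⟨q, hq1, hq2, hen⟩ := hr.exists_enters hx
  have hE' : ∀ l ∈ E, Enters (Reach G) v q x l ∧ Reach G l ∧ anchor i l.stack <:+ α := by
    intro l hl
    obtain ⟨⟨v', p', ps', hr', hps', hx'⟩, h⟩ := hE l hl
    obtain ⟨q', hq1', hq2', hen'⟩ := hr'.exists_enters hx'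
    -- The polarity of the focus tells which end of the edge the term moves to, so all consumers of
    -- `x` sit at one vertex and one port.
    obtain ⟨rfl, rfl⟩ := hG.uniq hq1 hq1' (by
      have := hq2.symm.trans hq2'
      simpa using this)
    exact ⟨hen', h⟩
  clear hE
  have hok := hG.ok v
  have single : (∀ l ∈ E, l = l₀) → ∃ F : Finset (Lab G), E ⊆ F ∧
      ∑ l ∈ F, min x.size l.size ≤ x.size := fun h =>
    ⟨{l₀}, fun l hl => Finset.mem_singleton.mpr (h l hl), by simp⟩
  cases hen with
  | link h ht =>
    refine single fun l hl => ?_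
    obtain ⟨hen', -, -⟩ := hE' l hl
    cases hen' with
    | link h' ht' =>
      exact Lab.eq_of_term_of_cfg (ht'.trans ht.symm) (h'.unique hG.functional h).2
    | dup hv => exact absurd rfl h.port_ne.2.2.2.2.2.2.1
    | box hw => exact absurd rfl h.port_ne.2.2.2.2.2.2.2
    | con hw he => exact absurd rfl h.port_ne.2.2.2.1
    | condArg hv => exact absurd rfl h.port_ne.2.2.2.2.1
    | recArg hv => exact absurd rfl h.port_ne.2.2.2.2.2.1
  | dup hv =>
    rw [hv] at hok
    refine absurd hok.2.2.1 ?_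
    rwa [show G.edgeTy _ = _ from hxi]
  | box hw =>
    rw [hw] at hok
    refine absurd hok.2.1 ?_
    rwa [← hok.1, show G.edgeTy _ = _ from hxi]
  | con hw he =>
    refine single fun l hl => ?_
    obtain ⟨hen', hlR, -⟩ := hE' l hl
    obtain ⟨a', c', e', i', U', ts', j', hw', he', hx', rfl⟩ := hen'.of_con rfl
    cases hw.symm.trans hw'
    obtain rfl := Ty.arrows_base_inj (he.symm.trans he')
    simp only [Lab.mk.injEq] at hx'
    refine hG.functional _ _ hlR hl₀R ?_
    rw [Lab.cfg, Lab.cfg, hx'.2.2.1]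
  | @condArg a e₀ es g c ts U j hv =>
    let f : Fin ((𝒜 a).arity c) → Lab G := fun j =>
      ⟨⟨a, ts j⟩, es c, U, TyCtx.argAt (G.edgeTy e₀) j .hole (G.edgeTy g)⟩
    refine ⟨Finset.univ.image f, fun l hl => ?_, sum_image_min_le AlgTerm.sum_size_lt.le⟩
    obtain ⟨hen', -, -⟩ := hE' l hl
    obtain ⟨a', e₀', es', g', c', ts', U', j', hv', hx', rfl⟩ := hen'.of_condArg rfl
    cases hv.symm.trans hv'
    cases hx'
    exact Finset.mem_image_of_mem f (Finset.mem_univ j')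
  | @recArg a e₀ es g c ts U u j hv =>
    let f : Fin ((𝒜 a).arity c) → Lab G := fun j =>
      ⟨⟨a, ts j⟩, es c, ⟨a, u, .mk c ts, v⟩ :: U, TyCtx.argAt (G.edgeTy e₀) j .hole
          (Ty.arrows ((𝒜 a).arity c) (G.edgeTy g) (G.edgeTy g))⟩
    refine ⟨Finset.univ.image f, fun l hl => ?_, sum_image_min_le
      (AlgTerm.sum_size_lt.le.trans (AlgCtx.size_le_plug _ _))⟩
    obtain ⟨hen', -, hlα⟩ := hE' l hl
    obtain ⟨a', e₀', es', g', c', ts', U', u', j', hv', hx', rfl⟩ := hen'.of_recArg rfl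
    cases hv.symm.trans hv'
    -- At a recursion different copies of the box receive nested subterms, whose sizes could add up
    -- to more than that of `x`. But `x` is the recurrence argument, so the box has tier exactly `i`
    -- and its entry belongs to the anchor. Suffixes of `α` of equal length coincide, hence all
    -- consumers lie in one copy.
    have hi : G.tier v = i := by
      have := (hG.tier_eq hv).1.symm.trans hxi
      exact (Ty.base.inj this).2
    rw [anchor_cons_of_le hi.le] at hlα hl₀α
    simp only [Lab.mk.injEq] at hx'
    obtain rfl : U = U' := hx'.2.2.1
    have := (List.suffix_of_suffix_length_le hlα hl₀α (by simp)).eq_of_length (by simp)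
    simp only [List.cons.injEq, Entry.mk.injEq, heq_eq_eq, and_true, true_and] at this
    obtain ⟨rfl, h⟩ := this
    cases h
    exact Finset.mem_image_of_mem f (Finset.mem_univ j')

theorem FreeAlg.IsWord.arity_le {C : FreeAlg} (h : C.IsWord) (c : Fin C.k) : C.arity c ≤ 1 := by
  obtain ⟨i, hi, h⟩ := h
  by_cases hc : c = i
  · rw [hc, hi]
    exact zero_le_one
  · exact (h c hc).le

/-- Constructor rules are the only ones with several premises, and constructors of word algebras
have at most one argument. -/
theorem IGraph.WF.pred_unique (hG : G.WF A D B I) {x y l : Lab G} (hw : (𝒜 l.term.1).IsWord)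
    (hx : Pred G x l) (hy : Pred G y l) : x = y := by
  obtain ⟨v, p, ps, h, hps, hx⟩ := hx
  rw [hG.pred_iff h hps] at hy
  cases h with
  | @con _ c _ _ _ _ hn he hU =>
    obtain ⟨j, rfl⟩ := hx
    obtain ⟨j', rfl⟩ := hy
    have := hw.arity_le c
    dsimp only at this
    rw [show j = j' from Fin.ext (by omega)]
  | _ => exact (Set.mem_singleton_iff.mp hx).trans (Set.mem_singleton_iff.mp hy).symm

/-- For word algebras, the derivation of a label is a path, in which every label has at most one
consumer. -/
theorem IGraph.WF.sum_consumers_le_of_word (hG : G.WF A D B I) {E : Finset (Lab G)}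
    {x r : Lab G} {i : ℕ} (hr : HasTier r i) (hw : (𝒜 r.term.1).IsWord)
    (hE : ∀ l ∈ E, Pred G x l ∧ Reach G l ∧ Anc G l r) :
    ∑ l ∈ E, min x.size l.size ≤ x.size := by
  have hword : ∀ {y}, Anc G y r → (𝒜 y.term.1).IsWord := fun h =>
    (hG.anc_invariant h hr).1 ▸ hw
  let S : Lab G → Lab G → Prop := fun l y => Pred G y l ∧ (𝒜 l.term.1).IsWord
  have hS : Relator.RightUnique S := fun _ _ _ h h' => hG.pred_unique h.2 h.1 h'.1
  have hchain : ∀ {y}, Anc G y r → Relation.ReflTransGen S r y := by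
    intro y h
    induction h using Relation.ReflTransGen.head_induction_on with
    | refl => exact .refl
    | head h h' ih => exact ih.tail ⟨h, hword h'⟩
  -- If one consumer `l'` lies strictly above another one `l` on the way from `r` to the leaf, then
  -- it is an ancestor of the only predecessor `x` of `l`. As `x` is also a predecessor of `l'`, the
  -- ranks contradict each other.
  have heq : ∀ {l l'}, l ∈ E → l' ∈ E → Relation.ReflTransGen S l l' → l = l' := by
    intro l l' hl hl' h
    obtain ⟨hxl, hlR, hlr⟩ := hE l hl
    obtain ⟨hxl', hlR', -⟩ := hE l' hl'
    rcases Relation.ReflTransGen.cases_head h with rfl | ⟨y, hy, hyl'⟩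
    · rfl
    · obtain rfl := hG.pred_unique (hword hlr) hxl hy.1
      have hanc : Anc G l' x := by
        clear h hl hl' hxl hxl' hlR hlr hlR' hy
        induction hyl' with
        | refl => exact .refl
        | tail _ h ih => exact Relation.ReflTransGen.head h.1 ih
      exact absurd (hG.rank_lt hlR' hxl') (hG.rank_le hanc hxl.reach).not_gt
  have hsub : ∀ l ∈ E, ∀ l' ∈ E, l = l' := fun l hl l' hl' =>
    ((hchain (hE l hl).2.2).total_of_right_unique hS (hchain (hE l' hl').2.2)).elim
      (heq hl hl') fun h => (heq hl' hl h).symm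
  rcases E.eq_empty_or_nonempty with rfl | ⟨l₀, hl₀⟩
  · simp
  · refine (Finset.sum_le_sum_of_subset (t := {l₀}) fun l hl =>
      Finset.mem_singleton.mpr (hsub l hl l₀ hl₀)).trans ?_
    simp

/-! ### Sizes are bounded by the number of constructor labels -/

/-- `l` is derived at a vertex `I^c`. -/
def IsCon (G : IGraph Γ) (l : Lab G) : Prop := ∃ v ps, Rule (Reach G) v .con ps l

theorem Rule.size_le {v : G.V} {p : Port} {ps : Set (Lab G)} {l : Lab G}
    (h : Rule (Reach G) v p ps l) (hp : p ≠ .con) : ∃ x ∈ ps, l.size ≤ x.size := by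
  cases h with
  | link h hp ht => exact ⟨_, rfl, by rw [Lab.size, Lab.size, ht]⟩
  | con hw he hU => exact absurd rfl hp
  | condArg hv => exact ⟨_, rfl, AlgTerm.arg_size_lt.le⟩
  | recArg hv => exact ⟨_, rfl, AlgTerm.arg_size_lt.le.trans (AlgCtx.size_le_plug _ _)⟩
  | _ => exact ⟨_, rfl, le_rfl⟩

-- A constructor adds one to the sizes of its arguments, and every other rule yields the term of a
-- premise or a subterm of it. The minimum charges a premise only for the part that is passed on;
-- without it, passing several subterms would charge the full size each time.
open Classical in
theorem size_le_sum_pred {F : Finset (Lab G)} {l : Lab G} (hl : Reach G l)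
    (hF : ∀ x, Pred G x l → x ∈ F) :
    l.size ≤ (if IsCon G l then 1 else 0) + ∑ x ∈ F with Pred G x l, min x.size l.size := by
  obtain ⟨v, p, ps, h, hps⟩ := hl.exists_rule
  have hpred : ∀ x ∈ ps, Pred G x l := fun x hx => ⟨v, p, ps, h, fun y hy => (hps y hy).1, hx⟩
  by_cases hp : p = .con
  · have hcon : IsCon G l := by
      subst hp
      exact ⟨v, ps, h⟩
    rw [if_pos hcon]
    cases h with
    | link h _ _ => exact absurd hp h.port_ne.2.2.2.1
    | @con a c e i U ts hw he hU =>
      let f : Fin ((𝒜 a).arity c) → Lab G := fun j =>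
        ⟨⟨a, ts j⟩, e, U, TyCtx.argAt (.base a i) j .hole (.base a i)⟩
      -- The type contexts tell argument positions apart, so equal arguments of a constructor still
      -- count as distinct labels.
      have hf : Function.Injective f := by
        intro j j' h
        have := congrArg Lab.ctx h
        exact (TyCtx.argAt_inj this).1
      have : ∑ j, (f j).size = ∑ x ∈ Finset.univ.map ⟨f, hf⟩, min x.size
          (Lab.size (⟨⟨a, .mk c ts⟩, e, U, TyCtx.arrows ((𝒜 a).arity c) (.base a i) .hole⟩ :
            Lab G)) := by
        rw [Finset.sum_map]
        exact Finset.sum_congr rfl fun j _ => (min_eq_left AlgTerm.arg_size_lt.le).symm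
      refine (Eq.le ?_).trans (Nat.add_le_add_left (this.le.trans
        (Finset.sum_le_sum_of_subset ?_)) 1)
      · simp only [Lab.size, AlgTerm.size, f]
      · intro x hx
        obtain ⟨j, -, rfl⟩ := Finset.mem_map.mp hx
        have := hpred _ ⟨j, rfl⟩
        exact Finset.mem_filter.mpr ⟨hF _ this, this⟩
    | _ => simp at hp
  · obtain ⟨x, hx, hle⟩ := h.size_le hp
    refine (Nat.le_add_left _ _).trans' ?_
    refine le_trans ?_ (Finset.single_le_sum (f := fun x => min x.size l.size)
      (fun _ _ => Nat.zero_le _) (Finset.mem_filter.mpr ⟨hF x (hpred x hx), hpred x hx⟩))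
    exact le_min hle le_rfl

-- Conservation of flow: the sizes of all ancestors are added up, each bounded by what is created at
-- it and what it takes from its predecessors. After exchanging the sums, each label is charged at
-- most its own size by its consumers, and `r` is not charged at all. All sizes except that of `r`
-- cancel, leaving the number of constructor labels.
open Classical in
theorem IGraph.WF.size_le_card (hG : G.WF A (wordTypes 𝒜) B I) {r : Lab G} (hr : Reach G r)
    {i : ℕ} (hi : HasTier r i) :
    r.size ≤ ((hG.finite_anc hr).toFinset.filter (IsCon G)).card := by
  set F := (hG.finite_anc hr).toFinset with hFdef
  have hmem : ∀ {x}, x ∈ F ↔ Anc G x r := by simp [hFdef]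
  have hrF : r ∈ F := hmem.mpr .refl
  have h1 : ∑ l ∈ F, l.size ≤ (F.filter (IsCon G)).card +
      ∑ l ∈ F, ∑ x ∈ F with Pred G x l, min x.size l.size := by
    rw [Finset.card_filter, ← Finset.sum_add_distrib]
    refine Finset.sum_le_sum fun l hl => size_le_sum_pred ((hmem.mp hl).reach hr) fun x hx => ?_
    exact hmem.mpr (Relation.ReflTransGen.head hx (hmem.mp hl))
  have h2 : ∑ l ∈ F, ∑ x ∈ F with Pred G x l, min x.size l.size =
      ∑ x ∈ F, ∑ l ∈ F with Pred G x l, min x.size l.size := by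
    simp only [Finset.sum_filter]
    exact Finset.sum_comm
  have h3 : ∀ x ∈ F, ∑ l ∈ F with Pred G x l, min x.size l.size ≤ x.size := by
    intro x hx
    by_cases hw : (𝒜 r.term.1).IsWord
    · refine hG.sum_consumers_le_of_word hi hw fun l hl => ?_
      obtain ⟨hl, hxl⟩ := Finset.mem_filter.mp hl
      exact ⟨hxl, (hmem.mp hl).reach hr, hmem.mp hl⟩
    · obtain ⟨h1, h2, -⟩ := hG.anc_invariant (hmem.mp hx) hi
      refine hG.sum_consumers_le_of_not_dup (α := anchor i r.stack) h2 ?_ fun l hl => ?_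
      -- Only types of word algebras may be duplicated, and the algebra of `x` is that of `r`.
      · rintro ⟨a, j, ha, h⟩
        rw [h1] at h
        rw [(Ty.base.inj h).1] at hw
        exact hw ha
      · obtain ⟨hl, hxl⟩ := Finset.mem_filter.mp hl
        exact ⟨hxl, (hmem.mp hl).reach hr, (hG.anc_invariant (hmem.mp hl) hi).2.2⟩
  -- A consumer of `r` among the ancestors of `r` would close a cycle.
  have h4 : ∑ l ∈ F with Pred G r l, min r.size l.size = 0 := by
    refine Finset.sum_eq_zero fun l hl => ?_
    obtain ⟨hl, hrl⟩ := Finset.mem_filter.mp hl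
    have hl := hmem.mp hl
    exact absurd (hG.rank_lt (hl.reach hr) hrl) (hG.rank_le hl hr).not_gt
  have h5 := Finset.sum_le_sum fun x (hx : x ∈ F.erase r) => h3 x (Finset.mem_of_mem_erase hx)
  rw [h2, ← Finset.add_sum_erase F _ hrF, ← Finset.add_sum_erase F _ hrF, h4] at h1
  omega

/-! ### Counting stacks and constructor labels -/

/-- The terms in the recurrence arguments of tier above `i` have size at most `N`. -/
def SizeBound (G : IGraph Γ) (i N : ℕ) : Prop :=
  ∀ {v e₀ t U}, i < G.tier v → G.RecPremise v e₀ → Reach G ⟨t, e₀, U, .hole⟩ → t.2.size ≤ N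

/-- Once the rest `U` of the stack is known, the recurrence argument is unique by determinism, and
an entry is a choice of a subterm occurrence in it. -/
theorem IGraph.WF.exists_entries (hG : G.WF A D B I) {i N : ℕ} (hN : SizeBound G i N) {v : G.V}
    (hv : i < G.tier v) {e₀ : G.Edge} (he₀ : G.RecPremise v e₀) (U : List (Entry G)) :
    ∃ F : Finset (Entry G), F.card ≤ N ∧
      ∀ b u t, Reach G ⟨⟨b, AlgCtx.plug u t⟩, e₀, U, .hole⟩ → ⟨b, u, t, v⟩ ∈ F := by
  classical
  by_cases h : ∃ b t, Reach G ⟨⟨b, t⟩, e₀, U, .hole⟩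
  · obtain ⟨b, w, hw⟩ := h
    obtain ⟨F, hF, hmem⟩ := w.exists_decompositions
    refine ⟨F.image fun q => ⟨b, q.1, q.2, v⟩,
      Finset.card_image_le.trans (hF.trans (hN hv he₀ hw)), fun b' u t ht => ?_⟩
    have := congrArg Lab.term (hG.functional _ _ ht hw rfl)
    obtain ⟨rfl, h⟩ := Sigma.mk.inj this
    exact Finset.mem_image.mpr ⟨(u, t), hmem u t (eq_of_heq h), rfl⟩
  · exact ⟨∅, Nat.zero_le _, fun b u t ht => absurd ⟨b, _, ht⟩ h⟩

/-- The stack is built from the outermost box inwards. A box of tier above `i` gives at most `N`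
entries over each tail. At a box of tier at most `i` the whole stack is its own anchor, hence a
suffix of `α` of prescribed length, and there is at most one. -/
theorem IGraph.WF.exists_stacks (hG : G.WF A D B I) {i N : ℕ} (hN1 : 1 ≤ N)
    (hN : SizeBound G i N) {α : List (Entry G)} {k : ℕ} {o : Option G.V} (h : BoxDepth G k o) :
    ∃ F : Finset (List (Entry G)), F.card ≤ N ^ k ∧
      ∀ U, StackValid G o U → anchor i U <:+ α → U ∈ F := by
  classical
  induction h with
  | none =>
    refine ⟨{[]}, by simpa using Nat.one_le_pow _ _ hN1, fun U hU _ => ?_⟩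
    cases hU
    exact Finset.mem_singleton_self _
  | @some k v a e₀ es g hv h ih =>
    have he₀ : G.RecPremise v e₀ := ⟨_, _, _, hv⟩
    rcases lt_or_ge i (G.tier v) with hi | hi
    · obtain ⟨F, hF, hmem⟩ := ih
      choose f hf hfmem using hG.exists_entries hN hi he₀
      refine ⟨F.biUnion fun U => (f U).image (· :: U), ?_, fun U hU hα => ?_⟩
      · rw [pow_succ]
        refine (Finset.card_biUnion_le_card_mul _ _ N fun U _ =>
          Finset.card_image_le.trans (hf U)).trans (Nat.mul_le_mul_right _ hF)
      · cases hU with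
        | cons hv' hR hU =>
          obtain rfl := he₀.unique hv'
          rw [anchor_cons_of_lt hi] at hα
          exact Finset.mem_biUnion.mpr ⟨_, hmem _ hU hα,
            Finset.mem_image_of_mem _ (hfmem _ _ _ _ hR)⟩
    · by_cases hex : ∃ U, StackValid G (some v) U ∧ anchor i U <:+ α
      · obtain ⟨U₀, hU₀, hα₀⟩ := hex
        refine ⟨{U₀}, by simpa using Nat.one_le_pow _ _ hN1, fun U hU hα => ?_⟩
        have hlen := hU.length_eq hU₀
        have key : ∀ {U}, StackValid G (some v) U → anchor i U = U := by
          intro U hU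
          cases hU with
          | cons _ _ _ => exact anchor_cons_of_le hi
        rw [key hU] at hα
        rw [key hU₀] at hα₀
        exact Finset.mem_singleton.mpr
          ((List.suffix_of_suffix_length_le hα hα₀ hlen.le).eq_of_length hlen)
      · exact ⟨∅, Nat.zero_le _, fun U hU hα => absurd ⟨U, hU, hα⟩ hex⟩

-- The vertex fixes the edge and the type context of the label, so only the stack is left to choose,
-- and by determinism the term follows. The exponent is the bound on the number of boxes around the
-- edge.
open Classical in
theorem IGraph.WF.card_con_le (hG : G.WF A D B I) {i N : ℕ} (hN1 : 1 ≤ N)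
    (hN : SizeBound G i N) {α : List (Entry G)} {W : Finset G.V}
    (hW : ∀ v a c e, G.node v = .con a c e → v ∈ W) {E : Finset (Lab G)}
    (hE : ∀ l ∈ E, IsCon G l ∧ Reach G l ∧ anchor i l.stack <:+ α) :
    E.card ≤ W.card * N ^ B := by
  have hsub : E ⊆ W.biUnion fun v => E.filter fun l => ∃ ps, Rule (Reach G) v .con ps l := by
    intro l hl
    obtain ⟨⟨v, ps, h⟩, -⟩ := hE l hl
    have hv : ∃ a c e, G.node v = .con a c e := by
      generalize hp : Port.con = p at h
      cases h with
      | link h _ _ => exact absurd hp.symm h.port_ne.2.2.2.1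
      | con hw _ _ => exact ⟨_, _, _, hw⟩
      | _ => simp at hp
    obtain ⟨a, c, e, hv⟩ := hv
    exact Finset.mem_biUnion.mpr ⟨v, hW v a c e hv, Finset.mem_filter.mpr ⟨hl, ps, h⟩⟩
  refine (Finset.card_le_card hsub).trans (Finset.card_biUnion_le_card_mul _ _ _ fun v hv => ?_)
  have shape : ∀ l, (∃ ps, Rule (Reach G) v .con ps l) → ∃ a c e i, G.node v = .con a c e ∧
      G.edgeTy e = Ty.arrows ((𝒜 a).arity c) (.base a i) (.base a i) ∧
      l.edge = e ∧ l.ctx = TyCtx.arrows ((𝒜 a).arity c) (.base a i) .hole := by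
    rintro l ⟨ps, h⟩
    generalize hp : Port.con = p at h
    cases h with
    | link h _ _ => exact absurd hp.symm h.port_ne.2.2.2.1
    | con hw he _ => exact ⟨_, _, _, _, hw, he, rfl, rfl⟩
    | _ => simp at hp
  rcases (E.filter fun l => ∃ ps, Rule (Reach G) v .con ps l).eq_empty_or_nonempty with h0 | ⟨l₀, hl₀⟩
  · rw [h0]
    exact Nat.zero_le _
  obtain ⟨a, c, e, j, hv, he, -, -⟩ := shape l₀ (Finset.mem_filter.mp hl₀).2
  have shape' : ∀ l, (∃ ps, Rule (Reach G) v .con ps l) → l.edge = e ∧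
      l.ctx = TyCtx.arrows ((𝒜 a).arity c) (.base a j) .hole := by
    intro l hl
    obtain ⟨a', c', e', j', hv', he', h1, h2⟩ := shape l hl
    cases hv.symm.trans hv'
    obtain rfl := Ty.arrows_base_inj (he.symm.trans he')
    exact ⟨h1, h2⟩
  obtain ⟨F, hF, hmem⟩ := hG.exists_stacks hN1 hN (α := α) (hG.depth e)
  refine (Finset.card_le_card_of_injOn Lab.stack (fun l hl => ?_) fun l hl l' hl' h => ?_).trans hF
  · obtain ⟨hl, hl'⟩ := Finset.mem_filter.mp hl
    obtain ⟨-, hlR, hlα⟩ := hE l hl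
    exact hmem _ ((shape' l hl').1 ▸ hG.stackValid hlR) hlα
  · obtain ⟨hl, hlp⟩ := Finset.mem_filter.mp hl
    obtain ⟨hl', hlp'⟩ := Finset.mem_filter.mp hl'
    obtain ⟨h1, h2⟩ := shape' l hlp
    obtain ⟨h1', h2'⟩ := shape' l' hlp'
    refine hG.functional _ _ (hE l hl).2.1 (hE l' hl').2.1 ?_
    rw [Lab.cfg, Lab.cfg, h1, h1', h2, h2', h]

theorem IGraph.WF.size_le (hG : G.WF A (wordTypes 𝒜) B I) {W : Finset G.V}
    (hW : ∀ v a c e, G.node v = .con a c e → v ∈ W) {i N : ℕ} (hN1 : 1 ≤ N)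
    (hN : SizeBound G i N) {l : Lab G} (hl : Reach G l) (hi : HasTier l i) :
    l.size ≤ W.card * N ^ B := by
  classical
  refine (hG.size_le_card hl hi).trans
    (hG.card_con_le hN1 hN (α := anchor i l.stack) hW fun x hx => ?_)
  obtain ⟨hx, hcon⟩ := Finset.mem_filter.mp hx
  have hx : Anc G x l := by simpa using hx
  exact ⟨hcon, hx.reach hl, (hG.anc_invariant hx hi).2.2⟩

/-- Descending induction on the tier, where `k` bounds the distance to the highest one: recurrence
arguments in boxes of tier above `i` are terms of that higher tier, so the induction hypothesis
bounds them. -/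
theorem IGraph.WF.size_le_pow (hG : G.WF A (wordTypes 𝒜) B I) {W : Finset G.V}
    (hW : ∀ v a c e, G.node v = .con a c e → v ∈ W) {s : ℕ} (hs : 1 ≤ s) (hWs : W.card ≤ s)
    (k : ℕ) : ∀ {i : ℕ} {l : Lab G}, Reach G l → HasTier l i → I ≤ i + k →
      l.size ≤ s ^ (1 + B) ^ k := by
  induction k with
  | zero =>
    intro i l hl hi hk
    -- No box has tier above `i`, so `SizeBound` is vacuous and `N = 1` will do.
    refine (hG.size_le hW le_rfl (fun hv he₀ _ => ?_) hl hi).trans (by simpa using hWs)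
    obtain ⟨a, es, g, he₀⟩ := he₀
    exact absurd ((hG.tier_eq he₀).2.trans hk) hv.not_ge
  | succ k ih =>
    intro i l hl hi hk
    have hN : SizeBound G i (s ^ (1 + B) ^ k) := by
      intro v e₀ t U hv he₀ ht
      obtain ⟨a, es, g, he₀⟩ := he₀
      obtain ⟨j, hj⟩ := hG.exists_tier ht
      have : G.tier v = j := (Ty.base.inj ((hG.tier_eq he₀).1.symm.trans hj)).2
      exact ih ht hj (by omega)
    refine (hG.size_le hW (Nat.one_le_pow _ _ hs) hN hl hi).trans
      ((Nat.mul_le_mul_right _ hWs).trans ?_)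
    -- The exponent is now `(1 + B) ^ k * B + 1`, and the last `1` is absorbed by `(1 + B) ^ k`.
    rw [← pow_mul, ← pow_succ']
    refine Nat.pow_le_pow_right hs ?_
    have : 1 ≤ (1 + B) ^ k := Nat.one_le_pow _ _ (by omega)
    rw [pow_succ, mul_add, mul_one]
    omega

end Labels

end LinRec

theorem mainTheorem3 {n : ℕ} (𝒜 : Fin n → LinRec.FreeAlg) :
    ∃ p : ℕ → ℕ → Polynomial ℕ,
      ∀ (Γ : LinRec.Ctx 𝒜) (M : LinRec.Term 𝒜) (A : LinRec.Ty 𝒜)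
        (π : LinRec.Deriv (LinRec.RH (LinRec.wordTypes 𝒜)) Γ M A),
        ∀ T ∈ LinRec.trees π.graph,
          T.value.2.size ≤ (p π.highTier π.recDepth).eval M.size := by
  refine ⟨fun d e => Polynomial.X ^ (1 + e) ^ d, fun Γ M A π T hT => ?_⟩
  have hG := LinRec.Deriv.graph_wf (S := LinRec.RH (LinRec.wordTypes 𝒜)) trivial π
  obtain ⟨W, hW, hcard⟩ := LinRec.Deriv.exists_conVertices π
  have hl := hG.reach_label hT
  obtain ⟨i, hi⟩ := hG.exists_tier hl
  rw [Polynomial.eval_pow, Polynomial.eval_X]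
  -- The number of descending steps is taken as the highest tier itself, which suffices whatever the
  -- tier `i` of the label is.
  exact hG.size_le_pow hW M.one_le_size hcard π.highTier hl hi (Nat.le_add_left _ _)
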